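/- Let $K$ be a field of characteristic $0$, let $V_1$ be the $SL_2$-module of binary linear forms over $K$ (with $SL_2=SL_2(K)$ acting by linear substitution), and let $\mathcal I=K[6V_1]^{SL_2}$ be the algebra of $SL_2$-invariant polynomial functions on $6V_1=V_1^{\oplus 6}$, graded by polynomial degree. Then $\mathcal I$ has a finite minimal generating set consisting of homogeneous elements. Let $f_1,\dots,f_m$ be any such set, let $R=K[x_1,\dots,x_m]$ be graded by $\deg x_i=\deg f_i$, and regard $\mathcal I$ as a graded $R$-module through $R\to\mathcal I$, $x_i\mapsto f_i$. Then $\mathcal I$ has a minimal graded free resolution over $R$ of the form $$0\to R(-18)\to R(-14)^{15}\to R(-12)^{35}\to R(-8)^{21}\oplus R(-10)^{21}\to R(-6)^{35}\to R(-4)^{15}\to R\to\mathcal I\to 0,$$ in which $R\to\mathcal I$ is the map above; that is, the sequence is exact, all maps are $R$-linear and homogeneous of degree $0$, and the image of each map between free modules lies in $(x_1,\dots,x_m)$ times its target. This resolution has length $6$, and the homological (projective) dimension of $\mathcal I$ as an $R$-module is $6$. -/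

import Mathlib

open MvPolynomial

universe u

/-- The `SL₂`-module `V_d` of binary forms of degree `d` over `K`. -/
abbrev BinaryForm (K : Type u) [Field K] (d : ℕ) : Type u :=
  homogeneousSubmodule (Fin 2) K d

/-- The action of `SL₂` on binary forms by linear substitution: `(g • p)(x) = p(g⁻¹ x)`. -/
noncomputable def BinaryForm.act {K : Type u} [Field K] {d : ℕ}
    (g : Matrix.SpecialLinearGroup (Fin 2) K) (p : BinaryForm K d) : BinaryForm K d :=
  ⟨aeval (fun i : Fin 2 => ∑ j : Fin 2, C (g⁻¹ i j) * X j) (p : MvPolynomial (Fin 2) K), by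
    rw [mem_homogeneousSubmodule]
    have h := ((mem_homogeneousSubmodule d _).1 p.2).aeval
      (fun i : Fin 2 => ∑ j : Fin 2, C (g⁻¹ i j) * (X j : MvPolynomial (Fin 2) K)) (n := 1)
      (fun i => IsHomogeneous.sum _ _ _ fun j _ => isHomogeneous_C_mul_X _ _)
    simpa using h⟩

/-- Linear coordinates on `n V₁ = V₁ ⊕ ⋯ ⊕ V₁`: the coordinate `(i, j)` of `(ℓ₁, …, ℓₙ)` is the
coefficient of the variable `X j` in the `i`-th linear form. -/
noncomputable def linearFormsCoord {K : Type u} [Field K] {n : ℕ} (v : Fin n → BinaryForm K 1) :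
    Fin n × Fin 2 → K :=
  fun a => coeff (Finsupp.single a.2 1) (v a.1 : MvPolynomial (Fin 2) K)

/-- The algebra `K[n V₁]^{SL₂}`: the polynomial functions on `n V₁` (polynomials in the linear
coordinates) that are constant on the `SL₂`-orbits. -/
noncomputable def linearFormsInvariants (K : Type u) [Field K] (n : ℕ) :
    Subalgebra K (MvPolynomial (Fin n × Fin 2) K) where
  carrier := {f | ∀ (g : Matrix.SpecialLinearGroup (Fin 2) K) (v : Fin n → BinaryForm K 1),
    eval (linearFormsCoord fun i => BinaryForm.act g (v i)) f = eval (linearFormsCoord v) f}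
  mul_mem' := by
    intro a b ha hb g v
    rw [map_mul, map_mul, ha g v, hb g v]
  add_mem' := by
    intro a b ha hb g v
    rw [map_add, map_add, ha g v, hb g v]
  algebraMap_mem' := by
    intro r g v
    simp [algebraMap_eq]

/-- The family `f` of elements of a subalgebra `A` of a polynomial ring is a minimal generating
set of `A` consisting of homogeneous elements, `f i` being of degree `w i`. -/
structure IsMinimalHomogeneousGenerators {K : Type u} [Field K] {τ : Type}
    (A : Subalgebra K (MvPolynomial τ K)) {m : ℕ} (w : Fin m → ℕ) (f : Fin m → A) : Prop where
  homogeneous : ∀ i, (f i : MvPolynomial τ K).IsHomogeneous (w i)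
  generates : Algebra.adjoin K (Set.range f) = ⊤
  minimal : ∀ S : Set (Fin m), Algebra.adjoin K (f '' S) = ⊤ → S = Set.univ

/-- For `R = K[x_i : i ∈ σ]` and a list `e = [e₁, …, e_r]`, the free module
`R(-e₁) ⊕ ⋯ ⊕ R(-e_r)`. -/
abbrev ShiftedFree (K : Type u) [Field K] (σ : Type) (e : List ℕ) : Type u :=
  Fin e.length → MvPolynomial σ K

/-- The graded piece of degree `n` of `R(-e₁) ⊕ ⋯ ⊕ R(-e_r)`, where `x_i` has degree `w i`: every
monomial occurring in the `a`-th entry has weighted degree `n - e_a`. -/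
def IsDegree {K : Type u} [Field K] {σ : Type} (w : σ → ℕ) {e : List ℕ} (n : ℕ)
    (v : ShiftedFree K σ e) : Prop :=
  ∀ a : Fin e.length, ∀ s : σ →₀ ℕ, coeff s (v a) ≠ 0 → Finsupp.weight w s + e.get a = n

/-- A minimal graded free resolution `⋯ → F₂ → F₁ → F₀ → A → 0`, over `R = K[x_i : i ∈ σ]` graded
by `deg x_i = w i`, of a graded subalgebra `A` of a polynomial ring, which is an `R`-module through
`φ : R → A`. The module `F i` is the direct sum of the `R(-j)`, `j` running over the list `e i`. -/
structure MinimalGradedFreeResolution {K : Type u} [Field K] {σ τ : Type} (w : σ → ℕ)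
    (A : Subalgebra K (MvPolynomial τ K)) (φ : MvPolynomial σ K →ₐ[K] A) (e : ℕ → List ℕ) where
  /-- the differentials -/
  d : ∀ i, ShiftedFree K σ (e (i + 1)) →ₗ[MvPolynomial σ K] ShiftedFree K σ (e i)
  /-- the augmentation -/
  ε : ShiftedFree K σ (e 0) →ₛₗ[(φ : MvPolynomial σ K →+* A)] A
  d_graded : ∀ i n v, IsDegree w n v → IsDegree w n (d i v)
  ε_graded : ∀ n v, IsDegree w n v → (ε v : MvPolynomial τ K).IsHomogeneous n
  ε_surjective : Function.Surjective ε
  exact_zero : Function.Exact (d 0) ε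
  exact_succ : ∀ i, Function.Exact (d (i + 1)) (d i)
  minimal : ∀ i, LinearMap.range (d i) ≤
    Ideal.span (Set.range (X : σ → MvPolynomial σ K)) •
      (⊤ : Submodule (MvPolynomial σ K) (ShiftedFree K σ (e i)))

/-- The projective (homological) dimension of `A` as a module over `R` through `φ : R → A`. -/
noncomputable def homologicalDimension {R A : Type u} [CommRing R] [CommRing A] (φ : R →+* A) :
    WithBot ℕ∞ :=
  letI : Module R A := Module.compHom A φ
  CategoryTheory.projectiveDimension (ModuleCat.of R A)

/-- The shifts of the complex
`0 → R(-18) → R(-14)^15 → R(-12)^35 → R(-8)^21 ⊕ R(-10)^21 → R(-6)^35 → R(-4)^15 → R`. -/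
def sixLinearFormsShifts : ℕ → List ℕ
  | 0 => [0]
  | 1 => List.replicate 15 4
  | 2 => List.replicate 35 6
  | 3 => List.replicate 21 8 ++ List.replicate 21 10
  | 4 => List.replicate 35 12
  | 5 => List.replicate 15 14
  | 6 => [18]
  | _ => []

/-! The invariant algebra is the Plücker algebra of `Gr(2,6)`: it is generated by the 15 brackets of
pairs of forms, and the relations among them are generated by the Pfaffians of the principal `4 × 4`
blocks of the generic skew-symmetric `6 × 6` matrix `X`. With `Y = pfAdj X`, the candidate
resolution is the Józefiak–Pragacz complex `S → Λ → gl/scalars → Sym ⊕ Sym → sl → Λ → S`, of ranks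
1, 15, 35, 42, 35, 15, 1.

Acyclicity. Polarizing `X Y = Pf(X)` gives, for each skew `M`, explicit maps `h` with `a z = d (h
z)` for every cycle `z` of positive degree, where `a = tr (M Y)`. If `a` is a nonzerodivisor,
exactness in degree `i + 1` over `S/a` implies exactness in degree `i` over `S`: modulo `a`, `h z`
is a cycle, so `h z = d u + a v`, hence `a z = a d v` and `z = d v`. A regular sequence of length 6
in the Pfaffian ideal therefore gives exactness in all positive degrees
(`HasPfaffianGrade.exactAt`).

Regular sequence. Take the nine antidiagonal sums of `X` as parameters `b` in a base ring `B`,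
leaving six variables. Modulo the Pfaffians the fourth power of each variable drops in degree, so
the quotient is finite over `B`, and the ideal contains a monic polynomial in each variable; these
form a regular sequence (`hasPfaffianGrade_sectionEntries`).

Fundamental theorems. Since `B` and `b` are arbitrary, the complex stays exact after setting the
first entry, and then the second, to zero. So `x 0` is a nonzerodivisor modulo the Pfaffian ideal,
and `x 1` modulo that ideal plus `x 0`. The first fact reduces the second fundamental theorem to
inverting `x 0`. The second shows that a polynomial whose product with the bracket `[01]` is a
polynomial in brackets is itself one (`exists_aeval_plucker_eq_of_mul`), which reduces the first
fundamental theorem to inverting `[01]`; there the group moves two forms to normal position.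

Conclusion. Any minimal homogeneous generators have degree 2 and arise from the brackets by an
invertible linear substitution, so the complex transports. Consecutive terms share no shift, which
forces minimality, and minimality of the last map gives projective dimension exactly 6. -/

open Matrix

/-! ### The Pfaffian adjoint and its polynomial identities -/

section PfaffianAdjoint

variable {S : Type*} [CommRing S]

/-- The skew-symmetric `6 × 6` matrix with given entries above the diagonal. -/
def skewOf (x : Fin 15 → S) : Matrix (Fin 6) (Fin 6) S :=
  !![0, x 0, x 1, x 2, x 3, x 4;
    -x 0, 0, x 5, x 6, x 7, x 8;
    -x 1, -x 5, 0, x 9, x 10, x 11;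
    -x 2, -x 6, -x 9, 0, x 12, x 13;
    -x 3, -x 7, -x 10, -x 12, 0, x 14;
    -x 4, -x 8, -x 11, -x 13, -x 14, 0]

/-- The polarization of the Pfaffian of the principal `4 × 4` block with indices `a, b, c, d`. -/
def polarPf (X Z : Matrix (Fin 6) (Fin 6) S) (a b c d : Fin 6) : S :=
  X a b * Z c d + Z a b * X c d - (X a c * Z b d + Z a c * X b d) + (X a d * Z b c + Z a d * X b c)

/-- The Pfaffian of the principal `4 × 4` block with indices `a, b, c, d`. -/
def subPf (X : Matrix (Fin 6) (Fin 6) S) (a b c d : Fin 6) : S :=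
  X a b * X c d - X a c * X b d + X a d * X b c

/-- The Pfaffian adjoint of a skew-symmetric `6 × 6` matrix: its entries are, up to sign, the
Pfaffians of the principal `4 × 4` blocks. -/
def pfAdj (X : Matrix (Fin 6) (Fin 6) S) : Matrix (Fin 6) (Fin 6) S :=
  !![0, -subPf X 2 3 4 5, subPf X 1 3 4 5, -subPf X 1 2 4 5, subPf X 1 2 3 5, -subPf X 1 2 3 4;
    subPf X 2 3 4 5, 0, -subPf X 0 3 4 5, subPf X 0 2 4 5, -subPf X 0 2 3 5, subPf X 0 2 3 4;
    -subPf X 1 3 4 5, subPf X 0 3 4 5, 0, -subPf X 0 1 4 5, subPf X 0 1 3 5, -subPf X 0 1 3 4;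
    subPf X 1 2 4 5, -subPf X 0 2 4 5, subPf X 0 1 4 5, 0, -subPf X 0 1 2 5, subPf X 0 1 2 4;
    -subPf X 1 2 3 5, subPf X 0 2 3 5, -subPf X 0 1 3 5, subPf X 0 1 2 5, 0, -subPf X 0 1 2 3;
    subPf X 1 2 3 4, -subPf X 0 2 3 4, subPf X 0 1 3 4, -subPf X 0 1 2 4, subPf X 0 1 2 3, 0]

/-- The polarization of the quadratic map `pfAdj`. -/
def polarAdj (X Z : Matrix (Fin 6) (Fin 6) S) : Matrix (Fin 6) (Fin 6) S :=
  !![0, -polarPf X Z 2 3 4 5, polarPf X Z 1 3 4 5, -polarPf X Z 1 2 4 5, polarPf X Z 1 2 3 5, -polarPf X Z 1 2 3 4;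
    polarPf X Z 2 3 4 5, 0, -polarPf X Z 0 3 4 5, polarPf X Z 0 2 4 5, -polarPf X Z 0 2 3 5, polarPf X Z 0 2 3 4;
    -polarPf X Z 1 3 4 5, polarPf X Z 0 3 4 5, 0, -polarPf X Z 0 1 4 5, polarPf X Z 0 1 3 5, -polarPf X Z 0 1 3 4;
    polarPf X Z 1 2 4 5, -polarPf X Z 0 2 4 5, polarPf X Z 0 1 4 5, 0, -polarPf X Z 0 1 2 5, polarPf X Z 0 1 2 4;
    -polarPf X Z 1 2 3 5, polarPf X Z 0 2 3 5, -polarPf X Z 0 1 3 5, polarPf X Z 0 1 2 5, 0, -polarPf X Z 0 1 2 3;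
    polarPf X Z 1 2 3 4, -polarPf X Z 0 2 3 4, polarPf X Z 0 1 3 4, -polarPf X Z 0 1 2 4, polarPf X Z 0 1 2 3, 0]

/-- The Pfaffian of a skew-symmetric `6 × 6` matrix. -/
def pfaff (X : Matrix (Fin 6) (Fin 6) S) : S :=
  X 0 1 * subPf X 2 3 4 5 - X 0 2 * subPf X 1 3 4 5 + X 0 3 * subPf X 1 2 4 5
    - X 0 4 * subPf X 1 2 3 5 + X 0 5 * subPf X 1 2 3 4

theorem skewOf_transpose (x : Fin 15 → S) : (skewOf x)ᵀ = -skewOf x := by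
  ext i j; fin_cases i <;> fin_cases j <;> simp [skewOf]

theorem pfAdj_transpose (X : Matrix (Fin 6) (Fin 6) S) : (pfAdj X)ᵀ = -pfAdj X := by
  ext i j; fin_cases i <;> fin_cases j <;> simp [pfAdj]

theorem polarAdj_transpose (X Z : Matrix (Fin 6) (Fin 6) S) :
    (polarAdj X Z)ᵀ = -polarAdj X Z := by
  ext i j; fin_cases i <;> fin_cases j <;> simp [polarAdj]

theorem pfAdj_map {S' : Type*} [CommRing S'] (f : S →+* S') (X : Matrix (Fin 6) (Fin 6) S) :
    pfAdj (X.map f) = (pfAdj X).map f := by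
  ext i j; fin_cases i <;> fin_cases j <;> simp [pfAdj, subPf]

/-- Invertibility of 2 turns `Xᵀ = -X` into an alternating matrix, so identities checked entrywise
on `skewOf` apply. -/
theorem exists_eq_skewOf (h2 : IsUnit (2 : S)) {X : Matrix (Fin 6) (Fin 6) S} (hX : Xᵀ = -X) :
    ∃ x, X = skewOf x := by
  have h : ∀ i j, X j i = -X i j := fun i j => congrFun (congrFun hX i) j
  have h0 : ∀ i, X i i = 0 := fun i => by
    have : 2 * X i i = 0 := by linear_combination h i i
    exact (h2.mul_right_eq_zero).1 this
  refine ⟨![X 0 1, X 0 2, X 0 3, X 0 4, X 0 5, X 1 2, X 1 3, X 1 4, X 1 5, X 2 3, X 2 4, X 2 5,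
    X 3 4, X 3 5, X 4 5], ?_⟩
  ext i j
  fin_cases i <;> fin_cases j <;> first | exact h0 _ | rfl | exact h _ _

theorem skewOf_mul_pfAdj (x : Fin 15 → S) :
    skewOf x * pfAdj (skewOf x) = pfaff (skewOf x) • (1 : Matrix (Fin 6) (Fin 6) S) := by
  ext i j
  fin_cases i <;> fin_cases j <;>
    simp only [Fin.zero_eta, Fin.mk_one, Fin.reduceFinMk, Matrix.smul_apply, Matrix.mul_apply,
      Fin.sum_univ_six, skewOf, pfAdj, subPf, pfaff, Matrix.of_apply, Matrix.cons_val,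
      Matrix.one_apply, Fin.reduceEq, if_true, if_false, smul_eq_mul] <;> ring

-- The derivative of `X * pfAdj X = pfaff X • 1` in the direction `Z`: the derivative of the
-- Pfaffian is half of `tr (Z Y)`, and the denominator is cleared.
set_option maxHeartbeats 2000000 in
theorem skewOf_mul_polarAdj (x z : Fin 15 → S) :
    (2 : S) • (skewOf x * polarAdj (skewOf x) (skewOf z) + skewOf z * pfAdj (skewOf x)) =
      trace (skewOf z * pfAdj (skewOf x)) • (1 : Matrix (Fin 6) (Fin 6) S) := by
  ext i j
  fin_cases i <;> fin_cases j <;>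
    simp only [Fin.zero_eta, Fin.mk_one, Fin.reduceFinMk, Matrix.trace, Matrix.smul_apply,
      Matrix.add_apply, Matrix.mul_apply, Matrix.diag_apply, Fin.sum_univ_six] <;>
    simp only [skewOf, pfAdj, polarAdj, subPf, polarPf, Matrix.of_apply, Matrix.cons_val,
      Matrix.one_apply, Fin.reduceEq, if_true, if_false, smul_eq_mul] <;>
    ring

-- The derivative at `g = 1` in the direction `G` of the equivariance `pfAdj (g X gᵀ) = det g • g⁻ᵀ
-- (pfAdj X) g⁻¹`.
set_option maxHeartbeats 2000000 in
theorem polarAdj_skewOf_infinitesimal (x : Fin 15 → S) (G : Matrix (Fin 6) (Fin 6) S) :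
    polarAdj (skewOf x) (G * skewOf x + skewOf x * Gᵀ) =
      trace G • pfAdj (skewOf x) - Gᵀ * pfAdj (skewOf x) - pfAdj (skewOf x) * G := by
  ext i j
  fin_cases i <;> fin_cases j <;>
    simp only [Fin.zero_eta, Fin.mk_one, Fin.reduceFinMk, Matrix.trace, Matrix.smul_apply,
      Matrix.sub_apply, Matrix.mul_apply, Matrix.diag_apply, Fin.sum_univ_six] <;>
    simp only [skewOf, pfAdj, polarAdj, subPf, polarPf, Matrix.of_apply, Matrix.cons_val,
      Matrix.mul_apply, Matrix.add_apply, Fin.sum_univ_six, Matrix.transpose_apply,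
      smul_eq_mul] <;>
    ring

/-- Both sides are twice the second derivative of the Pfaffian at `X` in the two directions, which
is symmetric. -/
theorem trace_polarAdj_skewOf_comm (x z c : Fin 15 → S) :
    trace (polarAdj (skewOf x) (skewOf z) * skewOf c) =
      trace (polarAdj (skewOf x) (skewOf c) * skewOf z) := by
  simp only [Matrix.trace, Matrix.mul_apply, Matrix.diag_apply, Fin.sum_univ_six, skewOf,
    polarAdj, polarPf, Matrix.of_apply, Matrix.cons_val]
  ring

end PfaffianAdjoint

set_option linter.unusedSimpArgs false

/-! ### Null-homotopies for multiplication by an element of the Pfaffian ideal -/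

section Homotopy

variable {S : Type*} [CommRing S] {X M : Matrix (Fin 6) (Fin 6) S}

theorem mul_pfAdj (h2 : IsUnit (2 : S)) (hX : Xᵀ = -X) : X * pfAdj X = pfaff X • 1 := by
  obtain ⟨x, rfl⟩ := exists_eq_skewOf h2 hX
  exact skewOf_mul_pfAdj x

theorem pfAdj_mul (h2 : IsUnit (2 : S)) (hX : Xᵀ = -X) : pfAdj X * X = pfaff X • 1 := by
  have h := congrArg transpose (mul_pfAdj h2 hX)
  simpa [transpose_mul, hX, pfAdj_transpose] using h

/-- Here `m` is the derivative of the Pfaffian at `X` in the direction `M`; the second matrix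
identity is the transpose of the first. -/
theorem exists_half_trace (h2 : IsUnit (2 : S)) (hX : Xᵀ = -X) (hM : Mᵀ = -M) :
    ∃ m : S, trace (M * pfAdj X) = m + m ∧ X * polarAdj X M + M * pfAdj X = m • 1 ∧
      polarAdj X M * X + pfAdj X * M = m • 1 := by
  obtain ⟨c, hc⟩ := h2.exists_left_inv
  have key : X * polarAdj X M + M * pfAdj X = (c * trace (M * pfAdj X)) • 1 := by
    obtain ⟨x, rfl⟩ := exists_eq_skewOf h2 hX
    obtain ⟨z, rfl⟩ := exists_eq_skewOf h2 hM
    rw [mul_smul, ← skewOf_mul_polarAdj, smul_smul, hc, one_smul]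
  refine ⟨c * trace (M * pfAdj X), by linear_combination (-trace (M * pfAdj X)) * hc, key, ?_⟩
  have h := congrArg transpose key
  simpa [transpose_mul, hX, hM, pfAdj_transpose, polarAdj_transpose, add_comm] using h

theorem polarAdj_infinitesimal (h2 : IsUnit (2 : S)) (hX : Xᵀ = -X)
    (G : Matrix (Fin 6) (Fin 6) S) :
    polarAdj X (G * X + X * Gᵀ) = trace G • pfAdj X - Gᵀ * pfAdj X - pfAdj X * G := by
  obtain ⟨x, rfl⟩ := exists_eq_skewOf h2 hX
  exact polarAdj_skewOf_infinitesimal x G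

theorem trace_polarAdj_comm {C : Matrix (Fin 6) (Fin 6) S} (h2 : IsUnit (2 : S)) (hX : Xᵀ = -X)
    (hM : Mᵀ = -M) (hC : Cᵀ = -C) :
    trace (polarAdj X M * C) = trace (polarAdj X C * M) := by
  obtain ⟨x, rfl⟩ := exists_eq_skewOf h2 hX
  obtain ⟨z, rfl⟩ := exists_eq_skewOf h2 hM
  obtain ⟨c, rfl⟩ := exists_eq_skewOf h2 hC
  exact trace_polarAdj_skewOf_comm x z c

theorem polarAdj_smul_add_smul (X M : Matrix (Fin 6) (Fin 6) S) (r s : S) :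
    polarAdj X (r • M + s • M) = (r + s) • polarAdj X M := by
  ext i j
  fin_cases i <;> fin_cases j <;>
    simp only [Fin.zero_eta, Fin.mk_one, Fin.reduceFinMk, polarAdj, polarPf, Matrix.add_apply,
      Matrix.smul_apply, smul_eq_mul, Matrix.of_apply, Matrix.cons_val] <;> ring

/-- The homotopy in degree one: `C ↦ A`, together with `r ↦ r M` from degree zero. Tracelessness of
`A` is the symmetry of the second derivative of the Pfaffian. -/
theorem homotopy_skew {C : Matrix (Fin 6) (Fin 6) S} (h2 : IsUnit (2 : S)) (hX : Xᵀ = -X)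
    (hM : Mᵀ = -M) (hC : Cᵀ = -C) (A : Matrix (Fin 6) (Fin 6) S)
    (hA : A = C * polarAdj X M - M * polarAdj X C) :
    trace A = 0 ∧ trace (M * pfAdj X) • C = A * X + X * Aᵀ + trace (C * pfAdj X) • M := by
  obtain ⟨m, hm, h1, h1'⟩ := exists_half_trace h2 hX hM
  obtain ⟨c, hc, h3, h3'⟩ := exists_half_trace h2 hX hC
  subst hA
  refine ⟨?_, ?_⟩
  · rw [trace_sub, trace_mul_comm C, trace_mul_comm M, trace_polarAdj_comm h2 hX hM hC, sub_self]
  · rw [hm, hc]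
    simp only [transpose_sub, transpose_mul, hM, hC, polarAdj_transpose]
    have e1 : C * (polarAdj X M * X + pfAdj X * M) = C * (m • 1) := by rw [h1']
    have e2 : (X * polarAdj X M + M * pfAdj X) * C = (m • 1) * C := by rw [h1]
    have e3 : M * (polarAdj X C * X + pfAdj X * C) = M * (c • 1) := by rw [h3']
    have e4 : (X * polarAdj X C + C * pfAdj X) * M = (c • 1) * M := by rw [h3]
    simp only [mul_add, add_mul, mul_sub, sub_mul, mul_neg, neg_mul, neg_neg, mul_assoc,
      smul_mul_assoc, mul_smul_comm, mul_one, one_mul, add_smul] at e1 e2 e3 e4 ⊢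
    linear_combination (norm := module) e3 + e4 - e1 - e2

/-- The homotopy on cycles of degree two. A cycle `A` is an infinitesimal stabilizer of `X`, hence
also of `Y` by `polarAdj_infinitesimal`; this relation multiplied by `M`, and the cycle condition
multiplied by `polarAdj X M`, give the identity. -/
theorem homotopy_traceless {A : Matrix (Fin 6) (Fin 6) S} (h2 : IsUnit (2 : S)) (hX : Xᵀ = -X)
    (hM : Mᵀ = -M) (hA : trace A = 0) (hdA : A * X + X * Aᵀ = 0) :
    trace (M * pfAdj X) • A = X * (polarAdj X M * A - Aᵀ * polarAdj X M)
      + (A * M - M * Aᵀ) * pfAdj X := by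
  obtain ⟨m, hm, h1, h1'⟩ := exists_half_trace h2 hX hM
  have h0 : polarAdj X (A * X + X * Aᵀ) = 0 := by
    rw [hdA]; simpa using polarAdj_smul_add_smul X M 0 0
  have hi := polarAdj_infinitesimal h2 hX A
  rw [h0, hA] at hi
  have e1 : A * (X * polarAdj X M + M * pfAdj X) = A * (m • 1) := by rw [h1]
  have e2 : (X * polarAdj X M + M * pfAdj X) * A = (m • 1) * A := by rw [h1]
  have e3 := congrArg (M * ·) hi
  have e4 : (A * X + X * Aᵀ) * polarAdj X M = 0 := by rw [hdA, zero_mul]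
  rw [hm]
  simp only [mul_add, add_mul, mul_sub, sub_mul, mul_neg, neg_mul, neg_neg, mul_assoc, zero_smul,
      smul_mul_assoc, mul_smul_comm, mul_one, one_mul, add_smul, mul_zero, zero_sub] at e1 e2 e3 e4 ⊢
  linear_combination (norm := module) e4 - e1 - e2 + e3

/-- The homotopy on cycles of degree three, `(P, T) ↦ B`. It follows from the cycle condition and
its transpose, multiplied by `polarAdj X M` for `P` and by `M` for `T`. -/
theorem homotopy_symm {P T : Matrix (Fin 6) (Fin 6) S} (h2 : IsUnit (2 : S)) (hX : Xᵀ = -X)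
    (hM : Mᵀ = -M) (hP : Pᵀ = P) (hT : Tᵀ = T) (hd : X * P + T * pfAdj X = 0)
    (B : Matrix (Fin 6) (Fin 6) S) (hB : B = polarAdj X M * T - P * M) :
    trace (M * pfAdj X) • P = pfAdj X * Bᵀ - B * pfAdj X ∧
      trace (M * pfAdj X) • T = X * B - Bᵀ * X := by
  obtain ⟨m, hm, h1, h1'⟩ := exists_half_trace h2 hX hM
  have hd' : P * X + pfAdj X * T = 0 := by
    have h := congrArg transpose hd
    simp only [transpose_add, transpose_mul, hP, hT, hX, pfAdj_transpose, transpose_zero] at h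
    linear_combination (norm := (simp only [mul_neg, neg_mul]; abel)) -h
  subst hB
  simp only [transpose_sub, transpose_mul, hP, hT, hM, polarAdj_transpose]
  have e1 := congrArg (polarAdj X M * ·) hd
  have e2 := congrArg (· * polarAdj X M) hd'
  have e3 := congrArg (· * P) h1'
  have e4 := congrArg (P * ·) h1
  have f1 := congrArg (· * M) hd
  have f2 := congrArg (M * ·) hd'
  have f3 := congrArg (· * T) h1
  have f4 := congrArg (T * ·) h1'
  rw [hm]
  simp only [mul_add, add_mul, mul_sub, sub_mul, mul_neg, neg_mul, neg_neg, mul_assoc,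
    smul_mul_assoc, mul_smul_comm, mul_one, one_mul, add_smul, mul_zero, zero_mul]
    at e1 e2 e3 e4 f1 f2 f3 f4 ⊢
  exact ⟨by linear_combination (norm := module) e1 + e2 - e3 - e4,
    by linear_combination (norm := module) f1 + f2 - f3 - f4⟩

/-- The component of the homotopy defined on matrices modulo scalars. -/
def homotopyScalars (X M B : Matrix (Fin 6) (Fin 6) S) : Matrix (Fin 6) (Fin 6) S :=
  B * polarAdj X M + polarAdj X M * Bᵀ - polarAdj X (Bᵀ * M + M * B)

theorem homotopyScalars_transpose (B : Matrix (Fin 6) (Fin 6) S) :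
    (homotopyScalars X M B)ᵀ = -homotopyScalars X M B := by
  simp only [homotopyScalars, transpose_sub, transpose_add, transpose_mul, polarAdj_transpose,
    transpose_transpose, mul_neg, neg_mul]
  abel

/-- This makes `homotopyScalars` well defined on matrices modulo scalars. -/
theorem homotopyScalars_smul_one (r : S) : homotopyScalars X M (r • 1) = 0 := by
  simp [homotopyScalars, polarAdj_smul_add_smul, add_smul]

/-- The homotopy on cycles of degree four. The subtracted term in `homotopyScalars` multiplies with
`X` to a scalar minus `Bᵀ * M + M * B` times `Y`-terms, so the identity holds only modulo scalars;
`r` is half the trace attached to `Bᵀ * M + M * B`. -/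
theorem homotopy_scalars {B : Matrix (Fin 6) (Fin 6) S} (h2 : IsUnit (2 : S)) (hX : Xᵀ = -X)
    (hM : Mᵀ = -M) (hP : pfAdj X * Bᵀ - B * pfAdj X = 0) (hT : X * B - Bᵀ * X = 0) :
    ∃ r : S, trace (M * pfAdj X) • B = homotopyScalars X M B * X + r • 1 := by
  obtain ⟨m, hm, h1, h1'⟩ := exists_half_trace h2 hX hM
  have hZ : (Bᵀ * M + M * B)ᵀ = -(Bᵀ * M + M * B) := by
    simp [transpose_mul, hM, add_comm]
  obtain ⟨r, -, -, hr⟩ := exists_half_trace h2 hX hZ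
  refine ⟨r, ?_⟩
  have e1 := congrArg (polarAdj X M * ·) hT
  have e2 := congrArg (· * M) hP
  have e3 := congrArg (· * B) h1'
  have e4 := congrArg (B * ·) h1'
  rw [hm, homotopyScalars]
  simp only [mul_add, add_mul, mul_sub, sub_mul, mul_neg, neg_mul, neg_neg, mul_assoc,
    smul_mul_assoc, mul_smul_comm, mul_one, one_mul, add_smul, mul_zero, zero_mul]
    at e1 e2 e3 e4 hr ⊢
  linear_combination (norm := module) e1 - e2 - e3 - e4 + hr

/-- The homotopy on cycles of degree five, `C ↦ tr (M C)`. As `C X` is a scalar, `homotopyScalars`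
kills it; its polarized term is the infinitesimal action of `G = M C` on `X`, so the vanishing
unfolds by `polarAdj_infinitesimal`. -/
theorem homotopy_skew_top {C : Matrix (Fin 6) (Fin 6) S} (h2 : IsUnit (2 : S)) (hX : Xᵀ = -X)
    (hM : Mᵀ = -M) (hC : Cᵀ = -C) {r : S} (hd : C * X + r • 1 = 0) :
    trace (M * pfAdj X) • C = trace (M * C) • pfAdj X := by
  obtain ⟨m, hm, h1, h1'⟩ := exists_half_trace h2 hX hM
  have hCX : C * X = (-r) • 1 := by rw [neg_smul]; exact eq_neg_of_add_eq_zero_left hd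
  have h0 : homotopyScalars X M (C * X) = 0 := by rw [hCX, homotopyScalars_smul_one]
  have hi := polarAdj_infinitesimal h2 hX (M * C)
  have hT : (C * X)ᵀ = X * C := by simp [transpose_mul, hC, hX]
  have hT' : (M * C)ᵀ = C * M := by simp [transpose_mul, hC, hM]
  rw [homotopyScalars, hT, show X * C * M + M * (C * X) = M * C * X + X * (M * C)ᵀ by
    rw [hT', mul_assoc, mul_assoc, add_comm], hi, hT'] at h0
  have e3 := congrArg (· * C) h1'
  have e4 := congrArg (C * ·) h1
  rw [hm]
  simp only [mul_add, add_mul, mul_sub, sub_mul, mul_neg, neg_mul, neg_neg, mul_assoc,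
    smul_mul_assoc, mul_smul_comm, mul_one, one_mul, add_smul, mul_zero, zero_mul]
    at e3 e4 h0 ⊢
  linear_combination (norm := module) h0 - e3 - e4

end Homotopy

/-! ### Exactness by induction along a regular sequence in the Pfaffian ideal -/

section Acyclicity

/-- Exactness, at the term of homological degree `i`, of the complex of free `S`-modules
`S → Λ → gl/scalars → Sym ⊕ Sym → sl → Λ → S` attached to a skew-symmetric matrix `X` with Pfaffian
adjoint `Y`, where `Λ` and `Sym` are the modules of skew-symmetric and of symmetric matrices. The
maps are `r ↦ r Y`, `C ↦ C X`, `B ↦ (Y Bᵀ - B Y, X B - Bᵀ X)`, `(P, T) ↦ X P + T Y`,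
`A ↦ A X + X Aᵀ` and `C ↦ tr (C Y)`. -/
def PfaffianExactAt {S : Type*} [CommRing S] (X : Matrix (Fin 6) (Fin 6) S) : ℕ → Prop
  | 1 => ∀ C, Cᵀ = -C → trace (C * pfAdj X) = 0 → ∃ A, trace A = 0 ∧ C = A * X + X * Aᵀ
  | 2 => ∀ A, trace A = 0 → A * X + X * Aᵀ = 0 →
      ∃ P T, Pᵀ = P ∧ Tᵀ = T ∧ A = X * P + T * pfAdj X
  | 3 => ∀ P T, Pᵀ = P → Tᵀ = T → X * P + T * pfAdj X = 0 →
      ∃ B, P = pfAdj X * Bᵀ - B * pfAdj X ∧ T = X * B - Bᵀ * X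
  | 4 => ∀ B, pfAdj X * Bᵀ - B * pfAdj X = 0 → X * B - Bᵀ * X = 0 →
      ∃ C, Cᵀ = -C ∧ ∃ r : S, B = C * X + r • 1
  | 5 => ∀ C, Cᵀ = -C → ∀ r : S, C * X + r • 1 = 0 → ∃ s : S, C = s • pfAdj X
  | 6 => ∀ r : S, r • pfAdj X = 0 → r = 0
  | _ => True

variable {S S' : Type*} [CommRing S] [CommRing S']

theorem mapMatrix_smul (f : S →+* S') (r : S) (Z : Matrix (Fin 6) (Fin 6) S) :
    f.mapMatrix (r • Z) = f r • f.mapMatrix Z := by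
  ext i j; simp

theorem mapMatrix_transpose (f : S →+* S') (Z : Matrix (Fin 6) (Fin 6) S) :
    f.mapMatrix Zᵀ = (f.mapMatrix Z)ᵀ := rfl

theorem mapMatrix_pfAdj (f : S →+* S') (Z : Matrix (Fin 6) (Fin 6) S) :
    f.mapMatrix (pfAdj Z) = pfAdj (f.mapMatrix Z) := (pfAdj_map f Z).symm

theorem mapMatrix_trace (f : S →+* S') (Z : Matrix (Fin 6) (Fin 6) S) :
    f (trace Z) = trace (f.mapMatrix Z) := by
  simp [trace, map_sum]

theorem exists_mapMatrix_eq {f : S →+* S'} (hf : Function.Surjective f)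
    (Z : Matrix (Fin 6) (Fin 6) S') : ∃ W, f.mapMatrix W = Z := by
  choose g hg using hf
  exact ⟨Z.map g, by ext i j; simp [hg]⟩

theorem exists_mapMatrix_eq_of_skew (h2 : IsUnit (2 : S)) {f : S →+* S'}
    (hf : Function.Surjective f) {Z : Matrix (Fin 6) (Fin 6) S'} (hZ : Zᵀ = -Z) :
    ∃ W, Wᵀ = -W ∧ f.mapMatrix W = Z := by
  obtain ⟨W, rfl⟩ := exists_mapMatrix_eq hf Z
  obtain ⟨c, hc⟩ := h2.exists_left_inv
  have hc' : f c * 2 = 1 := by rw [← map_ofNat f 2, ← map_mul, hc, map_one]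
  refine ⟨c • (W - Wᵀ), by rw [transpose_smul, transpose_sub, transpose_transpose, ← smul_neg, neg_sub],
    ?_⟩
  rw [mapMatrix_smul, map_sub, mapMatrix_transpose, hZ, sub_neg_eq_add, ← two_smul S', smul_smul,
    hc', one_smul]

theorem exists_mapMatrix_eq_of_symm (h2 : IsUnit (2 : S)) {f : S →+* S'}
    (hf : Function.Surjective f) {Z : Matrix (Fin 6) (Fin 6) S'} (hZ : Zᵀ = Z) :
    ∃ W, Wᵀ = W ∧ f.mapMatrix W = Z := by
  obtain ⟨W, rfl⟩ := exists_mapMatrix_eq hf Z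
  obtain ⟨c, hc⟩ := h2.exists_left_inv
  have hc' : f c * 2 = 1 := by rw [← map_ofNat f 2, ← map_mul, hc, map_one]
  refine ⟨c • (W + Wᵀ), by simp [transpose_smul, add_comm], ?_⟩
  rw [mapMatrix_smul, map_add, mapMatrix_transpose, hZ, ← two_smul S', smul_smul, hc', one_smul]

variable {f : S →+* S'} {a : S}

theorem exists_eq_add_smul (hk : RingHom.ker f = Ideal.span {a}) {Z W : Matrix (Fin 6) (Fin 6) S}
    (h : f.mapMatrix Z = f.mapMatrix W) : ∃ V, Z = W + a • V := by
  have : ∀ i j, ∃ v, Z i j - W i j = a * v := fun i j => by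
    have hz : Z i j - W i j ∈ RingHom.ker f := by
      rw [RingHom.mem_ker, map_sub, sub_eq_zero]
      exact congrFun (congrFun h i) j
    rw [hk] at hz
    exact Ideal.mem_span_singleton.1 hz
  choose V hV using this
  exact ⟨Matrix.of V, by ext i j; simp [← hV]⟩

theorem smul_matrix_left_cancel (ha : ∀ s, a * s = 0 → s = 0) {Z W : Matrix (Fin 6) (Fin 6) S}
    (h : a • Z = a • W) : Z = W := by
  ext i j
  have hij : a * Z i j = a * W i j := congrFun (congrFun h i) j
  exact sub_eq_zero.1 (ha _ (by rw [mul_sub, hij, sub_self]))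

theorem mapMatrix_smul_generator (hk : RingHom.ker f = Ideal.span {a})
    (Z : Matrix (Fin 6) (Fin 6) S) : f.mapMatrix (a • Z) = 0 := by
  have : f a = 0 := by
    rw [← RingHom.mem_ker, hk]; exact Ideal.mem_span_singleton_self a
  rw [mapMatrix_smul, this, zero_smul]

variable {X M : Matrix (Fin 6) (Fin 6) S}

theorem trace_mul_eq_zero_of_skew_symm (h2 : IsUnit (2 : S)) {C P : Matrix (Fin 6) (Fin 6) S}
    (hC : Cᵀ = -C) (hP : Pᵀ = P) : trace (C * P) = 0 := by
  have h : trace (C * P) = -trace (C * P) := by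
    conv_lhs => rw [← trace_transpose, transpose_mul, hC, hP, mul_neg, trace_neg, trace_mul_comm]
  exact h2.mul_right_eq_zero.1 (by linear_combination h)

theorem pfaffianExactAt_six (ha : ∀ s, trace (M * pfAdj X) * s = 0 → s = 0) :
    PfaffianExactAt X 6 := by
  intro r hr
  apply ha
  rw [mul_comm, ← smul_eq_mul, ← trace_smul, ← mul_smul_comm, hr, mul_zero, trace_zero]

/-- The pattern for degrees five down to one, with `a = tr (M Y)`: write `a z = d (h z)`, use
exactness one degree higher modulo `a` to get `h z = d u + a v`, then cancel `a` using `d d = 0`. -/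
theorem pfaffianExactAt_five (h2 : IsUnit (2 : S)) (hX : Xᵀ = -X) (hM : Mᵀ = -M)
    (ha : ∀ s, trace (M * pfAdj X) * s = 0 → s = 0)
    (hk : RingHom.ker f = Ideal.span {trace (M * pfAdj X)})
    (h : PfaffianExactAt (f.mapMatrix X) 6) : PfaffianExactAt X 5 := by
  intro C hC r hd
  have e := homotopy_skew_top h2 hX hM hC hd
  have h0 : f (trace (M * C)) = 0 := by
    apply h
    rw [← mapMatrix_pfAdj, ← mapMatrix_smul, ← e, mapMatrix_smul_generator hk]
  rw [← RingHom.mem_ker, hk, Ideal.mem_span_singleton] at h0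
  obtain ⟨s, hs⟩ := h0
  exact ⟨s, smul_matrix_left_cancel ha (by rw [e, hs, smul_smul])⟩

theorem pfaffianExactAt_four (h2 : IsUnit (2 : S)) (hX : Xᵀ = -X) (hM : Mᵀ = -M)
    (ha : ∀ s, trace (M * pfAdj X) * s = 0 → s = 0) (hf : Function.Surjective f)
    (hk : RingHom.ker f = Ideal.span {trace (M * pfAdj X)})
    (h : PfaffianExactAt (f.mapMatrix X) 5) : PfaffianExactAt X 4 := by
  intro B hP hT
  obtain ⟨r, e⟩ := homotopy_scalars h2 hX hM hP hT
  have hC := homotopyScalars_transpose (X := X) (M := M) B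
  generalize homotopyScalars X M B = C at e hC
  obtain ⟨s', hs'⟩ := h (f.mapMatrix C) (by rw [← mapMatrix_transpose, hC, map_neg]) (f r) (by
    rw [← map_mul, ← map_one f.mapMatrix, ← mapMatrix_smul, ← map_add, ← e,
      mapMatrix_smul_generator hk])
  obtain ⟨s, rfl⟩ := hf s'
  rw [← mapMatrix_pfAdj, ← mapMatrix_smul] at hs'
  obtain ⟨V, rfl⟩ := exists_eq_add_smul hk hs'
  have hV : Vᵀ = -V := smul_matrix_left_cancel ha (by
    simp only [transpose_add, transpose_smul, pfAdj_transpose] at hC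
    linear_combination (norm := module) hC)
  -- The boundary part `s • pfAdj X` of the homotopy contributes only the scalar `s * pfaff X`. So
  -- `a • (B - V * X)` is scalar, hence so is `B - V * X`, and any diagonal entry gives its value.
  refine ⟨V, hV, (B - V * X) 0 0, ?_⟩
  rw [add_mul, smul_mul_assoc, smul_mul_assoc, pfAdj_mul h2 hX, smul_smul] at e
  have e' : trace (M * pfAdj X) • (B - V * X) = (s * pfaff X + r) • 1 := by
    linear_combination (norm := module) e
  rw [← sub_eq_iff_eq_add']
  apply smul_matrix_left_cancel ha
  have h00 : trace (M * pfAdj X) * (B - V * X) 0 0 = s * pfaff X + r := by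
    simpa using congrFun (congrFun e' 0) 0
  rw [e', smul_smul, h00]

theorem pfaffianExactAt_three (h2 : IsUnit (2 : S)) (hX : Xᵀ = -X) (hM : Mᵀ = -M)
    (ha : ∀ s, trace (M * pfAdj X) * s = 0 → s = 0) (hf : Function.Surjective f)
    (hk : RingHom.ker f = Ideal.span {trace (M * pfAdj X)})
    (h : PfaffianExactAt (f.mapMatrix X) 4) : PfaffianExactAt X 3 := by
  intro P T hP hT hd
  obtain ⟨eP, eT⟩ := homotopy_symm h2 hX hM hP hT hd _ rfl
  generalize polarAdj X M * T - P * M = B at eP eT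
  obtain ⟨C', hC', r', hB'⟩ := h (f.mapMatrix B)
    (by rw [← mapMatrix_pfAdj, ← mapMatrix_transpose, ← map_mul, ← map_mul, ← map_sub, ← eP,
          mapMatrix_smul_generator hk])
    (by rw [← mapMatrix_transpose, ← map_mul, ← map_mul, ← map_sub, ← eT,
          mapMatrix_smul_generator hk])
  obtain ⟨C, hC, rfl⟩ := exists_mapMatrix_eq_of_skew h2 hf hC'
  obtain ⟨r, rfl⟩ := hf r'
  rw [← map_one f.mapMatrix, ← map_mul, ← mapMatrix_smul, ← map_add] at hB'
  obtain ⟨V, rfl⟩ := exists_eq_add_smul hk hB'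
  refine ⟨V, smul_matrix_left_cancel ha ?_, smul_matrix_left_cancel ha ?_⟩
  · rw [eP]
    have e1 := congrArg (· * C) (pfAdj_mul h2 hX)
    have e2 := congrArg (C * ·) (mul_pfAdj h2 hX)
    simp only [transpose_add, transpose_mul, transpose_smul, transpose_one, hC, hX, mul_add,
      add_mul, mul_assoc, smul_mul_assoc, mul_smul_comm, mul_one, one_mul, neg_mul, mul_neg]
      at e1 e2 ⊢
    linear_combination (norm := module) e1 - e2
  · rw [eT]
    simp only [transpose_add, transpose_mul, transpose_smul, transpose_one, hC, hX, mul_add,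
      add_mul, mul_assoc, smul_mul_assoc, mul_smul_comm, mul_one, one_mul, neg_mul, mul_neg]
    module

theorem pfaffianExactAt_two (h2 : IsUnit (2 : S)) (hX : Xᵀ = -X) (hM : Mᵀ = -M)
    (ha : ∀ s, trace (M * pfAdj X) * s = 0 → s = 0) (hf : Function.Surjective f)
    (hk : RingHom.ker f = Ideal.span {trace (M * pfAdj X)})
    (h : PfaffianExactAt (f.mapMatrix X) 3) : PfaffianExactAt X 2 := by
  intro A hA hd
  have e := homotopy_traceless h2 hX hM hA hd
  have hP : (polarAdj X M * A - Aᵀ * polarAdj X M)ᵀ = polarAdj X M * A - Aᵀ * polarAdj X M := by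
    simp only [transpose_sub, transpose_mul, polarAdj_transpose, transpose_transpose]
    noncomm_ring
  have hT : (A * M - M * Aᵀ)ᵀ = A * M - M * Aᵀ := by
    simp only [transpose_sub, transpose_mul, hM, transpose_transpose]
    noncomm_ring
  generalize polarAdj X M * A - Aᵀ * polarAdj X M = P at e hP
  generalize A * M - M * Aᵀ = T at e hT
  obtain ⟨B', hB, hB'⟩ := h (f.mapMatrix P) (f.mapMatrix T)
    (by rw [← mapMatrix_transpose, hP]) (by rw [← mapMatrix_transpose, hT])
    (by rw [← mapMatrix_pfAdj, ← map_mul, ← map_mul, ← map_add, ← e, mapMatrix_smul_generator hk])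
  obtain ⟨B, rfl⟩ := exists_mapMatrix_eq hf B'
  rw [← mapMatrix_pfAdj, ← mapMatrix_transpose, ← map_mul, ← map_mul, ← map_sub] at hB
  rw [← mapMatrix_transpose, ← map_mul, ← map_mul, ← map_sub] at hB'
  obtain ⟨V, rfl⟩ := exists_eq_add_smul hk hB
  obtain ⟨W, rfl⟩ := exists_eq_add_smul hk hB'
  refine ⟨V, W, smul_matrix_left_cancel ha ?_, smul_matrix_left_cancel ha ?_,
    smul_matrix_left_cancel ha ?_⟩
  · simp only [transpose_add, transpose_sub, transpose_mul, transpose_smul, transpose_transpose,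
      pfAdj_transpose, mul_neg, neg_mul] at hP
    linear_combination (norm := module) hP
  · simp only [transpose_add, transpose_sub, transpose_mul, transpose_smul, transpose_transpose,
      hX, mul_neg, neg_mul] at hT
    linear_combination (norm := module) hT
  · rw [e]
    have e1 := congrArg (· * Bᵀ) (mul_pfAdj h2 hX)
    have e2 := congrArg (Bᵀ * ·) (mul_pfAdj h2 hX)
    simp only [mul_add, add_mul, mul_sub, sub_mul, mul_assoc, smul_mul_assoc, mul_smul_comm,
      mul_one, one_mul] at e1 e2 ⊢
    linear_combination (norm := module) e1 - e2

theorem pfaffianExactAt_one (h2 : IsUnit (2 : S)) (hX : Xᵀ = -X) (hM : Mᵀ = -M)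
    (ha : ∀ s, trace (M * pfAdj X) * s = 0 → s = 0) (hf : Function.Surjective f)
    (hk : RingHom.ker f = Ideal.span {trace (M * pfAdj X)})
    (h : PfaffianExactAt (f.mapMatrix X) 2) : PfaffianExactAt X 1 := by
  intro C hC hd
  obtain ⟨hA, e⟩ := homotopy_skew h2 hX hM hC _ rfl
  generalize C * polarAdj X M - M * polarAdj X C = A at hA e
  rw [hd, zero_smul, add_zero] at e
  obtain ⟨P', T', hP', hT', hA'⟩ := h (f.mapMatrix A)
    (by rw [← mapMatrix_trace, hA, map_zero])
    (by rw [← mapMatrix_transpose, ← map_mul, ← map_mul, ← map_add, ← e,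
          mapMatrix_smul_generator hk])
  obtain ⟨P, hP, rfl⟩ := exists_mapMatrix_eq_of_symm h2 hf hP'
  obtain ⟨T, hT, rfl⟩ := exists_mapMatrix_eq_of_symm h2 hf hT'
  rw [← mapMatrix_pfAdj, ← map_mul, ← map_mul, ← map_add] at hA'
  obtain ⟨V, rfl⟩ := exists_eq_add_smul hk hA'
  refine ⟨V, ha _ ?_, smul_matrix_left_cancel ha ?_⟩
  -- `X * P` and `T * pfAdj X` are traceless (skew times symmetric), so `a * tr V = tr A = 0`.
  · rw [trace_add, trace_add, trace_mul_eq_zero_of_skew_symm h2 hX hP, trace_mul_comm T,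
      trace_mul_eq_zero_of_skew_symm h2 (pfAdj_transpose X) hT, trace_smul] at hA
    simpa using hA
  · rw [e]
    have e1 := congrArg (T * ·) (pfAdj_mul h2 hX)
    have e2 := congrArg (· * T) (mul_pfAdj h2 hX)
    simp only [transpose_add, transpose_mul, transpose_smul, hP, hT, hX, pfAdj_transpose, mul_add,
      add_mul, mul_assoc, smul_mul_assoc, mul_smul_comm, mul_one, one_mul, neg_mul, mul_neg]
      at e1 e2 ⊢
    linear_combination (norm := module) e1 - e2

/-- The ideal generated by the Pfaffians of the principal `4 × 4` blocks of a skew-symmetric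
`6 × 6` matrix `X` contains a regular sequence of length `n`. -/
inductive HasPfaffianGrade : ∀ {S : Type u} [CommRing S], Matrix (Fin 6) (Fin 6) S → ℕ → Prop
  | zero {S : Type u} [CommRing S] (X : Matrix (Fin 6) (Fin 6) S) : HasPfaffianGrade X 0
  | succ {S S' : Type u} [CommRing S] [CommRing S'] (X M : Matrix (Fin 6) (Fin 6) S)
      (f : S →+* S') (n : ℕ) (hM : Mᵀ = -M) (ha : ∀ s, trace (M * pfAdj X) * s = 0 → s = 0)
      (hf : Function.Surjective f) (hk : RingHom.ker f = Ideal.span {trace (M * pfAdj X)})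
      (h : HasPfaffianGrade (f.mapMatrix X) n) : HasPfaffianGrade X (n + 1)

/-- Degrees from 7 on are trivially exact, and each element of the regular sequence lowers the bound
by one; grade 6 reaches degree 1. -/
theorem HasPfaffianGrade.exactAt {S : Type u} [CommRing S] {X : Matrix (Fin 6) (Fin 6) S} {n : ℕ}
    (h : HasPfaffianGrade X n) : IsUnit (2 : S) → Xᵀ = -X → ∀ i, 7 ≤ i + n →
      PfaffianExactAt X i := by
  induction h with
  | zero X =>
    intro _ _ i hi
    obtain ⟨j, rfl⟩ := Nat.exists_eq_add_of_le' hi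
    trivial
  | succ X M f n hM ha hf hk h ih =>
    intro h2 hX i hi
    have ih' := ih (map_ofNat f 2 ▸ h2.map f) (by rw [← mapMatrix_transpose, hX, map_neg])
    match i, hi with
    | 0, _ => trivial
    | 1, _ => exact pfaffianExactAt_one h2 hX hM ha hf hk (ih' _ (by omega))
    | 2, _ => exact pfaffianExactAt_two h2 hX hM ha hf hk (ih' _ (by omega))
    | 3, _ => exact pfaffianExactAt_three h2 hX hM ha hf hk (ih' _ (by omega))
    | 4, _ => exact pfaffianExactAt_four h2 hX hM ha hf hk (ih' _ (by omega))
    | 5, _ => exact pfaffianExactAt_five h2 hX hM ha hk (ih' _ (by omega))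
    | 6, _ => exact pfaffianExactAt_six ha
    | _ + 7, _ => trivial

end Acyclicity

/-! ### A regular sequence of length six from a finite linear section -/

section Grade

/-- The ideal generated by the Pfaffians of the principal `4 × 4` blocks of `X`. -/
def pfaffianIdeal {S : Type*} [CommRing S] (X : Matrix (Fin 6) (Fin 6) S) : Ideal S where
  carrier := {a | ∃ M, Mᵀ = -M ∧ a = trace (M * pfAdj X)}
  add_mem' := by
    rintro _ _ ⟨M, hM, rfl⟩ ⟨N, hN, rfl⟩
    exact ⟨M + N, by rw [transpose_add, hM, hN, neg_add], by rw [add_mul, trace_add]⟩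
  zero_mem' := ⟨0, by simp, by simp⟩
  smul_mem' := by
    rintro c _ ⟨M, hM, rfl⟩
    exact ⟨c • M, by rw [transpose_smul, hM, smul_neg], by rw [smul_mul_assoc, trace_smul]⟩

variable {S S' : Type*} [CommRing S] [CommRing S']

theorem map_mem_pfaffianIdeal (f : S →+* S') {X : Matrix (Fin 6) (Fin 6) S} {a : S}
    (h : a ∈ pfaffianIdeal X) : f a ∈ pfaffianIdeal (f.mapMatrix X) := by
  obtain ⟨M, hM, rfl⟩ := h
  exact ⟨f.mapMatrix M, by rw [← mapMatrix_transpose, hM, map_neg],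
    by rw [mapMatrix_trace, map_mul, mapMatrix_pfAdj]⟩

/-- Pairing with a difference of two matrix units gives twice the entry, whence the factor `c =
1/2`. -/
theorem pfAdj_mem_pfaffianIdeal (h2 : IsUnit (2 : S)) (X : Matrix (Fin 6) (Fin 6) S)
    (i j : Fin 6) : pfAdj X i j ∈ pfaffianIdeal X := by
  obtain ⟨c, hc⟩ := h2.exists_left_inv
  refine ⟨c • (Matrix.single j i 1 - Matrix.single i j 1), ?_, ?_⟩
  · rw [transpose_smul, transpose_sub, transpose_single, transpose_single, ← smul_neg, neg_sub]
  · have h : pfAdj X j i = -pfAdj X i j := congrFun (congrFun (pfAdj_transpose X) i) j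
    rw [smul_mul_assoc, trace_smul, sub_mul, trace_sub, trace_single_mul, trace_single_mul, h]
    simp only [one_mul, smul_eq_mul]
    linear_combination (-pfAdj X i j) * hc

/-- Separation of the first variable of a polynomial ring. -/
noncomputable def firstVariableEquiv (n : ℕ) (C : Type u) [CommRing C] :
    MvPolynomial (Fin (n + 1)) C ≃+* MvPolynomial (Fin n) (Polynomial C) :=
  ((renameEquiv C (_root_.finSuccEquiv n)).trans (optionEquivRight C (Fin n))).toRingEquiv

theorem firstVariableEquiv_aeval_zero {n : ℕ} {C : Type u} [CommRing C] (a : Polynomial C) :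
    firstVariableEquiv n C (Polynomial.aeval (X 0) a) = MvPolynomial.C a := by
  have h : ((renameEquiv C (_root_.finSuccEquiv n)).trans (optionEquivRight C (Fin n))).toAlgHom.comp
      (Polynomial.aeval (X 0)) = IsScalarTower.toAlgHom C (Polynomial C) _ := by
    ext; simp [algebraMap_eq]
  exact DFunLike.congr_fun h a

theorem firstVariableEquiv_X_succ {n : ℕ} {C : Type u} [CommRing C] (i : Fin n) :
    firstVariableEquiv n C (X i.succ) = X i := by
  simp [firstVariableEquiv]

theorem firstVariableEquiv_C {n : ℕ} {C : Type u} [CommRing C] (r : C) :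
    firstVariableEquiv n C (MvPolynomial.C r) = MvPolynomial.C (Polynomial.C r) := by
  simp [firstVariableEquiv]

/-- A monic `a` in the first variable is a nonzerodivisor, and the quotient is a polynomial ring in
the remaining variables over `C[t]/(a)`, where the other polynomials stay monic. Hence the induction
must allow every base ring `C`. -/
theorem hasPfaffianGrade_of_monic : ∀ (n : ℕ) (C : Type u) [CommRing C]
    (Z : Matrix (Fin 6) (Fin 6) (MvPolynomial (Fin n) C)),
    (∀ i, ∃ a : Polynomial C, a.Monic ∧ Polynomial.aeval (X i) a ∈ pfaffianIdeal Z) →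
    HasPfaffianGrade Z n
  | 0, _, _, Z, _ => .zero Z
  | n + 1, C, _, Z, h => by
    obtain ⟨a, ha, M, hM, haM⟩ := h 0
    let f : MvPolynomial (Fin (n + 1)) C →+* MvPolynomial (Fin n) (AdjoinRoot a) :=
      (MvPolynomial.map (AdjoinRoot.mk a)).comp (firstVariableEquiv n C : _ →+* _)
    refine .succ Z M f n hM ?_ ?_ ?_ (hasPfaffianGrade_of_monic n (AdjoinRoot a) _ ?_)
    · intro s hs
      rw [← haM] at hs
      apply (firstVariableEquiv n C).injective
      have hs' := congrArg (firstVariableEquiv n C) hs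
      rw [map_mul, firstVariableEquiv_aeval_zero, map_zero] at hs'
      rw [map_zero]
      ext1 m
      have := congrArg (MvPolynomial.coeff m) hs'
      rw [MvPolynomial.coeff_C_mul, MvPolynomial.coeff_zero] at this
      rw [MvPolynomial.coeff_zero]
      exact (ha.mul_right_eq_zero_iff).1 this
    · exact (MvPolynomial.map_surjective _ AdjoinRoot.mk_surjective).comp
        (firstVariableEquiv n C).surjective
    · rw [← haM]
      ext s
      rw [RingHom.mem_ker, RingHom.comp_apply, ← RingHom.mem_ker, MvPolynomial.ker_map,
        show RingHom.ker (AdjoinRoot.mk a) = Ideal.span {a} from Ideal.mk_ker, Ideal.map_span,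
        Set.image_singleton, Ideal.mem_span_singleton, Ideal.mem_span_singleton,
        ← firstVariableEquiv_aeval_zero]
      exact map_dvd_iff (firstVariableEquiv n C)
    · intro i
      obtain ⟨c, hc, hci⟩ := h i.succ
      refine ⟨c.map (AdjoinRoot.of a), hc.map _, ?_⟩
      convert map_mem_pfaffianIdeal f hci using 1
      have hC : (algebraMap (AdjoinRoot a) (MvPolynomial (Fin n) (AdjoinRoot a))).comp
          (AdjoinRoot.of a) = f.comp (algebraMap C _) := by
        ext1 r
        simp [f, algebraMap_eq, firstVariableEquiv_C]
      have hX : f (X i.succ) = X i := by simp [f, firstVariableEquiv_X_succ]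
      rw [Polynomial.aeval_def, Polynomial.aeval_def, Polynomial.eval₂_map, Polynomial.hom_eval₂,
        hC, hX]

theorem prod_mem_pow_card {B A ι : Type*} [CommRing B] [CommRing A] [Algebra B A]
    (N : Submodule B A) (T : Finset ι) (w : ι → A) (hw : ∀ i, w i ∈ N) :
    ∏ i ∈ T, w i ∈ N ^ T.card := by
  classical
  induction T using Finset.induction_on with
  | empty => simp [Submodule.one_le.1 le_rfl]
  | insert i T hi ih =>
    rw [Finset.prod_insert hi, Finset.card_insert_of_notMem hi, pow_succ']
    exact Submodule.mul_mem_mul (hw i) ih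

/-- If the fourth power of each of six elements `y i` is a polynomial of degree at most `3` in the
`y i`, then polynomials in the `y i` have degree at most `18`. -/
theorem span_pow_succ_le {B A : Type*} [CommRing B] [CommRing A] [Algebra B A] (y : Fin 6 → A)
    (N : Submodule B A) (hN : N = Submodule.span B (Set.range fun o : Option (Fin 6) => o.elim 1 y))
    (hy : ∀ i, y i ^ 4 ∈ N ^ 3) : N ^ 19 ≤ N ^ 18 := by
  classical
  have hv : ∀ o : Option (Fin 6), o.elim 1 y ∈ N := fun o => by
    rw [hN]; exact Submodule.subset_span ⟨o, rfl⟩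
  rw [hN, Submodule.span_pow, ← hN, Submodule.span_le]
  intro x hx
  rw [Set.mem_pow] at hx
  obtain ⟨g, rfl⟩ := hx
  choose o ho using fun i => (g i).2
  rw [List.prod_ofFn]
  simp only [← ho]
  by_cases h : ∃ i, o i = none
  · obtain ⟨i, hi⟩ := h
    rw [← Finset.mul_prod_erase _ _ (Finset.mem_univ i), hi, Option.elim_none, one_mul]
    have := prod_mem_pow_card N (Finset.univ.erase i) (fun i => (o i).elim 1 y) fun i => hv _
    rwa [Finset.card_erase_of_mem (Finset.mem_univ i), Finset.card_univ, Fintype.card_fin] at this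
  · push Not at h
    choose t ht using fun i => Option.ne_none_iff_exists'.1 (h i)
    -- Since `19 > 6 * 3`, a product of 19 of the six `y i` contains some `y k` at least four times.
    obtain ⟨k, -, hk⟩ := Finset.exists_lt_card_fiber_of_mul_lt_card_of_maps_to
      (s := (Finset.univ : Finset (Fin 19))) (t := (Finset.univ : Finset (Fin 6))) (f := t) (n := 3)
      (fun _ _ => Finset.mem_univ _) (by simp)
    obtain ⟨T, hT, hT4⟩ := Finset.exists_subset_card_eq (show 4 ≤ _ from hk)
    rw [← Finset.prod_mul_prod_compl T]
    have h1 : ∏ i ∈ T, (o i).elim 1 y = y k ^ 4 := by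
      rw [← hT4]
      apply Finset.prod_eq_pow_card
      intro i hi
      rw [ht, Option.elim_some, (Finset.mem_filter.1 (hT hi)).2]
    have h3 := prod_mem_pow_card N Tᶜ (fun i => (o i).elim 1 y) fun i => hv _
    rw [Finset.card_compl, hT4, Fintype.card_fin] at h3
    rw [h1]
    have := Submodule.mul_mem_mul (hy k) h3
    rwa [← pow_add] at this

/-- A linear section of the space of skew-symmetric `6 × 6` matrices, displaced by constants. -/
noncomputable def sectionEntries {B : Type*} [CommRing B] (b : Fin 9 → B) :
    Fin 15 → MvPolynomial (Fin 6) B :=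
  ![C (b 0), C (b 1), X 0, X 1, X 2, -X 0 + C (b 2), -X 1 + C (b 3), X 3, X 4,
    -X 2 - X 3 + C (b 4), -X 4 + C (b 5), X 5, -X 5 + C (b 6), C (b 7), C (b 8)]

theorem subPf_mem_pfaffianIdeal (h2 : IsUnit (2 : S)) (Z : Matrix (Fin 6) (Fin 6) S) :
    subPf Z 0 1 2 3 ∈ pfaffianIdeal Z ∧ subPf Z 0 1 2 4 ∈ pfaffianIdeal Z ∧
    subPf Z 0 1 3 4 ∈ pfaffianIdeal Z ∧ subPf Z 0 1 4 5 ∈ pfaffianIdeal Z ∧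
    subPf Z 0 2 3 5 ∈ pfaffianIdeal Z ∧ subPf Z 1 2 3 4 ∈ pfaffianIdeal Z ∧
    subPf Z 1 2 4 5 ∈ pfaffianIdeal Z ∧ subPf Z 2 3 4 5 ∈ pfaffianIdeal Z := by
  have h := pfAdj_mem_pfaffianIdeal h2 Z
  exact ⟨h 5 4, h 3 5, h 5 2, h 3 2, h 4 1, h 5 0, h 3 0, h 1 0⟩

/-- `N` stands for polynomials of degree at most 1 in the `y i`. The eight hypotheses are quadrics
that drop to degree 1; explicit certificates write each `y i ^ 4` as a combination of them with
coefficients of degree 2, so the result has degree at most 3. -/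
theorem pow_four_mem_of_quadratic_relations {B A : Type*} [CommRing B] [CommRing A] [Algebra B A]
    (N : Submodule B A) (y : Fin 6 → A) (hy : ∀ i, y i ∈ N)
    (h0 : y 0 * y 0 ∈ N) (h1 : y 0 * y 1 ∈ N) (h2 : y 0 * y 3 + y 1 * y 1 ∈ N)
    (h3 : y 1 * y 4 - y 2 * y 3 ∈ N) (h4 : y 2 * y 2 + y 2 * y 3 + y 0 * y 5 ∈ N)
    (h5 : y 3 * y 3 + y 2 * y 3 + y 1 * y 4 - y 0 * y 5 ∈ N) (h6 : y 4 * y 4 + y 3 * y 5 ∈ N)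
    (h7 : y 5 * y 5 ∈ N) (i : Fin 6) : y i ^ 4 ∈ N ^ 3 := by
  have hyy : ∀ i j, y i * y j ∈ N ^ 2 := fun i j => by
    rw [pow_two]; exact Submodule.mul_mem_mul (hy i) (hy j)
  have hm : ∀ {r q : A}, r ∈ N → q ∈ N ^ 2 → r * q ∈ N ^ 3 := fun hr hq => by
    rw [pow_succ']; exact Submodule.mul_mem_mul hr hq
  -- This square is the remainder left by the certificates for `y 2 ^ 4` and `y 3 ^ 4`.
  have hbe : (y 1 * y 4) * (y 1 * y 4) ∈ N ^ 3 := by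
    rw [show (y 1 * y 4) * (y 1 * y 4) = (y 0 * y 3 + y 1 * y 1) * (y 4 * y 4)
      - (y 4 * y 4 + y 3 * y 5) * (y 0 * y 3)
      + (y 3 * y 3 + y 2 * y 3 + y 1 * y 4 - y 0 * y 5) * (y 0 * y 5)
      + (y 1 * y 4 - y 2 * y 3) * (y 0 * y 5) - (2 : ℕ) • ((y 0 * y 1) * (y 4 * y 5))
      + (y 0 * y 0) * (y 5 * y 5) by simp only [nsmul_eq_mul]; push_cast; ring]
    exact add_mem (sub_mem (add_mem (add_mem (sub_mem (hm h2 (hyy _ _)) (hm h6 (hyy _ _)))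
      (hm h5 (hyy _ _))) (hm h3 (hyy _ _))) (nsmul_mem (hm h1 (hyy _ _)) 2)) (hm h0 (hyy _ _))
  fin_cases i
  · show y 0 ^ 4 ∈ N ^ 3
    rw [show y 0 ^ 4 = (y 0 * y 0) * (y 0 * y 0) by ring]
    exact hm h0 (hyy _ _)
  · show y 1 ^ 4 ∈ N ^ 3
    rw [show y 1 ^ 4 = (y 0 * y 3 + y 1 * y 1) * (y 1 * y 1 - y 0 * y 3)
      + (y 0 * y 0) * (y 3 * y 3) by ring]
    exact add_mem (hm h2 (sub_mem (hyy _ _) (hyy _ _))) (hm h0 (hyy _ _))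
  · show y 2 ^ 4 ∈ N ^ 3
    rw [show y 2 ^ 4 = ((y 2 * y 2 + y 2 * y 3 + y 0 * y 5) + (y 1 * y 4 - y 2 * y 3))
        * (y 2 * y 2 - y 1 * y 4 - y 0 * y 5) + ((y 1 * y 4) * (y 1 * y 4)
      + (2 : ℕ) • ((y 0 * y 1) * (y 4 * y 5)) + (y 0 * y 0) * (y 5 * y 5)) by
      simp only [nsmul_eq_mul]; push_cast; ring]
    exact add_mem (hm (add_mem h4 h3) (sub_mem (sub_mem (hyy _ _) (hyy _ _)) (hyy _ _)))
      (add_mem (add_mem hbe (nsmul_mem (hm h1 (hyy _ _)) 2)) (hm h0 (hyy _ _)))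
  · show y 3 ^ 4 ∈ N ^ 3
    rw [show y 3 ^ 4 = ((y 3 * y 3 + y 2 * y 3 + y 1 * y 4 - y 0 * y 5) + (y 1 * y 4 - y 2 * y 3))
        * (y 3 * y 3 + y 0 * y 5 - (2 : ℕ) • (y 1 * y 4)) + ((y 0 * y 0) * (y 5 * y 5)
      - (4 : ℕ) • ((y 0 * y 1) * (y 4 * y 5)) + (4 : ℕ) • ((y 1 * y 4) * (y 1 * y 4))) by
      simp only [nsmul_eq_mul]; push_cast; ring]
    exact add_mem (hm (add_mem h5 h3) (sub_mem (add_mem (hyy _ _) (hyy _ _))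
      (nsmul_mem (hyy _ _) 2))) (add_mem (sub_mem (hm h0 (hyy _ _))
      (nsmul_mem (hm h1 (hyy _ _)) 4)) (nsmul_mem hbe 4))
  · show y 4 ^ 4 ∈ N ^ 3
    rw [show y 4 ^ 4 = (y 4 * y 4 + y 3 * y 5) * (y 4 * y 4 - y 3 * y 5)
      + (y 5 * y 5) * (y 3 * y 3) by ring]
    exact add_mem (hm h6 (sub_mem (hyy _ _) (hyy _ _))) (hm h7 (hyy _ _))
  · show y 5 ^ 4 ∈ N ^ 3
    rw [show y 5 ^ 4 = (y 5 * y 5) * (y 5 * y 5) by ring]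
    exact hm h7 (hyy _ _)

/-- In `sectionEntries` the upper-triangular entries `(i, j)` with `i + j = s` sum to the constant
`b (s - 1)`, for `s = 1, …, 9`: the rank levels of the poset of Plücker coordinates supply a system
of parameters. Eight of the Pfaffians then have the quadratic parts required by
`pow_four_mem_of_quadratic_relations`. -/
theorem sectionQuotient_pow_four_mem {B : Type*} [CommRing B] (h2 : IsUnit (2 : B)) (b : Fin 9 → B)
    (I : Ideal (MvPolynomial (Fin 6) B)) (hI : I = pfaffianIdeal (skewOf (sectionEntries b)))
    (y : Fin 6 → MvPolynomial (Fin 6) B ⧸ I) (hy : ∀ i, y i = Ideal.Quotient.mk I (X i))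
    (N : Submodule B (MvPolynomial (Fin 6) B ⧸ I))
    (hN : N = Submodule.span B (Set.range fun o : Option (Fin 6) => o.elim 1 y)) (i : Fin 6) :
    y i ^ 4 ∈ N ^ 3 := by
  have hyN : ∀ i, y i ∈ N := fun i => by
    rw [hN]; exact Submodule.subset_span ⟨some i, rfl⟩
  have h1N : (1 : MvPolynomial (Fin 6) B ⧸ I) ∈ N := by
    rw [hN]; exact Submodule.subset_span ⟨none, rfl⟩
  let ι : B →+* MvPolynomial (Fin 6) B ⧸ I := (Ideal.Quotient.mk I).comp C
  have hιm : ∀ (β : B) {m}, m ∈ N → ι β * m ∈ N := fun β m hm => by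
    have : β • m = ι β * m := Algebra.smul_def β m
    rw [← this]; exact N.smul_mem β hm
  have hι : ∀ β, ι β ∈ N := fun β => by simpa using hιm β h1N
  have h2' : IsUnit (2 : MvPolynomial (Fin 6) B) := map_ofNat (C : B →+* MvPolynomial (Fin 6) B) 2 ▸
    h2.map (C : B →+* MvPolynomial (Fin 6) B)
  have hq : ∀ {s}, s ∈ pfaffianIdeal (skewOf (sectionEntries b)) → Ideal.Quotient.mk I s = 0 :=
    fun hs => Ideal.Quotient.eq_zero_iff_mem.2 (hI ▸ hs)
  have hιC : ∀ β, Ideal.Quotient.mk I (C β) = ι β := fun _ => rfl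
  obtain ⟨e0, e1, e2, e3, e4, e5, e6, e7⟩ :=
    subPf_mem_pfaffianIdeal h2' (skewOf (sectionEntries b))
  replace e0 := hq e0
  replace e1 := hq e1
  replace e2 := hq e2
  replace e3 := hq e3
  replace e4 := hq e4
  replace e5 := hq e5
  replace e6 := hq e6
  replace e7 := hq e7
  simp only [subPf, skewOf, sectionEntries, Matrix.of_apply, Matrix.cons_val, map_add, map_sub,
    map_mul, map_neg, hιC, ← hy] at e0 e1 e2 e3 e4 e5 e6 e7
  have nf : ∀ {r : MvPolynomial (Fin 6) B ⧸ I} (l : MvPolynomial (Fin 6) B ⧸ I),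
      l ∈ N → r = l → r ∈ N := fun l hl h => h ▸ hl
  refine pow_four_mem_of_quadratic_relations N y hyN
    (nf (ι (b 0) * (-y 2 - y 3 + ι (b 4)) - ι (b 1) * (-y 1 + ι (b 3)) + ι (b 2) * y 0) ?_
      (by linear_combination -e0))
    (nf (ι (b 0) * (-y 4 + ι (b 5)) - ι (b 1) * y 3 + ι (b 2) * y 1) ?_
      (by linear_combination -e1))
    (nf (ι (b 0) * (-y 5 + ι (b 6)) + ι (b 3) * y 1) ?_
      (by linear_combination -e2))
    (nf (ι (b 0) * ι (b 8)) ?_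
      (by linear_combination -e3))
    (nf (ι (b 1) * ι (b 7) + ι (b 4) * y 2) ?_
      (by linear_combination -e4))
    (nf (-(ι (b 6) * y 0) - ι (b 2) * y 5 + ι (b 2) * ι (b 6) + ι (b 5) * y 1
      + ι (b 3) * y 4 - ι (b 3) * ι (b 5) + ι (b 4) * y 3) ?_
      (by linear_combination -e5))
    (nf (ι (b 8) * (-y 0 + ι (b 2)) + ι (b 5) * y 4) ?_
      (by linear_combination -e6))
    (nf (ι (b 8) * (-y 2 - y 3 + ι (b 4)) - ι (b 7) * (-y 4 + ι (b 5)) + ι (b 6) * y 5) ?_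
      (by linear_combination -e7)) i <;>
    repeat' first | exact hyN _ | exact hι _ | apply hιm | apply add_mem | apply sub_mem | apply neg_mem

theorem hasPfaffianGrade_sectionEntries {B : Type u} [CommRing B] (h2 : IsUnit (2 : B))
    (b : Fin 9 → B) : HasPfaffianGrade (skewOf (sectionEntries b)) 6 := by
  apply hasPfaffianGrade_of_monic
  intro i
  generalize hI : pfaffianIdeal (skewOf (sectionEntries b)) = I
  let y : Fin 6 → MvPolynomial (Fin 6) B ⧸ I := fun i => Ideal.Quotient.mk I (X i)
  let N : Submodule B (MvPolynomial (Fin 6) B ⧸ I) :=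
    Submodule.span B (Set.range fun o : Option (Fin 6) => o.elim 1 y)
  have hle : N ^ 19 ≤ N ^ 18 := span_pow_succ_le y N rfl fun i =>
    sectionQuotient_pow_four_mem h2 b I hI.symm y (fun _ => rfl) N rfl i
  have h1 : (1 : MvPolynomial (Fin 6) B ⧸ I) ∈ N ^ 18 := by
    have : (1 : MvPolynomial (Fin 6) B ⧸ I) ∈ N := Submodule.subset_span ⟨none, rfl⟩
    simpa using Submodule.pow_mem_pow N this 18
  -- `N ^ 18` contains the constants and, by `hle`, is stable under multiplication by each variable.
  have htop : N ^ 18 = ⊤ := by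
    rw [eq_top_iff]
    rintro q -
    obtain ⟨p, rfl⟩ := Ideal.Quotient.mk_surjective q
    induction p using MvPolynomial.induction_on with
    | C r =>
      have : Ideal.Quotient.mk I (C r) = r • (1 : MvPolynomial (Fin 6) B ⧸ I) := by
        rw [Algebra.smul_def, mul_one]; rfl
      rw [this]
      exact Submodule.smul_mem _ _ h1
    | add p q hp hq => rw [map_add]; exact add_mem hp hq
    | mul_X p i hp =>
      rw [map_mul]
      apply hle
      rw [pow_succ]
      exact Submodule.mul_mem_mul hp (Submodule.subset_span ⟨some i, rfl⟩)
  have hfin : Module.Finite B (MvPolynomial (Fin 6) B ⧸ I) := by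
    refine ⟨?_⟩
    rw [← htop]
    exact (Submodule.fg_span (Set.finite_range _)).pow 18
  -- An integral equation for the class of `X i` is a monic polynomial in `X i` lying in the
  -- Pfaffian ideal.
  obtain ⟨a, ha, hay⟩ := IsIntegral.of_finite B (y i)
  refine ⟨a, ha, ?_⟩
  rw [← Ideal.Quotient.eq_zero_iff_mem, Polynomial.aeval_def, Polynomial.hom_eval₂]
  exact hay

end Grade

/-! ### Nonzerodivisors modulo the Pfaffian ideal of the generic matrix -/

section GenericMatrix

theorem mapMatrix_skewOf {S S' : Type*} [CommRing S] [CommRing S'] (f : S →+* S')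
    (x : Fin 15 → S) : f.mapMatrix (skewOf x) = skewOf fun k => f (x k) := by
  ext i j; fin_cases i <;> fin_cases j <;> simp [skewOf]

theorem HasPfaffianGrade.of_ringEquiv {S S' : Type u} [CommRing S] [CommRing S'] (e : S ≃+* S')
    {X : Matrix (Fin 6) (Fin 6) S} {Z : Matrix (Fin 6) (Fin 6) S'}
    (hZ : (e : S →+* S').mapMatrix X = Z) {n : ℕ} (h : HasPfaffianGrade Z n) :
    HasPfaffianGrade X n := by
  cases h with
  | zero => exact .zero X
  | succ _ M f n hM ha hf hk h =>
    have key : (e : S →+* S') (trace ((e.symm : S' →+* S).mapMatrix M * pfAdj X)) =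
        trace (M * pfAdj Z) := by
      rw [mapMatrix_trace, map_mul, mapMatrix_pfAdj, hZ]
      congr 2
      ext i j; simp
    have key' : e (trace ((e.symm : S' →+* S).mapMatrix M * pfAdj X)) = trace (M * pfAdj Z) := key
    refine .succ X ((e.symm : S' →+* S).mapMatrix M) (f.comp (e : S →+* S')) n
      (by rw [← mapMatrix_transpose, hM, map_neg]) ?_ (hf.comp e.surjective) ?_ ?_
    · intro s hs
      have := congrArg e hs
      rw [map_mul, key', map_zero] at this
      exact (map_eq_zero_iff e e.injective).1 (ha _ this)
    · ext s
      rw [RingHom.mem_ker, RingHom.comp_apply, ← RingHom.mem_ker, hk, Ideal.mem_span_singleton,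
        Ideal.mem_span_singleton, ← key]
      exact map_dvd_iff e
    · have : (f.comp (e : S →+* S')).mapMatrix X = f.mapMatrix Z := by rw [← hZ]; ext i j; simp
      rwa [this]

theorem exists_mapMatrix_eq_of_trace_zero {S S' : Type*} [CommRing S] [CommRing S']
    {f : S →+* S'} (hf : Function.Surjective f) {Z : Matrix (Fin 6) (Fin 6) S'}
    (hZ : trace Z = 0) : ∃ W, trace W = 0 ∧ f.mapMatrix W = Z := by
  obtain ⟨W, rfl⟩ := exists_mapMatrix_eq hf Z
  rw [← mapMatrix_trace] at hZ
  refine ⟨W - Matrix.single 0 0 (trace W), ?_, ?_⟩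
  · rw [trace_sub, trace_single_eq_same, sub_self]
  · rw [map_sub, RingHom.mapMatrix_apply, RingHom.mapMatrix_apply, Matrix.map_single, hZ,
      Matrix.single_zero, sub_zero]

theorem trace_boundary_mul_pfAdj {S : Type*} [CommRing S] (h2 : IsUnit (2 : S))
    {X A : Matrix (Fin 6) (Fin 6) S} (hX : Xᵀ = -X) (hA : trace A = 0) :
    trace ((A * X + X * Aᵀ) * pfAdj X) = 0 := by
  rw [add_mul, trace_add, mul_assoc, mul_pfAdj h2 hX, trace_mul_comm (X * Aᵀ), ← mul_assoc,
    pfAdj_mul h2 hX]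
  simp [hA]

/-- A nonzerodivisor modulo which the complex is exact in degree one remains a nonzerodivisor modulo
the ideal of Pfaffians. -/
theorem mem_pfaffianIdeal_of_mul_mem {S S' : Type*} [CommRing S] [CommRing S'] {f : S →+* S'}
    {t : S} (h2 : IsUnit (2 : S)) (ht : ∀ s, t * s = 0 → s = 0) (hf : Function.Surjective f)
    (hk : RingHom.ker f = Ideal.span {t}) {X : Matrix (Fin 6) (Fin 6) S} (hX : Xᵀ = -X)
    (h : PfaffianExactAt (f.mapMatrix X) 1) {s : S} (hs : t * s ∈ pfaffianIdeal X) :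
    s ∈ pfaffianIdeal X := by
  obtain ⟨C, hC, hCs⟩ := hs
  have hft : f t = 0 := by
    rw [← RingHom.mem_ker, hk]; exact Ideal.mem_span_singleton_self t
  -- Modulo `t` the matrix `C` is a cycle, so `C = d A + t V`. As `d A` pairs to zero with `pfAdj
  -- X`, this gives `t s = t tr (V Y)`.
  obtain ⟨A', hA', hCA⟩ := h (f.mapMatrix C) (by rw [← mapMatrix_transpose, hC, map_neg])
    (by rw [← mapMatrix_pfAdj, ← map_mul, ← mapMatrix_trace, ← hCs, map_mul, hft, zero_mul])
  obtain ⟨A, hA, rfl⟩ := exists_mapMatrix_eq_of_trace_zero hf hA'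
  rw [← mapMatrix_transpose, ← map_mul, ← map_mul, ← map_add] at hCA
  obtain ⟨V, rfl⟩ := exists_eq_add_smul hk hCA
  refine ⟨V, smul_matrix_left_cancel ht ?_, sub_eq_zero.1 (ht _ ?_)⟩
  · simp only [transpose_add, transpose_mul, transpose_smul, transpose_transpose, hX, mul_neg,
      neg_mul] at hC
    linear_combination (norm := module) hC
  · rw [add_mul, trace_add, trace_boundary_mul_pfAdj h2 hX hA, zero_add, smul_mul_assoc,
      trace_smul, smul_eq_mul] at hCs
    rw [mul_sub, hCs, sub_self]

theorem exists_mem_pfaffianIdeal_map_eq {S S' : Type*} [CommRing S] [CommRing S'] {f : S →+* S'}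
    (h2 : IsUnit (2 : S)) (hf : Function.Surjective f) {X : Matrix (Fin 6) (Fin 6) S} {a : S'}
    (ha : a ∈ pfaffianIdeal (f.mapMatrix X)) : ∃ s ∈ pfaffianIdeal X, f s = a := by
  obtain ⟨M', hM', rfl⟩ := ha
  obtain ⟨M, hM, rfl⟩ := exists_mapMatrix_eq_of_skew h2 hf hM'
  exact ⟨_, ⟨M, hM, rfl⟩, by rw [mapMatrix_trace, map_mul, mapMatrix_pfAdj]⟩

/-- Setting the polynomial variable of the coefficients to zero. -/
noncomputable def coeffsEvalZero (B : Type u) [CommRing B] :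
    MvPolynomial (Fin 6) (Polynomial B) →+* MvPolynomial (Fin 6) B :=
  MvPolynomial.map (Polynomial.evalRingHom 0)

theorem coeffsEvalZero_surjective (B : Type u) [CommRing B] :
    Function.Surjective (coeffsEvalZero B) :=
  MvPolynomial.map_surjective _ fun b => ⟨Polynomial.C b, by simp⟩

theorem ker_coeffsEvalZero (B : Type u) [CommRing B] :
    RingHom.ker (coeffsEvalZero B) = Ideal.span {C Polynomial.X} := by
  rw [coeffsEvalZero, MvPolynomial.ker_map, Polynomial.ker_evalRingHom, map_zero, sub_zero,
    Ideal.map_span, Set.image_singleton]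

theorem C_polynomialX_mul_eq_zero (B : Type u) [CommRing B]
    (s : MvPolynomial (Fin 6) (Polynomial B)) (hs : C Polynomial.X * s = 0) : s = 0 := by
  ext1 m
  have := congrArg (coeff m) hs
  rw [coeff_C_mul, coeff_zero] at this
  rw [coeff_zero]
  exact Polynomial.monic_X.mul_right_eq_zero_iff.1 this

theorem mapMatrix_sectionEntries {B B' : Type*} [CommRing B] [CommRing B'] (φ : B →+* B')
    (b : Fin 9 → B) : (MvPolynomial.map φ).mapMatrix (skewOf (sectionEntries b)) =
      skewOf (sectionEntries fun k => φ (b k)) := by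
  rw [mapMatrix_skewOf]
  congr 1
  funext k
  fin_cases k <;> simp [sectionEntries]

/-- The constants `b` are arbitrary, so exactness persists when some of them are specialized to
zero. -/
theorem exactAt_sectionEntries {B : Type u} [CommRing B] (h2 : IsUnit (2 : B)) (b : Fin 9 → B)
    {i : ℕ} (hi : 1 ≤ i) : PfaffianExactAt (skewOf (sectionEntries b)) i :=
  (hasPfaffianGrade_sectionEntries h2 b).exactAt
    (map_ofNat (C : B →+* MvPolynomial (Fin 6) B) 2 ▸ h2.map (C : B →+* MvPolynomial (Fin 6) B))
    (skewOf_transpose _) i (by omega)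

section Adapted

variable {R P : Type u} [CommRing R] [CommRing P]
  (e : R ≃+* MvPolynomial (Fin 6) (Polynomial (Polynomial P))) {x : Fin 15 → R}
  {c : Fin 9 → Polynomial (Polynomial P)}

theorem isUnit_two_polynomial {B : Type*} [CommRing B] (h : IsUnit (2 : B)) :
    IsUnit (2 : Polynomial B) :=
  map_ofNat (Polynomial.C : B →+* Polynomial B) 2 ▸ h.map (Polynomial.C : B →+* Polynomial B)

/-- In adapted coordinates, the reduction modulo the first coordinate. -/
noncomputable def reduceFirst : R →+* MvPolynomial (Fin 6) (Polynomial P) :=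
  (coeffsEvalZero _).comp e.toRingHom

theorem reduceFirst_surjective : Function.Surjective (reduceFirst e) :=
  (coeffsEvalZero_surjective _).comp e.surjective

theorem ker_reduceFirst {t : R} (ht : e t = C Polynomial.X) :
    RingHom.ker (reduceFirst e) = Ideal.span {t} := by
  ext s
  have h : s ∈ RingHom.ker (reduceFirst e) ↔ e s ∈ RingHom.ker (coeffsEvalZero (Polynomial P)) :=
    Iff.rfl
  rw [h, ker_coeffsEvalZero, Ideal.mem_span_singleton, Ideal.mem_span_singleton, ← ht]
  exact map_dvd_iff e

theorem adapted_first_mul_eq_zero {t : R} (ht : e t = C Polynomial.X) (s : R) (hs : t * s = 0) :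
    s = 0 := by
  have h := congrArg e hs
  rw [map_mul, ht, map_zero] at h
  exact (map_eq_zero_iff e e.injective).1 (C_polynomialX_mul_eq_zero _ _ h)

theorem reduceFirst_mapMatrix (hx : ∀ k, e (x k) = sectionEntries c k) : (reduceFirst e).mapMatrix (skewOf x) =
    skewOf (sectionEntries fun k => Polynomial.evalRingHom 0 (c k)) := by
  rw [← mapMatrix_sectionEntries, mapMatrix_skewOf, mapMatrix_skewOf]
  congr 1
  funext k
  rw [← hx]
  rfl

theorem exactAt_reduceFirst (hP : IsUnit (2 : P))
    (e : R ≃+* MvPolynomial (Fin 6) (Polynomial (Polynomial P)))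
    (hx : ∀ k, e (x k) = sectionEntries c k) :
    PfaffianExactAt ((reduceFirst e).mapMatrix (skewOf x)) 1 := by
  rw [reduceFirst_mapMatrix e hx]
  exact exactAt_sectionEntries (isUnit_two_polynomial hP) _ le_rfl

theorem exactAt_adapted (h2 : IsUnit (2 : R)) (hP : IsUnit (2 : P))
    (e : R ≃+* MvPolynomial (Fin 6) (Polynomial (Polynomial P)))
    (hx : ∀ k, e (x k) = sectionEntries c k)
    {i : ℕ} (hi : 1 ≤ i) : PfaffianExactAt (skewOf x) i := by
  refine (HasPfaffianGrade.of_ringEquiv e (Z := skewOf (sectionEntries c)) ?_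
    (hasPfaffianGrade_sectionEntries
      (isUnit_two_polynomial (isUnit_two_polynomial hP)) _)).exactAt h2
    (skewOf_transpose _) i (by omega)
  rw [mapMatrix_skewOf]
  congr 1
  funext k
  exact hx k

theorem mem_pfaffianIdeal_of_first_mul_mem (h2 : IsUnit (2 : R)) (hP : IsUnit (2 : P))
    (e : R ≃+* MvPolynomial (Fin 6) (Polynomial (Polynomial P)))
    (hx : ∀ k, e (x k) = sectionEntries c k)
    (h0 : c 0 = Polynomial.X) {s : R}
    (hs : x 0 * s ∈ pfaffianIdeal (skewOf x)) : s ∈ pfaffianIdeal (skewOf x) := by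
  have ht : e (x 0) = C Polynomial.X := by rw [hx, ← h0]; rfl
  exact mem_pfaffianIdeal_of_mul_mem h2 (adapted_first_mul_eq_zero e ht)
    (reduceFirst_surjective e) (ker_reduceFirst e ht) (skewOf_transpose _)
    (exactAt_reduceFirst hP e hx) hs

/-- Turns membership in the Pfaffian ideal plus `x 0` into membership in the Pfaffian ideal of the
matrix reduced modulo `x 0`. -/
theorem mem_sup_span_first_iff (h2 : IsUnit (2 : R))
    (e : R ≃+* MvPolynomial (Fin 6) (Polynomial (Polynomial P)))
    (hx : ∀ k, e (x k) = sectionEntries c k)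
    (h0 : c 0 = Polynomial.X) {s : R} :
    s ∈ pfaffianIdeal (skewOf x) ⊔ Ideal.span {x 0} ↔ reduceFirst e s ∈
      pfaffianIdeal ((reduceFirst e).mapMatrix (skewOf x)) := by
  have ht : e (x 0) = C Polynomial.X := by rw [hx, ← h0]; rfl
  rw [← ker_reduceFirst e ht]
  constructor
  · intro hs
    obtain ⟨i, hi, t, ht, rfl⟩ := Submodule.mem_sup.1 hs
    rw [map_add, RingHom.mem_ker.1 ht, add_zero]
    exact map_mem_pfaffianIdeal _ hi
  · intro hs
    obtain ⟨i, hi, his⟩ := exists_mem_pfaffianIdeal_map_eq h2 (reduceFirst_surjective e) hs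
    refine Submodule.mem_sup.2 ⟨i, hi, s - i, ?_, by ring⟩
    rw [RingHom.mem_ker, map_sub, his, sub_self]

/-- After reduction modulo `x 0`, the second entry becomes the remaining polynomial variable;
setting it to zero again yields a displaced section, whose complex is exact. -/
theorem mem_sup_of_second_mul_mem (h2 : IsUnit (2 : R)) (hP : IsUnit (2 : P))
    (e : R ≃+* MvPolynomial (Fin 6) (Polynomial (Polynomial P)))
    (hx : ∀ k, e (x k) = sectionEntries c k)
    (h0 : c 0 = Polynomial.X)
    (h1 : c 1 = Polynomial.C Polynomial.X) {s : R}
    (hs : x 1 * s ∈ pfaffianIdeal (skewOf x) ⊔ Ideal.span {x 0}) :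
    s ∈ pfaffianIdeal (skewOf x) ⊔ Ideal.span {x 0} := by
  rw [mem_sup_span_first_iff h2 e hx h0, reduceFirst_mapMatrix e hx] at hs ⊢
  have ht : reduceFirst e (x 1) = C Polynomial.X := by
    have : reduceFirst e (x 1) = coeffsEvalZero _ (e (x 1)) := rfl
    rw [this, hx, show sectionEntries c 1 = C (c 1) from rfl, h1, coeffsEvalZero, map_C]
    simp
  rw [map_mul, ht] at hs
  have h2' : IsUnit (2 : MvPolynomial (Fin 6) (Polynomial P)) :=
    map_ofNat (reduceFirst e) 2 ▸ h2.map (reduceFirst e)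
  refine mem_pfaffianIdeal_of_mul_mem h2' (C_polynomialX_mul_eq_zero _)
    (coeffsEvalZero_surjective _) (ker_coeffsEvalZero _) (skewOf_transpose _) ?_ hs
  rw [coeffsEvalZero, mapMatrix_sectionEntries]
  exact exactAt_sectionEntries hP _ le_rfl

end Adapted

variable (K : Type u) [Field K]

/-- The constants of the linear section in the coordinates adapted to it. -/
noncomputable def sectionConstants :
    Fin 9 → Polynomial (Polynomial (MvPolynomial (Fin 7) K)) :=
  ![Polynomial.X, Polynomial.C Polynomial.X, Polynomial.C (Polynomial.C (X 0)),
    Polynomial.C (Polynomial.C (X 1)), Polynomial.C (Polynomial.C (X 2)),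
    Polynomial.C (Polynomial.C (X 3)), Polynomial.C (Polynomial.C (X 4)),
    Polynomial.C (Polynomial.C (X 5)), Polynomial.C (Polynomial.C (X 6))]

/-- The coordinate ring of the space of skew-symmetric `6 × 6` matrices in coordinates adapted to
the linear section. -/
noncomputable def sectionCoordinates : MvPolynomial (Fin 15) K ≃+*
    MvPolynomial (Fin 6) (Polynomial (Polynomial (MvPolynomial (Fin 7) K))) :=
  RingEquiv.ofRingHom
    (aeval (sectionEntries (sectionConstants K)) : MvPolynomial (Fin 15) K →ₐ[K] _).toRingHom
    -- The inverse sends the seven parameters other than `x 0` and `x 1` to the remaining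
    -- antidiagonal sums of the generic matrix.
    (eval₂Hom (Polynomial.eval₂RingHom (Polynomial.eval₂RingHom
      (aeval ![X 5 + X 2, X 6 + X 3, X 9 + X 4 + X 7, X 10 + X 8, X 12 + X 11, X 13, X 14] :
        MvPolynomial (Fin 7) K →ₐ[K] MvPolynomial (Fin 15) K).toRingHom (X 1)) (X 0))
      ![X 2, X 3, X 4, X 7, X 8, X 11])
    (by
      refine MvPolynomial.ringHom_ext' (Polynomial.ringHom_ext' (Polynomial.ringHom_ext'
        (MvPolynomial.ringHom_ext' ?_ fun i => ?_) ?_) ?_) fun i => ?_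
      · ext1 r; simp [MvPolynomial.algebraMap_eq]
      · fin_cases i <;> simp [sectionEntries, sectionConstants]
        abel
      · simp [sectionEntries, sectionConstants]
      · simp [sectionEntries, sectionConstants]
      · fin_cases i <;> simp [sectionEntries, sectionConstants])
    (by
      refine MvPolynomial.ringHom_ext' ?_ fun i => ?_
      · ext1 r; simp [MvPolynomial.algebraMap_eq]
      · fin_cases i <;> simp [-coe_eval₂Hom, sectionEntries, sectionConstants])

theorem sectionCoordinates_X (k : Fin 15) :
    sectionCoordinates K (X k) = sectionEntries (sectionConstants K) k := by
  simp [sectionCoordinates]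

variable [CharZero K]

theorem isUnit_two_of_algebra (A : Type*) [CommRing A] [Algebra K A] : IsUnit (2 : A) :=
  map_ofNat (algebraMap K A) 2 ▸ (isUnit_iff_ne_zero.2 (two_ne_zero' K)).map (algebraMap K A)

theorem generic_mem_of_X_zero_mul_mem {s : MvPolynomial (Fin 15) K}
    (hs : X 0 * s ∈ pfaffianIdeal (skewOf (X : Fin 15 → MvPolynomial (Fin 15) K))) :
    s ∈ pfaffianIdeal (skewOf (X : Fin 15 → MvPolynomial (Fin 15) K)) :=
  mem_pfaffianIdeal_of_first_mul_mem (isUnit_two_of_algebra K _) (isUnit_two_of_algebra K _)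
    (sectionCoordinates K) (sectionCoordinates_X K) rfl hs

/-- The ideal of Pfaffians of the generic skew-symmetric matrix together with its first entry. -/
noncomputable def schubertIdeal : Ideal (MvPolynomial (Fin 15) K) :=
  pfaffianIdeal (skewOf X) ⊔ Ideal.span {X 0}

theorem schubert_mem_of_X_one_mul_mem {s : MvPolynomial (Fin 15) K}
    (hs : X 1 * s ∈ schubertIdeal K) : s ∈ schubertIdeal K :=
  mem_sup_of_second_mul_mem (isUnit_two_of_algebra K _) (isUnit_two_of_algebra K _)
    (sectionCoordinates K) (sectionCoordinates_X K) rfl rfl hs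

end GenericMatrix

/-! ### The first and second fundamental theorems for six linear forms -/

section FundamentalTheorems

variable (K : Type u) [Field K]

/-- The determinant of the `i`-th and the `j`-th of six linear forms. -/
noncomputable def bracket (i j : Fin 6) : MvPolynomial (Fin 6 × Fin 2) K :=
  X (i, 0) * X (j, 1) - X (i, 1) * X (j, 0)

/-- The determinants of pairs of linear forms, in the order of the entries of `skewOf`. -/
noncomputable def plucker : Fin 15 → MvPolynomial (Fin 6 × Fin 2) K :=
  ![bracket K 0 1, bracket K 0 2, bracket K 0 3, bracket K 0 4, bracket K 0 5, bracket K 1 2,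
    bracket K 1 3, bracket K 1 4, bracket K 1 5, bracket K 2 3, bracket K 2 4, bracket K 2 5,
    bracket K 3 4, bracket K 3 5, bracket K 4 5]

variable {K}

theorem pfAdj_plucker : pfAdj (skewOf (plucker K)) = 0 := by
  ext1 i j
  fin_cases i <;> fin_cases j <;>
    simp only [Fin.zero_eta, Fin.mk_one, Fin.reduceFinMk, pfAdj, subPf, skewOf, plucker,
      Matrix.of_apply, Matrix.cons_val, bracket, Matrix.zero_apply] <;> ring

theorem aeval_plucker_eq_zero {f : MvPolynomial (Fin 15) K} (hf : f ∈ pfaffianIdeal (skewOf X)) :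
    aeval (plucker K) f = 0 := by
  have h := map_mem_pfaffianIdeal (aeval (plucker K) : MvPolynomial (Fin 15) K →ₐ[K] _).toRingHom hf
  rw [mapMatrix_skewOf] at h
  obtain ⟨M, -, hM⟩ := h
  have : (fun k => (aeval (plucker K) : MvPolynomial (Fin 15) K →ₐ[K] _).toRingHom (X k)) =
      plucker K := by funext k; simp
  rw [this, pfAdj_plucker, mul_zero, trace_zero] at hM
  exact hM

theorem eval_plucker (v : Fin 6 × Fin 2 → K) (f : MvPolynomial (Fin 15) K) :
    eval v (aeval (plucker K) f) = eval (fun k => eval v (plucker K k)) f := by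
  induction f using MvPolynomial.induction_on with
  | C r => simp [algebraMap_eq]
  | add p q hp hq => rw [map_add, map_add, map_add, hp, hq]
  | mul_X p i hp => rw [map_mul, map_mul, map_mul, hp, aeval_X, eval_X]

/-- Elimination of the variables outside `s`, after multiplication by a power of `X t`. -/
theorem exists_pow_mul_sub_mem {σ : Type*} (J : Ideal (MvPolynomial σ K)) (t : σ) (s : Set σ)
    (ht : t ∈ s) (h : ∀ k, k ∉ s → ∃ g ∈ supported K s, X t * X k - g ∈ J)
    (f : MvPolynomial σ K) : ∃ n : ℕ, ∃ g ∈ supported K s, X t ^ n * f - g ∈ J := by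
  have hX : (X t : MvPolynomial σ K) ∈ supported K s := X_mem_supported.2 ht
  induction f using MvPolynomial.induction_on with
  | C r => exact ⟨0, C r, (supported K s).algebraMap_mem r, by simp⟩
  | add p q hp hq =>
    obtain ⟨n, g, hg, hn⟩ := hp
    obtain ⟨m, g', hg', hm⟩ := hq
    refine ⟨n + m, X t ^ m * g + X t ^ n * g', add_mem (mul_mem (pow_mem hX m) hg)
      (mul_mem (pow_mem hX n) hg'), ?_⟩
    convert J.add_mem (J.mul_mem_left (X t ^ m) hn) (J.mul_mem_left (X t ^ n) hm) using 1
    ring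
  | mul_X p k hp =>
    obtain ⟨n, g, hg, hn⟩ := hp
    by_cases hk : k ∈ s
    · refine ⟨n, g * X k, mul_mem hg (X_mem_supported.2 hk), ?_⟩
      convert J.mul_mem_right (X k) hn using 1
      ring
    · obtain ⟨g', hg', hm⟩ := h k hk
      refine ⟨n + 1, g * g', mul_mem hg hg', ?_⟩
      convert J.add_mem (J.mul_mem_right (X t * X k) hn) (J.mul_mem_left g hm) using 1
      ring

theorem eval_eq_of_mem_supported {σ : Type*} {s : Set σ} {g : MvPolynomial σ K}
    (hg : g ∈ supported K s) {c d : σ → K} (h : ∀ k ∈ s, c k = d k) : eval c g = eval d g := by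
  refine eval₂Hom_congr' rfl (fun i hi _ => h i (mem_supported.1 hg hi)) rfl

theorem eq_zero_of_eval_eq_zero {σ : Type*} [Infinite K] (t : σ) {g : MvPolynomial σ K}
    (h : ∀ c : σ → K, c t ≠ 0 → eval c g = 0) : g = 0 := by
  have : X t * g = 0 := by
    apply MvPolynomial.funext
    intro c
    by_cases hc : c t = 0
    · simp [hc]
    · simp [h c hc]
  exact (mul_eq_zero.1 this).resolve_left (X_ne_zero t)

theorem exists_mem_supported_of_relation {σ : Type*} {J : Ideal (MvPolynomial σ K)} {s : Set σ}
    {p : MvPolynomial σ K} (a b c d : σ) (ha : a ∈ s) (hb : b ∈ s) (hc : c ∈ s) (hd : d ∈ s)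
    (h : p - X a * X b + X c * X d ∈ J) : ∃ g ∈ supported K s, p - g ∈ J := by
  refine ⟨X a * X b - X c * X d, sub_mem (mul_mem (X_mem_supported.2 ha) (X_mem_supported.2 hb))
    (mul_mem (X_mem_supported.2 hc) (X_mem_supported.2 hd)), ?_⟩
  rwa [← sub_add]

/-- The relation `[01][ij] = [0i][1j] - [0j][1i]` eliminates the six coordinates whose pair avoids 0
and 1, once `x 0 = [01]` is inverted. -/
theorem exists_mem_supported_pfaffianIdeal [CharZero K] (k : Fin 15)
    (hk : k ∉ ({0, 1, 2, 3, 4, 5, 6, 7, 8} : Set (Fin 15))) :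
    ∃ g ∈ supported K ({0, 1, 2, 3, 4, 5, 6, 7, 8} : Set (Fin 15)),
      X 0 * X k - g ∈ pfaffianIdeal (skewOf (X : Fin 15 → MvPolynomial (Fin 15) K)) := by
  have key : ∀ i j, pfAdj (skewOf (X : Fin 15 → MvPolynomial (Fin 15) K)) i j ∈
      pfaffianIdeal (skewOf X) := pfAdj_mem_pfaffianIdeal (isUnit_two_of_algebra K _) _
  have hk' : k = 9 ∨ k = 10 ∨ k = 11 ∨ k = 12 ∨ k = 13 ∨ k = 14 := by
    simp only [Set.mem_insert_iff, Set.mem_singleton_iff] at hk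
    clear key
    revert k
    decide
  rcases hk' with rfl | rfl | rfl | rfl | rfl | rfl
  · exact exists_mem_supported_of_relation 1 6 2 5 (by simp) (by simp) (by simp) (by simp) (by
      simpa only [pfAdj, subPf, skewOf, Matrix.of_apply, Matrix.cons_val]
        using key 5 4)
  · exact exists_mem_supported_of_relation 1 7 3 5 (by simp) (by simp) (by simp) (by simp) (by
      simpa only [pfAdj, subPf, skewOf, Matrix.of_apply, Matrix.cons_val]
        using key 3 5)
  · exact exists_mem_supported_of_relation 1 8 4 5 (by simp) (by simp) (by simp) (by simp) (by
      simpa only [pfAdj, subPf, skewOf, Matrix.of_apply, Matrix.cons_val]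
        using key 4 3)
  · exact exists_mem_supported_of_relation 2 7 3 6 (by simp) (by simp) (by simp) (by simp) (by
      simpa only [pfAdj, subPf, skewOf, Matrix.of_apply, Matrix.cons_val]
        using key 5 2)
  · exact exists_mem_supported_of_relation 2 8 4 6 (by simp) (by simp) (by simp) (by simp) (by
      simpa only [pfAdj, subPf, skewOf, Matrix.of_apply, Matrix.cons_val]
        using key 2 4)
  · exact exists_mem_supported_of_relation 3 8 4 7 (by simp) (by simp) (by simp) (by simp) (by
      simpa only [pfAdj, subPf, skewOf, Matrix.of_apply, Matrix.cons_val]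
        using key 3 2)

/-- With `[01] = 0`, the pivot `[02]` eliminates every coordinate except those of the pairs meeting
`{0, 2}` other than `(0, 1)`. -/
theorem exists_mem_supported_schubertIdeal [CharZero K] (k : Fin 15)
    (hk : k ∉ ({1, 2, 3, 4, 5, 9, 10, 11} : Set (Fin 15))) :
    ∃ g ∈ supported K ({1, 2, 3, 4, 5, 9, 10, 11} : Set (Fin 15)),
      X 1 * X k - g ∈ schubertIdeal K := by
  have key : ∀ i j, pfAdj (skewOf (X : Fin 15 → MvPolynomial (Fin 15) K)) i j ∈
      schubertIdeal K := fun i j => Ideal.mem_sup_left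
        (pfAdj_mem_pfaffianIdeal (isUnit_two_of_algebra K _) _ i j)
  have hX0 : ∀ p, X 0 * p ∈ schubertIdeal K := fun p =>
    Ideal.mul_mem_right _ _ (Ideal.mem_sup_right (Ideal.mem_span_singleton_self _))
  have aux : ∀ b c d k : Fin 15, c ∈ ({1, 2, 3, 4, 5, 9, 10, 11} : Set (Fin 15)) →
      d ∈ ({1, 2, 3, 4, 5, 9, 10, 11} : Set (Fin 15)) →
      X 0 * X b - X 1 * X k + X c * X d ∈ schubertIdeal K →
      ∃ g ∈ supported K ({1, 2, 3, 4, 5, 9, 10, 11} : Set (Fin 15)),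
        X 1 * X k - g ∈ schubertIdeal K := fun b c d k hc hd h =>
    ⟨X c * X d, mul_mem (X_mem_supported.2 hc) (X_mem_supported.2 hd), by
      convert sub_mem (hX0 (X b)) h using 1
      ring⟩
  have hk' : k = 0 ∨ k = 6 ∨ k = 7 ∨ k = 8 ∨ k = 12 ∨ k = 13 ∨ k = 14 := by
    simp only [Set.mem_insert_iff, Set.mem_singleton_iff] at hk
    clear key aux
    revert k
    decide
  rcases hk' with rfl | rfl | rfl | rfl | rfl | rfl | rfl
  · exact ⟨0, zero_mem _, by simpa [mul_comm] using hX0 (X 1)⟩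
  · exact aux 9 2 5 _ (by simp) (by simp) (by
      simpa only [pfAdj, subPf, skewOf, Matrix.of_apply, Matrix.cons_val]
        using key 5 4)
  · exact aux 10 3 5 _ (by simp) (by simp) (by
      simpa only [pfAdj, subPf, skewOf, Matrix.of_apply, Matrix.cons_val]
        using key 3 5)
  · exact aux 11 4 5 _ (by simp) (by simp) (by
      simpa only [pfAdj, subPf, skewOf, Matrix.of_apply, Matrix.cons_val]
        using key 4 3)
  · exact exists_mem_supported_of_relation 2 10 3 9 (by simp) (by simp) (by simp) (by simp)
      (by
      simpa only [pfAdj, subPf, skewOf, Matrix.of_apply, Matrix.cons_val]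
        using key 1 5)
  · exact exists_mem_supported_of_relation 2 11 4 9 (by simp) (by simp) (by simp) (by simp)
      (by
      simpa only [pfAdj, subPf, skewOf, Matrix.of_apply, Matrix.cons_val]
        using key 4 1)
  · exact exists_mem_supported_of_relation 3 11 4 10 (by simp) (by simp) (by simp) (by simp)
      (by
      simpa only [pfAdj, subPf, skewOf, Matrix.of_apply, Matrix.cons_val]
        using key 1 3)

/-- The second fundamental theorem. -/
theorem mem_pfaffianIdeal_of_aeval_plucker_eq_zero [CharZero K] {f : MvPolynomial (Fin 15) K}
    (hf : aeval (plucker K) f = 0) : f ∈ pfaffianIdeal (skewOf X) := by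
  obtain ⟨n, g, hg, hn⟩ := exists_pow_mul_sub_mem (pfaffianIdeal (skewOf X)) 0 _ (by simp)
    exists_mem_supported_pfaffianIdeal f
  have hg0 : aeval (plucker K) g = 0 := by
    have := aeval_plucker_eq_zero hn
    rw [map_sub, map_mul, hf, mul_zero, zero_sub, neg_eq_zero] at this
    exact this
  have hg' : g = 0 := by
    apply eq_zero_of_eval_eq_zero 0
    intro c hc
    -- Six vectors whose nine brackets involving 0 or 1 take the prescribed values `c`: those nine
    -- coordinates are independent where `c 0 ≠ 0`.
    let v : Fin 6 × Fin 2 → K := fun a =>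
      !![1, 0; 0, c 0; -c 5 / c 0, c 1; -c 6 / c 0, c 2; -c 7 / c 0, c 3; -c 8 / c 0, c 4] a.1 a.2
    have h := eval_plucker v g
    rw [hg0, map_zero] at h
    rw [h]
    apply eval_eq_of_mem_supported hg
    rintro k (rfl | rfl | rfl | rfl | rfl | rfl | rfl | rfl | rfl) <;>
      simp [plucker, bracket, v] <;> field_simp
  rw [hg', sub_zero] at hn
  -- Now `X 0 ^ n * f` lies in the ideal, and `X 0` is cancelled one factor at a time.
  induction n with
  | zero => simpa using hn
  | succ n ih =>
    rw [pow_succ', mul_assoc] at hn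
    refine ih ?_ 
    simpa using generic_mem_of_X_zero_mul_mem K hn

theorem aeval_plucker_mem_span {f : MvPolynomial (Fin 15) K} (hf : f ∈ schubertIdeal K) :
    bracket K 0 1 ∣ aeval (plucker K) f := by
  obtain ⟨i, hi, t, ht, rfl⟩ := Submodule.mem_sup.1 hf
  obtain ⟨t', rfl⟩ := Ideal.mem_span_singleton.1 ht
  rw [map_add, aeval_plucker_eq_zero hi, zero_add, map_mul, aeval_X]
  exact Dvd.intro _ rfl

theorem bracket_zero_one_ne_zero : bracket K 0 1 ≠ 0 := by
  intro h0
  have := congrArg (eval fun a : Fin 6 × Fin 2 => if a = (0, 0) ∨ a = (1, 1) then (1 : K) else 0) h0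
  simp [bracket] at this

/-- Vanishing of `f` on configurations with `[01] = 0` forces `f` into `schubertIdeal`; modulo the
relations, `f` is then a multiple of `X 0`, and the bracket cancels. -/
theorem exists_aeval_plucker_eq_of_mul [CharZero K] {h : MvPolynomial (Fin 6 × Fin 2) K}
    {f : MvPolynomial (Fin 15) K} (hf : bracket K 0 1 * h = aeval (plucker K) f) :
    ∃ f' : MvPolynomial (Fin 15) K, h = aeval (plucker K) f' := by
  obtain ⟨n, g, hg, hn⟩ := exists_pow_mul_sub_mem (schubertIdeal K) 1 _ (by simp)
    exists_mem_supported_schubertIdeal f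
  have hg0 : bracket K 0 1 ∣ aeval (plucker K) g := by
    have := aeval_plucker_mem_span hn
    rw [map_sub, map_mul, ← hf] at this
    exact (dvd_sub_right (Dvd.dvd.mul_left (Dvd.intro _ rfl) _)).1 this
  have hg' : g = 0 := by
    apply eq_zero_of_eval_eq_zero 1
    intro c hc
    -- The first two vectors are parallel, so `[01] = 0`, while the eight remaining brackets
    -- involving 0 or 2 take the prescribed values.
    let v : Fin 6 × Fin 2 → K := fun a =>
      !![1, 0; c 5 / c 1, 0; 0, c 1; -c 9 / c 1, c 2; -c 10 / c 1, c 3; -c 11 / c 1, c 4] a.1 a.2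
    have h := eval_plucker v g
    obtain ⟨q, hq⟩ := hg0
    have h0 : eval v (bracket K 0 1) = 0 := by simp [bracket, v]
    rw [hq, map_mul, h0, zero_mul] at h
    rw [h]
    apply eval_eq_of_mem_supported hg
    rintro k (rfl | rfl | rfl | rfl | rfl | rfl | rfl | rfl) <;>
      simp [plucker, bracket, v] <;> field_simp
  rw [hg', sub_zero] at hn
  have hfs : f ∈ schubertIdeal K := by
    induction n with
    | zero => simpa using hn
    | succ n ih =>
      rw [pow_succ', mul_assoc] at hn
      exact ih (schubert_mem_of_X_one_mul_mem K hn)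
  obtain ⟨i, hi, t, ht, rfl⟩ := Submodule.mem_sup.1 hfs
  obtain ⟨t', rfl⟩ := Ideal.mem_span_singleton.1 ht
  refine ⟨t', ?_⟩
  rw [map_add, aeval_plucker_eq_zero hi, zero_add, map_mul, aeval_X] at hf
  exact mul_left_cancel₀ bracket_zero_one_ne_zero hf

theorem linearForm_eq (p : BinaryForm K 1) : (p : MvPolynomial (Fin 2) K) =
    C (coeff (Finsupp.single 0 1) (p : MvPolynomial (Fin 2) K)) * X 0 +
      C (coeff (Finsupp.single 1 1) (p : MvPolynomial (Fin 2) K)) * X 1 := by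
  have hp : (p : MvPolynomial (Fin 2) K).IsHomogeneous 1 := (mem_homogeneousSubmodule 1 _).1 p.2
  have hq := (isHomogeneous_C_mul_X (coeff (Finsupp.single 0 1) (p : MvPolynomial (Fin 2) K))
    (0 : Fin 2)).add
    (isHomogeneous_C_mul_X (coeff (Finsupp.single 1 1) (p : MvPolynomial (Fin 2) K)) (1 : Fin 2))
  ext m
  by_cases hm : m.degree = 1
  · obtain ⟨j, rfl⟩ : ∃ j, m = Finsupp.single j 1 := by
      rw [Finsupp.degree_eq_sum, Fin.sum_univ_two] at hm
      rcases Nat.eq_zero_or_pos (m 0) with h | h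
      · exact ⟨1, by ext j; fin_cases j <;> simp <;> omega⟩
      · exact ⟨0, by ext j; fin_cases j <;> simp <;> omega⟩
    fin_cases j <;> simp [coeff_C_mul, coeff_X, Finsupp.single_left_inj]
  · rw [hp.coeff_eq_zero hm, hq.coeff_eq_zero hm]

theorem linearFormsCoord_act (g : Matrix.SpecialLinearGroup (Fin 2) K)
    (v : Fin 6 → BinaryForm K 1) : linearFormsCoord (fun i => BinaryForm.act g (v i)) =
      fun a => linearFormsCoord v (a.1, 0) * g⁻¹ 0 a.2 + linearFormsCoord v (a.1, 1) * g⁻¹ 1 a.2 := by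
  funext a
  obtain ⟨i, j⟩ := a
  simp only [linearFormsCoord, BinaryForm.act]
  conv_lhs => rw [linearForm_eq (v i)]
  fin_cases j <;>
    simp [coeff_C_mul, coeff_X, Finsupp.single_left_inj, mul_add, algebraMap_eq]

theorem eval_invariant {h : MvPolynomial (Fin 6 × Fin 2) K} (hh : h ∈ linearFormsInvariants K 6)
    (g : Matrix.SpecialLinearGroup (Fin 2) K) (c : Fin 6 × Fin 2 → K) :
    eval (fun a => c (a.1, 0) * g 0 a.2 + c (a.1, 1) * g 1 a.2) h = eval c h := by
  let v : Fin 6 → BinaryForm K 1 := fun i =>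
    ⟨C (c (i, 0)) * X 0 + C (c (i, 1)) * X 1, (mem_homogeneousSubmodule 1 _).2
      ((isHomogeneous_C_mul_X _ _).add (isHomogeneous_C_mul_X _ _))⟩
  have hv : linearFormsCoord v = c := by
    funext a
    obtain ⟨i, j⟩ := a
    fin_cases j <;> simp [linearFormsCoord, v, coeff_C_mul, coeff_X, Finsupp.single_left_inj]
  have := hh g⁻¹ v
  rwa [linearFormsCoord_act, hv, inv_inv] at this

theorem bracket_mem_invariants (i j : Fin 6) : bracket K i j ∈ linearFormsInvariants K 6 := by
  intro g v
  rw [linearFormsCoord_act]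
  generalize linearFormsCoord v = c
  have hdet := g⁻¹.det_coe
  rw [Matrix.det_fin_two] at hdet
  simp only [bracket, map_sub, map_mul, eval_X]
  linear_combination (c (i, 0) * c (j, 1) - c (i, 1) * c (j, 0)) * hdet

theorem plucker_mem_invariants (k : Fin 15) : plucker K k ∈ linearFormsInvariants K 6 := by
  fin_cases k <;> exact bracket_mem_invariants _ _

theorem aeval_plucker_skewOf (i j : Fin 6) :
    aeval (plucker K) (skewOf (X : Fin 15 → MvPolynomial (Fin 15) K) i j) = bracket K i j := by
  fin_cases i <;> fin_cases j <;> simp [skewOf, plucker, bracket] <;> ring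

/-- The point at which `h` is evaluated is the configuration with the first two vectors normalized
to `(1, 0)` and `(0, [01])`. Its coordinates are brackets divided by at most one `[01]`, so a power
of `[01]` clears the denominators. -/
theorem exists_pow_mul_eval_eq (h : MvPolynomial (Fin 6 × Fin 2) K) :
    ∃ (n : ℕ) (F : MvPolynomial (Fin 15) K), ∀ c : Fin 6 × Fin 2 → K, eval c (bracket K 0 1) ≠ 0 →
      eval c (bracket K 0 1) ^ n * eval (fun a => if a.2 = 0 then
        eval c (bracket K a.1 1) / eval c (bracket K 0 1) else eval c (bracket K 0 a.1)) h =
      eval c (aeval (plucker K) F) := by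
  induction h using MvPolynomial.induction_on with
  | C r => exact ⟨0, C r, fun c _ => by simp [algebraMap_eq]⟩
  | add p q hp hq =>
    obtain ⟨n, F, hF⟩ := hp
    obtain ⟨m, G, hG⟩ := hq
    refine ⟨n + m, X 0 ^ m * F + X 0 ^ n * G, fun c hc => ?_⟩
    rw [map_add, map_add, map_add, map_mul, map_mul, map_mul, map_mul, ← hF c hc, ← hG c hc,
      map_pow, map_pow, aeval_X, map_pow, map_pow, aeval_X,
      show plucker K 0 = bracket K 0 1 from rfl]
    generalize eval _ p = P
    generalize eval _ q = Q
    ring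
  | mul_X p a hp =>
    obtain ⟨n, F, hF⟩ := hp
    refine ⟨n + 1, F * if a.2 = 0 then skewOf X a.1 1 else X 0 * skewOf X 0 a.1, fun c hc => ?_⟩
    rw [map_mul, map_mul, map_mul, ← hF c hc, eval_X]
    generalize eval _ p = P
    split_ifs with ha
    · rw [aeval_plucker_skewOf]
      field_simp
      ring
    · rw [map_mul, aeval_plucker_skewOf, aeval_X, map_mul,
        show plucker K 0 = bracket K 0 1 from rfl]
      ring

/-- The first fundamental theorem. -/
theorem exists_aeval_plucker_eq [CharZero K] {h : MvPolynomial (Fin 6 × Fin 2) K}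
    (hh : h ∈ linearFormsInvariants K 6) : ∃ f : MvPolynomial (Fin 15) K, h = aeval (plucker K) f := by
  obtain ⟨n, F, hF⟩ := exists_pow_mul_eval_eq h
  have key : bracket K 0 1 ^ n * h = aeval (plucker K) F := by
    -- One extra factor `[01]` makes both sides vanish where the normalization is undefined, so
    -- comparison on all points is possible.
    refine mul_left_cancel₀ bracket_zero_one_ne_zero (MvPolynomial.funext fun c => ?_)
    by_cases hc : eval c (bracket K 0 1) = 0
    · rw [map_mul, map_mul _ (bracket K 0 1), hc, zero_mul, zero_mul]
    · rw [map_mul, map_mul _ (bracket K 0 1), ← hF c hc, map_mul, map_pow]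
      have hc' : c (0, 0) * c (1, 1) - c (0, 1) * c (1, 0) ≠ 0 := by simpa [bracket] using hc
      -- This element carries vector 0 to `(1, 0)` and vector 1 to `(0, [01])`.
      let g : Matrix.SpecialLinearGroup (Fin 2) K :=
        ⟨!![c (1, 1) / (c (0, 0) * c (1, 1) - c (0, 1) * c (1, 0)), -c (0, 1);
          -c (1, 0) / (c (0, 0) * c (1, 1) - c (0, 1) * c (1, 0)), c (0, 0)], by
          rw [Matrix.det_fin_two_of, div_mul_eq_mul_div, neg_mul, mul_div_assoc', neg_div', ← sub_div,
            div_eq_one_iff_eq hc']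
          ring⟩
      rw [← eval_invariant hh g c]
      congr 4
      funext a
      obtain ⟨i, j⟩ := a
      fin_cases j
      · simp [g, bracket]
        field_simp
        ring
      · simp [g, bracket]
        ring
  clear hF
  induction n generalizing F with
  | zero => exact ⟨F, by simpa using key⟩
  | succ n ih =>
    rw [pow_succ', mul_assoc] at key
    obtain ⟨F', hF'⟩ := exists_aeval_plucker_eq_of_mul key
    exact ih F' hF'

end FundamentalTheorems

/-! ### Minimal homogeneous generators are linear in the brackets -/

section Generators

variable {K : Type u} [Field K]

/-- Monomials in homogeneous generators are homogeneous, so taking the component of degree `n` of a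
polynomial expression discards all others. -/
theorem mem_span_monomials_of_isHomogeneous {ι τ : Type*} {g : ι → MvPolynomial τ K} {w : ι → ℕ}
    (hg : ∀ i, (g i).IsHomogeneous (w i)) {x : MvPolynomial τ K} {n : ℕ}
    (hx : x ∈ Algebra.adjoin K (Set.range g)) (hn : x.IsHomogeneous n) :
    x ∈ Submodule.span K
      ((fun s : ι →₀ ℕ => s.prod fun i k => g i ^ k) '' {s | Finsupp.weight w s = n}) := by
  classical
  rw [Algebra.adjoin_range_eq_range_aeval] at hx
  obtain ⟨P, hP : aeval g P = x⟩ := hx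
  have hhom : ∀ s : ι →₀ ℕ, (s.prod fun i k => g i ^ k).IsHomogeneous (Finsupp.weight w s) := by
    intro s
    rw [Finsupp.weight_apply]
    refine IsHomogeneous.prod _ _ _ fun i _ => ?_
    change (g i ^ s i).IsHomogeneous (s i • w i)
    rw [smul_eq_mul, mul_comm]
    exact (hg i).pow _
  rw [← homogeneousComponent_eq_self hn, ← hP, P.as_sum, map_sum, map_sum]
  refine Submodule.sum_mem _ fun s _ => ?_
  rw [aeval_monomial, algebraMap_eq, homogeneousComponent_C_mul, ← smul_eq_C_mul,
    homogeneousComponent_of_mem (hhom s)]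
  refine Submodule.smul_mem _ _ ?_
  split_ifs with h
  · exact Submodule.subset_span ⟨s, h.symm, rfl⟩
  · exact zero_mem _

theorem weight_eq_two {ι : Type*} {w : ι → ℕ} (hw : ∀ i, 2 ≤ w i) {s : ι →₀ ℕ}
    (h : Finsupp.weight w s = 2) : ∃ i, w i = 2 ∧ s = Finsupp.single i 1 := by
  classical
  obtain ⟨i, hi⟩ : ∃ i, s i ≠ 0 := by
    by_contra! h0
    have : s = 0 := Finsupp.ext h0
    simp [this] at h
  have hs : Finsupp.single i 1 + (s - Finsupp.single i 1) = s := by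
    apply add_tsub_cancel_of_le
    rw [Finsupp.single_le_iff]
    omega
  generalize s - Finsupp.single i 1 = t at hs
  rw [← hs, map_add, Finsupp.weight_single, one_smul] at h
  have ht : t = 0 := by
    by_contra h0
    obtain ⟨j, hj⟩ := Finsupp.ne_iff.1 h0
    have := Finsupp.le_weight_of_ne_zero' w hj
    have := hw i
    have := hw j
    omega
  refine ⟨i, ?_, by rw [← hs, ht, add_zero]⟩
  simpa [ht] using h

theorem mem_span_of_isHomogeneous_two {ι τ : Type*} {g : ι → MvPolynomial τ K} {w : ι → ℕ}
    (hg : ∀ i, (g i).IsHomogeneous (w i)) (hw : ∀ i, 2 ≤ w i) {x : MvPolynomial τ K}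
    (hx : x ∈ Algebra.adjoin K (Set.range g)) (h2 : x.IsHomogeneous 2) :
    x ∈ Submodule.span K (g '' {i | w i = 2}) := by
  refine Submodule.span_mono ?_ (mem_span_monomials_of_isHomogeneous hg hx h2)
  rintro _ ⟨s, hs, rfl⟩
  obtain ⟨i, hi, rfl⟩ := weight_eq_two hw hs
  exact ⟨i, hi, by simp⟩

theorem plucker_isHomogeneous (k : Fin 15) : (plucker K k).IsHomogeneous 2 := by
  have h : ∀ i j, (bracket K i j).IsHomogeneous 2 := fun i j =>
    ((isHomogeneous_X K _).mul (isHomogeneous_X K _)).sub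
      ((isHomogeneous_X K _).mul (isHomogeneous_X K _))
  fin_cases k <;> exact h _ _

theorem linearIndependent_plucker : LinearIndependent K (plucker K) := by
  rw [Fintype.linearIndependent_iff]
  intro a ha
  -- Form `i` is placed at `(1, 0)`, form `j` at `(0, 1)` and the others at zero; for `i < j` only
  -- their own bracket survives.
  have key : ∀ i j : Fin 6, eval (fun p : Fin 6 × Fin 2 => if p = (i, 0) ∨ p = (j, 1) then 1 else 0)
      (∑ k, a k • plucker K k) = 0 := fun i j => by rw [ha, map_zero]
  simp only [Fin.sum_univ_succ, plucker, bracket] at key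
  intro k
  fin_cases k
  · simpa using key 0 1
  · simpa using key 0 2
  · simpa using key 0 3
  · simpa using key 0 4
  · simpa using key 0 5
  · simpa using key 1 2
  · simpa using key 1 3
  · simpa using key 1 4
  · simpa using key 1 5
  · simpa using key 2 3
  · simpa using key 2 4
  · simpa using key 2 5
  · simpa using key 3 4
  · simpa using key 3 5
  · simpa using key 4 5

theorem mem_adjoin_plucker [CharZero K] {h : MvPolynomial (Fin 6 × Fin 2) K}
    (hh : h ∈ linearFormsInvariants K 6) : h ∈ Algebra.adjoin K (Set.range (plucker K)) := by
  obtain ⟨F, rfl⟩ := exists_aeval_plucker_eq hh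
  rw [Algebra.adjoin_range_eq_range_aeval]
  exact ⟨F, rfl⟩

theorem adjoin_image_eq_top_iff [CharZero K] {ι : Type*} (f : ι → linearFormsInvariants K 6)
    (S : Set ι) : Algebra.adjoin K (f '' S) = ⊤ ↔ ∀ k, plucker K k ∈
      Algebra.adjoin K ((fun i => (f i : MvPolynomial (Fin 6 × Fin 2) K)) '' S) := by
  have hmap : (Algebra.adjoin K (f '' S)).map (linearFormsInvariants K 6).val =
      Algebra.adjoin K ((fun i => (f i : MvPolynomial (Fin 6 × Fin 2) K)) '' S) := by
    rw [AlgHom.map_adjoin, Set.image_image]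
    rfl
  rw [← hmap]
  constructor
  · intro h k
    rw [h]
    exact ⟨⟨plucker K k, plucker_mem_invariants k⟩, trivial, rfl⟩
  · intro h
    rw [eq_top_iff]
    rintro x -
    have hle : Algebra.adjoin K (Set.range (plucker K)) ≤
        (Algebra.adjoin K (f '' S)).map (linearFormsInvariants K 6).val :=
      Algebra.adjoin_le (by rintro _ ⟨k, rfl⟩; exact h k)
    obtain ⟨y, hy, hyx⟩ := hle (mem_adjoin_plucker x.2)
    have : y = x := Subtype.ext hyx
    exact this ▸ hy

theorem exists_minimalGenerators [CharZero K] :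
    IsMinimalHomogeneousGenerators (linearFormsInvariants K 6) (fun _ : Fin 15 => 2)
      (fun k => ⟨plucker K k, plucker_mem_invariants k⟩) where
  homogeneous := plucker_isHomogeneous
  generates := by
    rw [← Set.image_univ, adjoin_image_eq_top_iff]
    exact fun k => Algebra.subset_adjoin ⟨k, trivial, rfl⟩
  minimal := by
    intro S hS
    rw [adjoin_image_eq_top_iff] at hS
    rw [Set.eq_univ_iff_forall]
    intro k
    have hk := hS k
    rw [Set.image_eq_range] at hk
    have := mem_span_of_isHomogeneous_two (w := fun _ => 2)
      (fun i : S => plucker_isHomogeneous (K := K) i) (fun _ => le_rfl) hk (plucker_isHomogeneous k)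
    by_contra hkS
    refine linearIndependent_plucker.notMem_span_image hkS (Submodule.span_mono ?_ this)
    rintro _ ⟨i, -, rfl⟩
    exact ⟨i, i.2, rfl⟩

section Minimal

variable [CharZero K] {m : ℕ} {w : Fin m → ℕ} {f : Fin m → linearFormsInvariants K 6}

theorem notMem_adjoin_of_minimal
    (hf : IsMinimalHomogeneousGenerators (linearFormsInvariants K 6) w f) (i : Fin m) :
    (f i : MvPolynomial (Fin 6 × Fin 2) K) ∉
      Algebra.adjoin K ((fun i => (f i : MvPolynomial (Fin 6 × Fin 2) K)) '' {i}ᶜ) := by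
  intro hi
  have h := hf.generates
  rw [← Set.image_univ, adjoin_image_eq_top_iff] at h
  have hle : Algebra.adjoin K ((fun i => (f i : MvPolynomial (Fin 6 × Fin 2) K)) '' Set.univ) ≤
      Algebra.adjoin K ((fun i => (f i : MvPolynomial (Fin 6 × Fin 2) K)) '' {i}ᶜ) := by
    refine Algebra.adjoin_le ?_
    rintro _ ⟨j, -, rfl⟩
    by_cases hj : j = i
    · rw [hj]; exact hi
    · exact Algebra.subset_adjoin ⟨j, hj, rfl⟩
  have := hf.minimal {i}ᶜ ((adjoin_image_eq_top_iff f _).2 fun k => hle (h k))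
  exact (this ▸ Set.mem_univ i : i ∈ ({i}ᶜ : Set (Fin m))) rfl

/-- The invariants are spanned by monomials in the quadratic brackets, so those of degree below 2
are scalars, and a scalar generator is redundant. -/
theorem two_le_weight_of_minimal
    (hf : IsMinimalHomogeneousGenerators (linearFormsInvariants K 6) w f) (i : Fin m) :
    2 ≤ w i := by
  have hh := hf.homogeneous i
  have hmem := mem_span_monomials_of_isHomogeneous (w := fun _ => 2)
    (plucker_isHomogeneous (K := K)) (mem_adjoin_plucker (f i).2) hh
  by_contra! hw
  apply notMem_adjoin_of_minimal hf i
  suffices h : (f i : MvPolynomial (Fin 6 × Fin 2) K) ∈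
      (Algebra.adjoin K (∅ : Set (MvPolynomial (Fin 6 × Fin 2) K))) from
    Algebra.adjoin_mono (Set.empty_subset _) h
  refine (Submodule.span_le (p := Subalgebra.toSubmodule (Algebra.adjoin K ∅))).2 ?_ hmem
  rintro _ ⟨s, hs, rfl⟩
  have hs0 : s = 0 := by
    ext k
    by_contra hk
    have := Finsupp.le_weight_of_ne_zero' (fun _ : Fin 15 => 2) hk
    have hs' : Finsupp.weight (fun _ : Fin 15 => 2) s = w i := hs
    omega
  rw [hs0]
  exact one_mem (Algebra.adjoin K (∅ : Set (MvPolynomial (Fin 6 × Fin 2) K)))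

/-- With no generator of degree below 2, each bracket is a linear combination of the generators of
degree 2; these already generate, so minimality leaves no others. -/
theorem weight_eq_two_of_minimal
    (hf : IsMinimalHomogeneousGenerators (linearFormsInvariants K 6) w f) (i : Fin m) :
    w i = 2 := by
  have h := hf.generates
  rw [← Set.image_univ, adjoin_image_eq_top_iff, Set.image_univ] at h
  have h2 : ∀ k, plucker K k ∈ Algebra.adjoin K
      ((fun i => (f i : MvPolynomial (Fin 6 × Fin 2) K)) '' {i | w i = 2}) := fun k =>
    Algebra.span_le_adjoin K _ (mem_span_of_isHomogeneous_two hf.homogeneous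
      (two_le_weight_of_minimal hf) (h k) (plucker_isHomogeneous k))
  have := hf.minimal _ ((adjoin_image_eq_top_iff f _).2 h2)
  exact (this ▸ Set.mem_univ i : i ∈ {i | w i = 2})

theorem linearIndependent_of_minimal
    (hf : IsMinimalHomogeneousGenerators (linearFormsInvariants K 6) w f) :
    LinearIndependent K (fun i => (f i : MvPolynomial (Fin 6 × Fin 2) K)) := by
  rw [linearIndependent_iff_notMem_span]
  intro i hi
  apply notMem_adjoin_of_minimal hf i
  rw [Set.compl_eq_univ_sdiff]
  exact Algebra.span_le_adjoin K _ hi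

/-- Minimal generators of the invariants are obtained from the determinants by an invertible linear
substitution. -/
theorem exists_linear_coordinates
    (hf : IsMinimalHomogeneousGenerators (linearFormsInvariants K 6) w f) :
    ∃ Θ : MvPolynomial (Fin m) K ≃ₐ[K] MvPolynomial (Fin 15) K,
      (∀ r, ((aeval f r : linearFormsInvariants K 6) : MvPolynomial (Fin 6 × Fin 2) K) =
        aeval (plucker K) (Θ r)) ∧ ∀ k, (Θ.symm (X k)).IsHomogeneous 1 := by
  have h2 : ∀ k, plucker K k ∈ Submodule.span K
      (Set.range fun i => (f i : MvPolynomial (Fin 6 × Fin 2) K)) := fun k => by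
    have h := hf.generates
    rw [← Set.image_univ, adjoin_image_eq_top_iff, Set.image_univ] at h
    exact Submodule.span_mono (Set.image_subset_range _ _)
      (mem_span_of_isHomogeneous_two hf.homogeneous
        (two_le_weight_of_minimal hf) (h k) (plucker_isHomogeneous k))
  have h3 : ∀ i, (f i : MvPolynomial (Fin 6 × Fin 2) K) ∈ Submodule.span K
      (Set.range (plucker K)) := fun i =>
    Submodule.span_mono (Set.image_subset_range _ _)
      (mem_span_of_isHomogeneous_two (w := fun _ => 2) (plucker_isHomogeneous (K := K))
        (fun _ => le_rfl) (mem_adjoin_plucker (f i).2)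
        (by simpa only [weight_eq_two_of_minimal hf i] using hf.homogeneous i))
  simp only [Submodule.mem_span_range_iff_exists_fun] at h2 h3
  choose d hd using h2
  choose c hc using h3
  -- Both families are bases of the same space, so the transition matrices are mutually inverse.
  have hcd : ∀ i j, ∑ k, c i k * d k j = if j = i then 1 else 0 := by
    intro i
    have hi : ∑ j, ((∑ k, c i k * d k j) - if j = i then 1 else 0) •
        (f j : MvPolynomial (Fin 6 × Fin 2) K) = 0 := by
      simp only [sub_smul, Finset.sum_sub_distrib, ite_smul, one_smul, zero_smul,
        Finset.sum_ite_eq', Finset.mem_univ, if_true, sub_eq_zero, Finset.sum_smul, mul_smul]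
      rw [Finset.sum_comm]
      simp only [← Finset.smul_sum, hd, hc]
    intro j
    exact sub_eq_zero.1 (Fintype.linearIndependent_iff.1 (linearIndependent_of_minimal hf) _ hi j)
  have hdc : ∀ k l, ∑ i, d k i * c i l = if l = k then 1 else 0 := by
    intro k
    have hk : ∑ l, ((∑ i, d k i * c i l) - if l = k then 1 else 0) • plucker K l = 0 := by
      simp only [sub_smul, Finset.sum_sub_distrib, ite_smul, one_smul, zero_smul,
        Finset.sum_ite_eq', Finset.mem_univ, if_true, sub_eq_zero, Finset.sum_smul, mul_smul]
      rw [Finset.sum_comm]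
      simp only [← Finset.smul_sum, hd, hc]
    intro l
    exact sub_eq_zero.1 (Fintype.linearIndependent_iff.1 linearIndependent_plucker _ hk l)
  let φ : MvPolynomial (Fin m) K →ₐ[K] MvPolynomial (Fin 15) K :=
    aeval fun i => ∑ k, c i k • X k
  let ψ : MvPolynomial (Fin 15) K →ₐ[K] MvPolynomial (Fin m) K :=
    aeval fun k => ∑ i, d k i • X i
  refine ⟨AlgEquiv.ofAlgHom φ ψ ?_ ?_, ?_, ?_⟩
  · refine MvPolynomial.algHom_ext fun k => ?_
    simp only [φ, ψ, AlgHom.comp_apply, aeval_X, map_sum, map_smul, Finset.smul_sum, smul_smul]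
    rw [Finset.sum_comm]
    simp [← Finset.sum_smul, hdc]
  · refine MvPolynomial.algHom_ext fun i => ?_
    simp only [φ, ψ, AlgHom.comp_apply, aeval_X, map_sum, map_smul, Finset.smul_sum, smul_smul]
    rw [Finset.sum_comm]
    simp [← Finset.sum_smul, hcd]
  · intro r
    have : (linearFormsInvariants K 6).val.comp (aeval f) = (aeval (plucker K)).comp φ := by
      refine MvPolynomial.algHom_ext fun i => ?_
      simp only [φ, AlgHom.comp_apply, aeval_X, map_sum, map_smul, Subalgebra.coe_val, ← hc]
    exact DFunLike.congr_fun this r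
  · intro k
    change (aeval (fun k => ∑ i, d k i • X i) (X k : MvPolynomial (Fin 15) K)).IsHomogeneous 1
    rw [aeval_X]
    refine IsHomogeneous.sum _ _ _ fun i _ => ?_
    rw [smul_eq_C_mul]
    exact isHomogeneous_C_mul_X _ _

end Minimal

end Generators

/-! ### The Pfaffian complex in coordinates -/

section Complex

/-- The positions of a `6 × 6` matrix other than the last one. -/
abbrev NonCorner : Type := {p : Fin 6 × Fin 6 // p ≠ (5, 5)}

/-- The index sets of bases of the terms of the Pfaffian complex. -/
def PfTerm : ℕ → Type
  | 0 => Unit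
  | 1 => Fin 15
  | 2 => NonCorner
  | 3 => Sym2 (Fin 6) ⊕ Sym2 (Fin 6)
  | 4 => NonCorner
  | 5 => Fin 15
  | 6 => Unit
  | _ => Empty

variable {S : Type*} [CommRing S]

/-- The skew-symmetric matrix with given entries above the diagonal, as a linear map. -/
def skewOfₗ : (Fin 15 → S) →ₗ[S] Matrix (Fin 6) (Fin 6) S where
  toFun := skewOf
  map_add' x y := by ext i j; fin_cases i <;> fin_cases j <;> simp [skewOf] <;> ring
  map_smul' r x := by ext i j; fin_cases i <;> fin_cases j <;> simp [skewOf]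

/-- The entries of a matrix above the diagonal. -/
def skewReadₗ : Matrix (Fin 6) (Fin 6) S →ₗ[S] (Fin 15 → S) where
  toFun Z := ![Z 0 1, Z 0 2, Z 0 3, Z 0 4, Z 0 5, Z 1 2, Z 1 3, Z 1 4, Z 1 5, Z 2 3, Z 2 4, Z 2 5,
    Z 3 4, Z 3 5, Z 4 5]
  map_add' Z W := by funext k; fin_cases k <;> rfl
  map_smul' r Z := by funext k; fin_cases k <;> rfl

/-- The traceless matrix with given entries at the positions other than the last one. -/
def tracelessOfₗ : (NonCorner → S) →ₗ[S] Matrix (Fin 6) (Fin 6) S where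
  toFun a := Matrix.of fun i j => if h : (i, j) = (5, 5) then
    -∑ k : Fin 5, a ⟨(k.castSucc, k.castSucc), fun hk => (Fin.castSucc_lt_last k).ne
      (congrArg Prod.fst hk)⟩ else a ⟨(i, j), h⟩
  map_add' a b := by
    ext i j
    simp only [Matrix.of_apply, Matrix.add_apply]
    split_ifs
    · simp only [Pi.add_apply, Finset.sum_add_distrib, neg_add]
    · rfl
  map_smul' r a := by
    ext i j
    simp only [Matrix.of_apply, Matrix.smul_apply]
    split_ifs
    · simp only [Pi.smul_apply, smul_eq_mul, Finset.mul_sum, RingHom.id_apply, mul_neg]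
    · rfl

/-- The matrix with given entries at the positions other than the last one, and zero there. -/
def cornerlessOfₗ : (NonCorner → S) →ₗ[S] Matrix (Fin 6) (Fin 6) S where
  toFun a := Matrix.of fun i j => if h : (i, j) = (5, 5) then 0 else a ⟨(i, j), h⟩
  map_add' a b := by
    ext i j
    simp only [Matrix.of_apply, Matrix.add_apply]
    split_ifs
    · rw [add_zero]
    · rfl
  map_smul' r a := by
    ext i j
    simp only [Matrix.of_apply, Matrix.smul_apply]
    split_ifs
    · rw [smul_zero]
    · rfl

/-- The entries of a matrix at the positions other than the last one. -/
def cornerlessReadₗ : Matrix (Fin 6) (Fin 6) S →ₗ[S] (NonCorner → S) where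
  toFun Z p := Z p.1.1 p.1.2
  map_add' _ _ := rfl
  map_smul' _ _ := rfl

/-- The symmetric matrix with given entries. -/
def symmOfₗ : (Sym2 (Fin 6) → S) →ₗ[S] Matrix (Fin 6) (Fin 6) S where
  toFun a := Matrix.of fun i j => a s(i, j)
  map_add' _ _ := rfl
  map_smul' _ _ := rfl

/-- The entries of a symmetric matrix. -/
noncomputable def symmReadₗ : Matrix (Fin 6) (Fin 6) S →ₗ[S] (Sym2 (Fin 6) → S) where
  toFun Z p := Z p.out.1 p.out.2
  map_add' _ _ := rfl
  map_smul' _ _ := rfl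

/-- Normalization of a matrix modulo the scalar matrices. -/
def modScalarsₗ : Matrix (Fin 6) (Fin 6) S →ₗ[S] Matrix (Fin 6) (Fin 6) S where
  toFun Z := Z - Z 5 5 • 1
  map_add' Z W := by rw [Matrix.add_apply, add_smul, add_sub_add_comm]
  map_smul' r Z := by rw [Matrix.smul_apply, smul_eq_mul, mul_smul, RingHom.id_apply, smul_sub]

theorem skewReadₗ_skewOfₗ (x : Fin 15 → S) : skewReadₗ (skewOfₗ x) = x := by
  funext k; fin_cases k <;> rfl

theorem skewOfₗ_transpose (x : Fin 15 → S) : (skewOfₗ x)ᵀ = -skewOfₗ x := skewOf_transpose x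

theorem skewOfₗ_skewReadₗ (h2 : IsUnit (2 : S)) {Z : Matrix (Fin 6) (Fin 6) S} (hZ : Zᵀ = -Z) :
    skewOfₗ (skewReadₗ Z) = Z := by
  obtain ⟨x, rfl⟩ := exists_eq_skewOf h2 hZ
  exact congrArg skewOf (skewReadₗ_skewOfₗ x)

theorem cornerlessReadₗ_tracelessOfₗ (a : NonCorner → S) :
    cornerlessReadₗ (tracelessOfₗ a) = a := by
  funext p
  exact dif_neg p.2

theorem trace_tracelessOfₗ (a : NonCorner → S) : trace (tracelessOfₗ a) = 0 := by
  have h5 : (tracelessOfₗ a : Matrix (Fin 6) (Fin 6) S) (Fin.last 5) (Fin.last 5) =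
      -∑ k : Fin 5, a ⟨(k.castSucc, k.castSucc),
        fun hk => (Fin.castSucc_lt_last k).ne (congrArg Prod.fst hk)⟩ := rfl
  have hk : ∀ k : Fin 5, (tracelessOfₗ a : Matrix (Fin 6) (Fin 6) S) k.castSucc k.castSucc =
      a ⟨(k.castSucc, k.castSucc),
        fun hk => (Fin.castSucc_lt_last k).ne (congrArg Prod.fst hk)⟩ := fun k =>
    congrFun (cornerlessReadₗ_tracelessOfₗ a) ⟨(k.castSucc, k.castSucc), _⟩
  rw [trace, Fin.sum_univ_castSucc]
  simp only [diag_apply, hk, h5]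
  exact add_neg_cancel _

theorem eq_of_cornerlessReadₗ_eq {Z W : Matrix (Fin 6) (Fin 6) S}
    (h : cornerlessReadₗ Z = cornerlessReadₗ W) (h5 : Z 5 5 = W 5 5) : Z = W := by
  ext i j
  by_cases hij : (i, j) = (5, 5)
  · rw [Prod.mk.injEq] at hij
    rw [hij.1, hij.2, h5]
  · exact congrFun h ⟨(i, j), hij⟩

theorem eq_of_cornerlessReadₗ_eq_of_trace_eq {Z W : Matrix (Fin 6) (Fin 6) S}
    (h : cornerlessReadₗ Z = cornerlessReadₗ W) (ht : trace Z = trace W) : Z = W := by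
  refine eq_of_cornerlessReadₗ_eq h ?_
  rw [trace, trace, Fin.sum_univ_castSucc (fun i => diag Z i),
    Fin.sum_univ_castSucc (fun i => diag W i)] at ht
  have hk : ∀ k : Fin 5, Z k.castSucc k.castSucc = W k.castSucc k.castSucc := fun k =>
    congrFun h ⟨(k.castSucc, k.castSucc),
      fun hk => (Fin.castSucc_lt_last k).ne (congrArg Prod.fst hk)⟩
  simp only [diag_apply, hk, add_right_inj] at ht
  exact ht

theorem tracelessOfₗ_cornerlessReadₗ {Z : Matrix (Fin 6) (Fin 6) S} (hZ : trace Z = 0) :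
    tracelessOfₗ (cornerlessReadₗ Z) = Z :=
  eq_of_cornerlessReadₗ_eq_of_trace_eq (cornerlessReadₗ_tracelessOfₗ _)
    (by rw [trace_tracelessOfₗ, hZ])

theorem cornerlessReadₗ_cornerlessOfₗ (a : NonCorner → S) :
    cornerlessReadₗ (cornerlessOfₗ a) = a := by
  funext p
  exact dif_neg p.2

theorem modScalarsₗ_cornerlessOfₗ (a : NonCorner → S) :
    modScalarsₗ (cornerlessOfₗ a) = cornerlessOfₗ a := by
  have h5 : (cornerlessOfₗ a : Matrix (Fin 6) (Fin 6) S) 5 5 = 0 := rfl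
  change cornerlessOfₗ a - (cornerlessOfₗ a : Matrix (Fin 6) (Fin 6) S) 5 5 • 1 = _
  rw [h5, zero_smul, sub_zero]

/-- Classes modulo scalars are represented by matrices with zero last diagonal entry; the same 35
positions coordinatize traceless matrices, where that entry is determined by the trace. -/
theorem cornerlessOfₗ_cornerlessReadₗ_modScalarsₗ (Z : Matrix (Fin 6) (Fin 6) S) :
    cornerlessOfₗ (cornerlessReadₗ (modScalarsₗ Z)) = Z - Z 5 5 • 1 := by
  refine eq_of_cornerlessReadₗ_eq (cornerlessReadₗ_cornerlessOfₗ _) ?_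
  have h5 : (cornerlessOfₗ (cornerlessReadₗ (modScalarsₗ Z)) : Matrix (Fin 6) (Fin 6) S) 5 5 = 0 :=
    rfl
  rw [h5]
  simp

theorem symmOfₗ_transpose (a : Sym2 (Fin 6) → S) : (symmOfₗ a)ᵀ = symmOfₗ a := by
  ext i j
  exact congrArg a Sym2.eq_swap

theorem symmReadₗ_symmOfₗ (a : Sym2 (Fin 6) → S) : symmReadₗ (symmOfₗ a) = a := by
  funext p
  exact congrArg a (Quot.out_eq p)

theorem symmOfₗ_symmReadₗ {Z : Matrix (Fin 6) (Fin 6) S} (hZ : Zᵀ = Z) :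
    symmOfₗ (symmReadₗ Z) = Z := by
  ext i j
  change Z s(i, j).out.1 s(i, j).out.2 = Z i j
  have h : s(s(i, j).out.1, s(i, j).out.2) = s(i, j) := Quot.out_eq s(i, j)
  -- The chosen representative of an unordered pair may come in either order; symmetry of `Z` makes
  -- this immaterial.
  rcases Sym2.eq_iff.1 h with ⟨h1, h2⟩ | ⟨h1, h2⟩
  · rw [h1, h2]
  · rw [h1, h2]
    exact congrFun (congrFun hZ i) j

/-- The differentials of the Pfaffian complex of the matrix `X`. -/
noncomputable def pfDiff (X : Matrix (Fin 6) (Fin 6) S) :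
    ∀ i, (PfTerm (i + 1) → S) →ₗ[S] (PfTerm i → S)
  | 0 => LinearMap.pi fun _ => traceLinearMap (Fin 6) S S ∘ₗ LinearMap.mulRight S (pfAdj X) ∘ₗ skewOfₗ
  | 1 => skewReadₗ ∘ₗ (LinearMap.mulRight S X + LinearMap.mulLeft S X ∘ₗ
      (transposeLinearEquiv (Fin 6) (Fin 6) S S).toLinearMap) ∘ₗ tracelessOfₗ
  | 2 => cornerlessReadₗ ∘ₗ
      (LinearMap.mulLeft S X ∘ₗ symmOfₗ ∘ₗ LinearMap.funLeft S S Sum.inl +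
        LinearMap.mulRight S (pfAdj X) ∘ₗ symmOfₗ ∘ₗ LinearMap.funLeft S S Sum.inr)
  | 3 => (LinearEquiv.sumArrowLequivProdArrow _ _ S S).symm.toLinearMap ∘ₗ LinearMap.prod
      (symmReadₗ ∘ₗ (LinearMap.mulLeft S (pfAdj X) ∘ₗ
        (transposeLinearEquiv (Fin 6) (Fin 6) S S).toLinearMap - LinearMap.mulRight S (pfAdj X)) ∘ₗ
          cornerlessOfₗ)
      (symmReadₗ ∘ₗ (LinearMap.mulLeft S X - LinearMap.mulRight S X ∘ₗ
        (transposeLinearEquiv (Fin 6) (Fin 6) S S).toLinearMap) ∘ₗ cornerlessOfₗ)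
  | 4 => cornerlessReadₗ ∘ₗ modScalarsₗ ∘ₗ LinearMap.mulRight S X ∘ₗ skewOfₗ
  | 5 => LinearMap.toSpanSingleton S _ (skewReadₗ (pfAdj X)) ∘ₗ LinearMap.proj ()
  | _ + 6 => 0

variable (X : Matrix (Fin 6) (Fin 6) S)

theorem pfDiff_zero (c : Fin 15 → S) : pfDiff X 0 c = fun _ => trace (skewOfₗ c * pfAdj X) := rfl

theorem pfDiff_one (a : NonCorner → S) : pfDiff X 1 a =
    skewReadₗ (tracelessOfₗ a * X + X * (tracelessOfₗ a)ᵀ) := rfl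

theorem pfDiff_two (v : Sym2 (Fin 6) ⊕ Sym2 (Fin 6) → S) : pfDiff X 2 v =
    cornerlessReadₗ (X * symmOfₗ (v ∘ Sum.inl) + symmOfₗ (v ∘ Sum.inr) * pfAdj X) := rfl

theorem pfDiff_three (b : NonCorner → S) : pfDiff X 3 b = Sum.elim
    (symmReadₗ (pfAdj X * (cornerlessOfₗ b)ᵀ - cornerlessOfₗ b * pfAdj X))
    (symmReadₗ (X * cornerlessOfₗ b - (cornerlessOfₗ b)ᵀ * X)) := rfl

theorem pfDiff_four (c : Fin 15 → S) : pfDiff X 4 c =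
    cornerlessReadₗ (modScalarsₗ (skewOfₗ c * X)) := rfl

theorem pfDiff_five (r : Unit → S) : pfDiff X 5 r = r () • skewReadₗ (pfAdj X) := rfl

variable {X}

theorem mul_add_mul_transpose_boundary (h2 : IsUnit (2 : S)) (hX : Xᵀ = -X)
    {P T : Matrix (Fin 6) (Fin 6) S} (hP : Pᵀ = P) (hT : Tᵀ = T) :
    (X * P + T * pfAdj X) * X + X * (X * P + T * pfAdj X)ᵀ = 0 := by
  rw [transpose_add, transpose_mul, transpose_mul, hP, hT, hX, pfAdj_transpose X, add_mul, mul_add,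
    Matrix.mul_assoc T, pfAdj_mul h2 hX, Matrix.neg_mul, Matrix.mul_neg, Matrix.mul_neg,
    Matrix.mul_neg, ← Matrix.mul_assoc X (pfAdj X), mul_pfAdj h2 hX, Matrix.mul_assoc X P X]
  simp only [Matrix.mul_smul, Matrix.smul_mul, Matrix.mul_one, Matrix.one_mul]
  abel

theorem trace_boundary (h2 : IsUnit (2 : S)) (hX : Xᵀ = -X)
    {P T : Matrix (Fin 6) (Fin 6) S} (hP : Pᵀ = P) (hT : Tᵀ = T) :
    trace (X * P + T * pfAdj X) = 0 := by
  rw [trace_add, trace_mul_eq_zero_of_skew_symm h2 hX hP, trace_mul_comm,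
    trace_mul_eq_zero_of_skew_symm h2 (pfAdj_transpose X) hT, add_zero]

theorem mul_boundary_add_boundary_mul (h2 : IsUnit (2 : S)) (hX : Xᵀ = -X)
    (B : Matrix (Fin 6) (Fin 6) S) :
    X * (pfAdj X * Bᵀ - B * pfAdj X) + (X * B - Bᵀ * X) * pfAdj X = 0 := by
  rw [mul_sub, sub_mul, ← Matrix.mul_assoc, mul_pfAdj h2 hX, Matrix.mul_assoc Bᵀ, mul_pfAdj h2 hX,
    Matrix.mul_assoc X B]
  simp only [Matrix.mul_smul, Matrix.smul_mul, Matrix.mul_one, Matrix.one_mul]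
  abel

theorem pfAdj_mul_transpose_sub_eq_zero (h2 : IsUnit (2 : S)) (hX : Xᵀ = -X)
    {C : Matrix (Fin 6) (Fin 6) S} (hC : Cᵀ = -C) (r : S) :
    pfAdj X * (C * X - r • 1)ᵀ - (C * X - r • 1) * pfAdj X = 0 := by
  rw [transpose_sub, transpose_mul, hC, hX, neg_mul_neg, transpose_smul, transpose_one, mul_sub,
    sub_mul, ← Matrix.mul_assoc, pfAdj_mul h2 hX, Matrix.mul_assoc C, mul_pfAdj h2 hX]
  simp only [Matrix.mul_smul, Matrix.smul_mul, Matrix.mul_one, Matrix.one_mul, sub_self]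

theorem mul_sub_transpose_mul_eq_zero (hX : Xᵀ = -X)
    {C : Matrix (Fin 6) (Fin 6) S} (hC : Cᵀ = -C) (r : S) :
    X * (C * X - r • 1) - (C * X - r • 1)ᵀ * X = 0 := by
  rw [transpose_sub, transpose_mul, hC, hX, neg_mul_neg, transpose_smul, transpose_one, mul_sub,
    sub_mul, ← Matrix.mul_assoc]
  simp only [Matrix.mul_smul, Matrix.smul_mul, Matrix.mul_one, Matrix.one_mul, sub_self]

theorem symmReadₗ_eq_zero {Z : Matrix (Fin 6) (Fin 6) S} (hZ : Zᵀ = Z) (h : symmReadₗ Z = 0) :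
    Z = 0 := by
  rw [← symmOfₗ_symmReadₗ hZ, h, map_zero]

theorem transpose_pfAdj_mul_sub (B : Matrix (Fin 6) (Fin 6) S) :
    (pfAdj X * Bᵀ - B * pfAdj X)ᵀ = pfAdj X * Bᵀ - B * pfAdj X := by
  rw [transpose_sub, transpose_mul, transpose_mul, transpose_transpose, pfAdj_transpose X,
    Matrix.mul_neg, Matrix.neg_mul]
  abel

theorem transpose_mul_sub (hX : Xᵀ = -X) (B : Matrix (Fin 6) (Fin 6) S) :
    (X * B - Bᵀ * X)ᵀ = X * B - Bᵀ * X := by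
  rw [transpose_sub, transpose_mul, transpose_mul, transpose_transpose, hX,
    Matrix.mul_neg, Matrix.neg_mul]
  abel

theorem transpose_mul_add (hX : Xᵀ = -X) (A : Matrix (Fin 6) (Fin 6) S) :
    (A * X + X * Aᵀ)ᵀ = -(A * X + X * Aᵀ) := by
  rw [transpose_add, transpose_mul, transpose_mul, transpose_transpose, hX,
    Matrix.mul_neg, Matrix.neg_mul]
  abel

theorem exact_pfDiff_zero (h2 : IsUnit (2 : S)) (hX : Xᵀ = -X) (hE : PfaffianExactAt X 1) :
    Function.Exact (pfDiff X 1) (pfDiff X 0) := by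
  intro (c : Fin 15 → S)
  constructor
  · intro h
    obtain ⟨A, hA, hc⟩ := hE _ (skewOfₗ_transpose c) (congrFun h ())
    refine ⟨cornerlessReadₗ A, ?_⟩
    rw [pfDiff_one, tracelessOfₗ_cornerlessReadₗ hA, ← hc, skewReadₗ_skewOfₗ]
  · rintro ⟨(a : NonCorner → S), rfl⟩
    rw [pfDiff_one, pfDiff_zero, skewOfₗ_skewReadₗ h2 (transpose_mul_add hX _),
      trace_boundary_mul_pfAdj h2 hX (trace_tracelessOfₗ a)]
    rfl

theorem exact_pfDiff_one (h2 : IsUnit (2 : S)) (hX : Xᵀ = -X) (hE : PfaffianExactAt X 2) :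
    Function.Exact (pfDiff X 2) (pfDiff X 1) := by
  intro (a : NonCorner → S)
  constructor
  · intro h
    rw [pfDiff_one] at h
    have h0 : tracelessOfₗ a * X + X * (tracelessOfₗ a)ᵀ = 0 := by
      rw [← skewOfₗ_skewReadₗ h2 (transpose_mul_add hX (tracelessOfₗ a)), h]
      exact map_zero skewOfₗ
    obtain ⟨P, T, hP, hT, ha⟩ := hE _ (trace_tracelessOfₗ a) h0
    refine ⟨Sum.elim (symmReadₗ P) (symmReadₗ T), ?_⟩
    rw [pfDiff_two, Sum.elim_comp_inl, Sum.elim_comp_inr, symmOfₗ_symmReadₗ hP,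
      symmOfₗ_symmReadₗ hT, ← ha, cornerlessReadₗ_tracelessOfₗ]
  · rintro ⟨(v : Sym2 (Fin 6) ⊕ Sym2 (Fin 6) → S), rfl⟩
    have hP := symmOfₗ_transpose (v ∘ Sum.inl)
    have hT := symmOfₗ_transpose (v ∘ Sum.inr)
    rw [pfDiff_two, pfDiff_one, tracelessOfₗ_cornerlessReadₗ (trace_boundary h2 hX hP hT),
      mul_add_mul_transpose_boundary h2 hX hP hT]
    exact map_zero skewReadₗ

theorem exact_pfDiff_two (h2 : IsUnit (2 : S)) (hX : Xᵀ = -X) (hE : PfaffianExactAt X 3) :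
    Function.Exact (pfDiff X 3) (pfDiff X 2) := by
  intro (v : Sym2 (Fin 6) ⊕ Sym2 (Fin 6) → S)
  have hP := symmOfₗ_transpose (v ∘ Sum.inl)
  have hT := symmOfₗ_transpose (v ∘ Sum.inr)
  constructor
  · intro h
    rw [pfDiff_two] at h
    have h0 : X * symmOfₗ (v ∘ Sum.inl) + symmOfₗ (v ∘ Sum.inr) * pfAdj X = 0 := by
      rw [← tracelessOfₗ_cornerlessReadₗ (trace_boundary h2 hX hP hT), h]
      exact map_zero tracelessOfₗ
    obtain ⟨B, hB1, hB2⟩ := hE _ _ hP hT h0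
    refine ⟨cornerlessReadₗ (modScalarsₗ B), ?_⟩
    have e1 : pfAdj X * (B - B 5 5 • 1)ᵀ - (B - B 5 5 • 1) * pfAdj X =
        pfAdj X * Bᵀ - B * pfAdj X := by
      rw [transpose_sub, transpose_smul, transpose_one, mul_sub, sub_mul]
      simp only [Matrix.mul_smul, Matrix.smul_mul, Matrix.mul_one, Matrix.one_mul]
      abel
    have e2 : X * (B - B 5 5 • 1) - (B - B 5 5 • 1)ᵀ * X = X * B - Bᵀ * X := by
      rw [transpose_sub, transpose_smul, transpose_one, mul_sub, sub_mul]
      simp only [Matrix.mul_smul, Matrix.smul_mul, Matrix.mul_one, Matrix.one_mul]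
      abel
    rw [pfDiff_three, cornerlessOfₗ_cornerlessReadₗ_modScalarsₗ, e1, e2, ← hB1, ← hB2,
      symmReadₗ_symmOfₗ, symmReadₗ_symmOfₗ]
    exact Sum.elim_comp_inl_inr v
  · rintro ⟨(b : NonCorner → S), rfl⟩
    rw [pfDiff_three, pfDiff_two, Sum.elim_comp_inl, Sum.elim_comp_inr,
      symmOfₗ_symmReadₗ (transpose_pfAdj_mul_sub _), symmOfₗ_symmReadₗ (transpose_mul_sub hX _),
      mul_boundary_add_boundary_mul h2 hX]
    exact map_zero cornerlessReadₗ

theorem exact_pfDiff_three (h2 : IsUnit (2 : S)) (hX : Xᵀ = -X) (hE : PfaffianExactAt X 4) :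
    Function.Exact (pfDiff X 4) (pfDiff X 3) := by
  intro (b : NonCorner → S)
  constructor
  · intro h
    rw [pfDiff_three] at h
    obtain ⟨C, hC, r, hb⟩ := hE _
      (symmReadₗ_eq_zero (transpose_pfAdj_mul_sub _) (funext fun p => congrFun h (Sum.inl p)))
      (symmReadₗ_eq_zero (transpose_mul_sub hX _) (funext fun p => congrFun h (Sum.inr p)))
    refine ⟨skewReadₗ C, ?_⟩
    have hm : modScalarsₗ (r • (1 : Matrix (Fin 6) (Fin 6) S)) = 0 := by
      change r • (1 : Matrix (Fin 6) (Fin 6) S) - (r • (1 : Matrix (Fin 6) (Fin 6) S)) 5 5 • 1 = 0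
      simp
    rw [pfDiff_four, skewOfₗ_skewReadₗ h2 hC, ← cornerlessReadₗ_cornerlessOfₗ b,
      ← modScalarsₗ_cornerlessOfₗ, hb, map_add, hm, add_zero]
  · rintro ⟨(c : Fin 15 → S), rfl⟩
    rw [pfDiff_four, pfDiff_three, cornerlessOfₗ_cornerlessReadₗ_modScalarsₗ,
      pfAdj_mul_transpose_sub_eq_zero h2 hX (skewOfₗ_transpose c),
      mul_sub_transpose_mul_eq_zero hX (skewOfₗ_transpose c), map_zero]
    exact Sum.elim_zero_zero

theorem exact_pfDiff_four (h2 : IsUnit (2 : S)) (hX : Xᵀ = -X) (hE : PfaffianExactAt X 5) :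
    Function.Exact (pfDiff X 5) (pfDiff X 4) := by
  intro (c : Fin 15 → S)
  constructor
  · intro h
    rw [pfDiff_four] at h
    have h0 := cornerlessOfₗ_cornerlessReadₗ_modScalarsₗ (skewOfₗ c * X)
    rw [h] at h0
    obtain ⟨s, hs⟩ := hE _ (skewOfₗ_transpose c) (-(skewOfₗ c * X) 5 5) (by
      rw [neg_smul, ← sub_eq_add_neg, ← h0]
      exact map_zero cornerlessOfₗ)
    refine ⟨fun _ : Unit => s, (pfDiff_five X _).trans ?_⟩
    rw [← map_smul, ← hs, skewReadₗ_skewOfₗ]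
  · rintro ⟨(r : Unit → S), rfl⟩
    rw [pfDiff_five, pfDiff_four, map_smul, skewOfₗ_skewReadₗ h2 (pfAdj_transpose X),
      Matrix.smul_mul, pfAdj_mul h2 hX]
    have hm : ∀ r : S, modScalarsₗ (r • (1 : Matrix (Fin 6) (Fin 6) S)) = 0 := fun r => by
      change r • (1 : Matrix (Fin 6) (Fin 6) S) - (r • (1 : Matrix (Fin 6) (Fin 6) S)) 5 5 • 1 = 0
      simp
    rw [smul_smul, hm]
    exact map_zero cornerlessReadₗ

theorem exact_pfDiff_five (h2 : IsUnit (2 : S)) (hE : PfaffianExactAt X 6) :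
    Function.Exact (pfDiff X 6) (pfDiff X 5) := by
  intro (r : Unit → S)
  constructor
  · intro h
    refine ⟨0, ?_⟩
    have h0 : r () = 0 := hE _ (by
      rw [← skewOfₗ_skewReadₗ h2 (pfAdj_transpose X), ← map_smul]
      exact (congrArg skewOfₗ h).trans (map_zero skewOfₗ))
    rw [map_zero]
    exact (funext fun _ => h0.symm)
  · rintro ⟨v, rfl⟩
    exact map_zero (pfDiff X 5)

theorem exact_pfDiff (h2 : IsUnit (2 : S)) (hX : Xᵀ = -X) (hE : ∀ i, 1 ≤ i → PfaffianExactAt X i) :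
    ∀ i, Function.Exact (pfDiff X (i + 1)) (pfDiff X i)
  | 0 => exact_pfDiff_zero h2 hX (hE 1 (by omega))
  | 1 => exact_pfDiff_one h2 hX (hE 2 (by omega))
  | 2 => exact_pfDiff_two h2 hX (hE 3 (by omega))
  | 3 => exact_pfDiff_three h2 hX (hE 4 (by omega))
  | 4 => exact_pfDiff_four h2 hX (hE 5 (by omega))
  | 5 => exact_pfDiff_five h2 (hE 6 (by omega))
  | _ + 6 => fun _ => ⟨fun _ => ⟨0, funext fun a => Empty.elim a⟩, fun _ => rfl⟩

theorem exists_pfDiff_zero_eq_iff (h2 : IsUnit (2 : S)) (a : S) :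
    (∃ c, pfDiff X 0 c = fun _ => a) ↔ a ∈ pfaffianIdeal X := by
  constructor
  · rintro ⟨(c : Fin 15 → S), hc⟩
    exact ⟨skewOfₗ c, skewOfₗ_transpose c, (congrFun hc ()).symm⟩
  · rintro ⟨M, hM, rfl⟩
    refine ⟨skewReadₗ M, ?_⟩
    rw [pfDiff_zero, skewOfₗ_skewReadₗ h2 hM]

end Complex

/-! ### Internal degrees and minimality -/

section Grading

/-- The internal degrees of the basis elements of the terms of the Pfaffian complex, when the
entries of the matrix have degree `2`. -/
def pfDegree : ∀ i, PfTerm i → ℕ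
  | 0 => fun _ => 0
  | 1 => fun _ => 4
  | 2 => fun _ => 6
  | 3 => Sum.elim (fun _ => 8) (fun _ => 10)
  | 4 => fun _ => 12
  | 5 => fun _ => 14
  | 6 => fun _ => 18
  | _ + 7 => Empty.elim

variable {K : Type u} [Field K] {σ : Type}

/-- The element `p` of `R(-k)` is homogeneous of degree `n`. -/
def IsShiftedDegree (w : σ → ℕ) (k n : ℕ) (p : MvPolynomial σ K) : Prop :=
  ∀ s, coeff s p ≠ 0 → Finsupp.weight w s + k = n

variable {w : σ → ℕ} {k d n : ℕ}

namespace IsShiftedDegree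

theorem zero : IsShiftedDegree w k n (0 : MvPolynomial σ K) := fun s hs => absurd (coeff_zero s) hs

theorem neg {p : MvPolynomial σ K} (hp : IsShiftedDegree w k n p) : IsShiftedDegree w k n (-p) :=
  fun s hs => hp s fun h => hs (by rw [coeff_neg, h, neg_zero])

theorem add {p q : MvPolynomial σ K} (hp : IsShiftedDegree w k n p)
    (hq : IsShiftedDegree w k n q) : IsShiftedDegree w k n (p + q) := by
  intro s hs
  by_cases h : coeff s p = 0
  · exact hq s fun h' => hs (by rw [coeff_add, h, h', add_zero])
  · exact hp s h

theorem sub {p q : MvPolynomial σ K} (hp : IsShiftedDegree w k n p)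
    (hq : IsShiftedDegree w k n q) : IsShiftedDegree w k n (p - q) := by
  rw [sub_eq_add_neg]
  exact hp.add hq.neg

theorem sum {ι : Type*} (t : Finset ι) {p : ι → MvPolynomial σ K}
    (hp : ∀ i, IsShiftedDegree w k n (p i)) : IsShiftedDegree w k n (∑ i ∈ t, p i) :=
  Finset.sum_induction _ _ (fun _ _ => add) zero fun i _ => hp i

/-- Multiplication by an element of degree `d` is a degree-zero map from `R(-(k + d))` to `R(-k)`.
-/
theorem mul {p q : MvPolynomial σ K} (hp : IsShiftedDegree w (k + d) n p)
    (hq : IsWeightedHomogeneous w q d) : IsShiftedDegree w k n (p * q) := by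
  classical
  intro s hs
  rw [coeff_mul] at hs
  obtain ⟨⟨a, b⟩, hab, h⟩ := Finset.exists_ne_zero_of_sum_ne_zero hs
  rw [← Finset.HasAntidiagonal.mem_antidiagonal.1 hab, map_add, add_assoc, hq (right_ne_zero_of_mul h),
    add_comm d k]
  exact hp a (left_ne_zero_of_mul h)

end IsShiftedDegree

variable {Z W : Matrix (Fin 6) (Fin 6) (MvPolynomial σ K)}

theorem isShiftedDegree_mul_right (hZ : ∀ i j, IsShiftedDegree w (k + d) n (Z i j))
    (hW : ∀ i j, IsWeightedHomogeneous w (W i j) d) (i j : Fin 6) :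
    IsShiftedDegree w k n ((Z * W) i j) := by
  rw [Matrix.mul_apply]
  exact .sum _ fun l => (hZ i l).mul (hW l j)

theorem isShiftedDegree_mul_left (hZ : ∀ i j, IsShiftedDegree w (k + d) n (Z i j))
    (hW : ∀ i j, IsWeightedHomogeneous w (W i j) d) (i j : Fin 6) :
    IsShiftedDegree w k n ((W * Z) i j) := by
  rw [Matrix.mul_apply]
  refine .sum _ fun l => ?_
  rw [mul_comm]
  exact (hZ l j).mul (hW i l)

theorem pfAdj_mem_of_subPf_mem {S : Type*} [CommRing S] {N : AddSubgroup S}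
    {X : Matrix (Fin 6) (Fin 6) S} (h : ∀ a b c e, subPf X a b c e ∈ N) (i j : Fin 6) :
    pfAdj X i j ∈ N := by
  fin_cases i <;> fin_cases j <;> simp [pfAdj, h]

theorem isWeightedHomogeneous_pfAdj {X : Matrix (Fin 6) (Fin 6) (MvPolynomial σ K)}
    (hX : ∀ i j, IsWeightedHomogeneous w (X i j) 2) (i j : Fin 6) :
    IsWeightedHomogeneous w (pfAdj X i j) 4 := by
  have h : ∀ a b c e, subPf X a b c e ∈ weightedHomogeneousSubmodule K w 4 := fun a b c e =>
    add_mem (sub_mem ((hX a b).mul (hX c e)) ((hX a c).mul (hX b e))) ((hX a e).mul (hX b c))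
  exact pfAdj_mem_of_subPf_mem (N := (weightedHomogeneousSubmodule K w 4).toAddSubgroup) h i j

theorem isShiftedDegree_skewOfₗ {c : Fin 15 → MvPolynomial σ K}
    (hc : ∀ a, IsShiftedDegree w k n (c a)) (i j : Fin 6) :
    IsShiftedDegree w k n ((skewOfₗ c : Matrix (Fin 6) (Fin 6) (MvPolynomial σ K)) i j) := by
  fin_cases i <;> fin_cases j <;> first
    | exact hc _
    | exact (hc _).neg
    | exact .zero

theorem isShiftedDegree_skewReadₗ (hZ : ∀ i j, IsShiftedDegree w k n (Z i j)) (a : Fin 15) :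
    IsShiftedDegree w k n ((skewReadₗ Z : Fin 15 → MvPolynomial σ K) a) := by
  fin_cases a <;> exact hZ _ _

theorem isShiftedDegree_tracelessOfₗ {c : NonCorner → MvPolynomial σ K}
    (hc : ∀ a, IsShiftedDegree w k n (c a)) (i j : Fin 6) :
    IsShiftedDegree w k n ((tracelessOfₗ c : Matrix (Fin 6) (Fin 6) (MvPolynomial σ K)) i j) := by
  change IsShiftedDegree w k n (dite _ _ _)
  split_ifs
  · exact (IsShiftedDegree.sum _ fun _ => hc _).neg
  · exact hc _

theorem isShiftedDegree_cornerlessOfₗ {c : NonCorner → MvPolynomial σ K}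
    (hc : ∀ a, IsShiftedDegree w k n (c a)) (i j : Fin 6) :
    IsShiftedDegree w k n ((cornerlessOfₗ c : Matrix (Fin 6) (Fin 6) (MvPolynomial σ K)) i j) := by
  change IsShiftedDegree w k n (dite _ _ _)
  split_ifs
  · exact .zero
  · exact hc _

theorem isShiftedDegree_modScalarsₗ (hZ : ∀ i j, IsShiftedDegree w k n (Z i j)) (i j : Fin 6) :
    IsShiftedDegree w k n ((modScalarsₗ Z : Matrix (Fin 6) (Fin 6) (MvPolynomial σ K)) i j) := by
  change IsShiftedDegree w k n (Z i j - Z 5 5 * (1 : Matrix (Fin 6) (Fin 6) (MvPolynomial σ K)) i j)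
  refine (hZ i j).sub ?_
  rw [Matrix.one_apply]
  split_ifs
  · rw [mul_one]
    exact hZ 5 5
  · rw [mul_zero]
    exact .zero

/-- Each factor `X` accounts for a shift by 2 and each `pfAdj X` for a shift by 4. The two paths
through `Sym ⊕ Sym` agree: `6 + 2 + 4 = 6 + 4 + 2 = 12`. -/
theorem isShiftedDegree_pfDiff {X : Matrix (Fin 6) (Fin 6) (MvPolynomial σ K)}
    (hX : ∀ i j, IsWeightedHomogeneous w (X i j) 2) :
    ∀ (i : ℕ) (v : PfTerm (i + 1) → MvPolynomial σ K),
      (∀ a, IsShiftedDegree w (pfDegree (i + 1) a) n (v a)) →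
      ∀ a, IsShiftedDegree w (pfDegree i a) n (pfDiff X i v a)
  | 0, v, hv, _ => .sum _ fun l => isShiftedDegree_mul_right (k := 0) (d := 4)
      (isShiftedDegree_skewOfₗ hv) (isWeightedHomogeneous_pfAdj hX) l l
  | 1, v, hv, a => isShiftedDegree_skewReadₗ (fun i j =>
      (isShiftedDegree_mul_right (k := 4) (d := 2) (isShiftedDegree_tracelessOfₗ hv) hX i j).add
        (isShiftedDegree_mul_left (k := 4) (d := 2)
          (fun i j => isShiftedDegree_tracelessOfₗ hv j i) hX i j)) a
  | 2, v, hv, a => (isShiftedDegree_mul_left (Z := symmOfₗ (v ∘ Sum.inl)) (k := 6) (d := 2)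
      (fun i j => hv (Sum.inl s(i, j))) hX _ _).add
        (isShiftedDegree_mul_right (Z := symmOfₗ (v ∘ Sum.inr)) (k := 6) (d := 4)
          (fun i j => hv (Sum.inr s(i, j))) (isWeightedHomogeneous_pfAdj hX) _ _)
  | 3, v, hv, Sum.inl a => (isShiftedDegree_mul_left (k := 8) (d := 4)
      (fun i j => isShiftedDegree_cornerlessOfₗ hv j i) (isWeightedHomogeneous_pfAdj hX) _ _).sub
        (isShiftedDegree_mul_right (k := 8) (d := 4)
          (isShiftedDegree_cornerlessOfₗ hv) (isWeightedHomogeneous_pfAdj hX) _ _)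
  | 3, v, hv, Sum.inr a => (isShiftedDegree_mul_left (k := 10) (d := 2)
      (isShiftedDegree_cornerlessOfₗ hv) hX _ _).sub
        (isShiftedDegree_mul_right (k := 10) (d := 2)
          (fun i j => isShiftedDegree_cornerlessOfₗ hv j i) hX _ _)
  | 4, v, hv, a => isShiftedDegree_modScalarsₗ (isShiftedDegree_mul_right (k := 12) (d := 2)
      (isShiftedDegree_skewOfₗ hv) hX) _ _
  | 5, v, hv, a => by
      have h := isShiftedDegree_skewReadₗ (k := 14) (n := n) (w := w)
        (Z := v () • pfAdj X) (fun i j => (hv ()).mul (isWeightedHomogeneous_pfAdj hX i j)) a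
      rw [map_smul] at h
      exact h
  | _ + 6, v, hv, a => .zero

theorem mem_span_range_X_of_isShiftedDegree {p : MvPolynomial σ K} (hkn : k ≠ n)
    (hp : IsShiftedDegree w k n p) : p ∈ Ideal.span (Set.range (X : σ → MvPolynomial σ K)) := by
  rw [← Set.image_univ, mem_ideal_span_X_image]
  intro s hs
  by_contra! h
  have hs0 : s = 0 := Finsupp.ext fun i => h i (Set.mem_univ i)
  refine hkn ?_
  have := hp s (mem_support_iff.1 hs)
  rwa [hs0, map_zero, zero_add] at this

/-- Matrix entries of a graded map are homogeneous of degree the difference of the shifts; when no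
shifts coincide, no entry has a nonzero constant term. -/
theorem range_le_of_isShiftedDegree {ι κ : Type} [Fintype ι] [Fintype κ]
    (f : (ι → MvPolynomial σ K) →ₗ[MvPolynomial σ K] (κ → MvPolynomial σ K)) {e : ι → ℕ} {e' : κ → ℕ}
    (he : ∀ a b, e' b ≠ e a)
    (hf : ∀ n v, (∀ a, IsShiftedDegree w (e a) n (v a)) → ∀ b, IsShiftedDegree w (e' b) n (f v b)) :
    LinearMap.range f ≤ Ideal.span (Set.range (X : σ → MvPolynomial σ K)) •
      (⊤ : Submodule (MvPolynomial σ K) (κ → MvPolynomial σ K)) := by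
  classical
  have key : ∀ a, f (Pi.single a 1) ∈ Ideal.span (Set.range (X : σ → MvPolynomial σ K)) •
      (⊤ : Submodule (MvPolynomial σ K) (κ → MvPolynomial σ K)) := by
    intro a
    rw [pi_eq_sum_univ' (f (Pi.single a 1))]
    refine sum_mem fun b _ => Submodule.smul_mem_smul ?_ trivial
    refine mem_span_range_X_of_isShiftedDegree (he a b) (hf (e a) _ (fun a' => ?_) b)
    intro s hs
    by_cases h : a' = a
    · subst h
      rw [Pi.single_eq_same, coeff_one] at hs
      rw [← (ite_ne_right_iff.1 hs).1, map_zero, zero_add]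
    · rw [Pi.single_eq_of_ne h, coeff_zero] at hs
      exact absurd rfl hs
  rintro _ ⟨v, rfl⟩
  rw [pi_eq_sum_univ' v, map_sum]
  refine sum_mem fun a _ => ?_
  rw [map_smul]
  have h := Submodule.smul_mem _ (v a) (key a)
  convert h using 3

theorem exists_equiv_replicate_append {α β : Type} [Fintype α] [Fintype β] {p q : ℕ} (x y : ℕ)
    (hα : Fintype.card (Fin p) = Fintype.card α) (hβ : Fintype.card (Fin q) = Fintype.card β) :
    ∃ e : Fin (List.replicate p x ++ List.replicate q y).length ≃ α ⊕ β,
      ∀ a, Sum.elim (fun _ => x) (fun _ => y) (e a) =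
        (List.replicate p x ++ List.replicate q y).get a := by
  let e₀ : Fin p ⊕ Fin q ≃ Fin (List.replicate p x ++ List.replicate q y).length :=
    finSumFinEquiv.trans (finCongr (by simp))
  refine ⟨e₀.symm.trans ((Fintype.equivOfCardEq hα).sumCongr (Fintype.equivOfCardEq hβ)),
    fun a => ?_⟩
  obtain ⟨b | b, rfl⟩ := e₀.surjective a
  · simp [e₀]
  · simp [e₀]

theorem exists_equiv_pfTerm : ∀ i, ∃ e : Fin (sixLinearFormsShifts i).length ≃ PfTerm i,
    ∀ a, pfDegree i (e a) = (sixLinearFormsShifts i).get a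
  | 0 => ⟨Equiv.ofUnique (Fin 1) Unit, fun (a : Fin 1) => by fin_cases a; rfl⟩
  | 1 => ⟨finCongr List.length_replicate, fun a => (List.getElem_replicate _).symm⟩
  | 2 => ⟨(finCongr List.length_replicate).trans
      (Fintype.equivOfCardEq (α := Fin 35) (β := NonCorner) (by decide)), fun a => (List.getElem_replicate _).symm⟩
  | 3 => by
      have h21 : Fintype.card (Fin 21) = Fintype.card (Sym2 (Fin 6)) := by
        rw [Sym2.card, Fintype.card_fin, Fintype.card_fin]; rfl
      exact exists_equiv_replicate_append 8 10 h21 h21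
  | 4 => ⟨(finCongr List.length_replicate).trans
      (Fintype.equivOfCardEq (α := Fin 35) (β := NonCorner) (by decide)), fun a => (List.getElem_replicate _).symm⟩
  | 5 => ⟨finCongr List.length_replicate, fun a => (List.getElem_replicate _).symm⟩
  | 6 => ⟨Equiv.ofUnique (Fin 1) Unit, fun (a : Fin 1) => by fin_cases a; rfl⟩
  | _ + 7 => ⟨Equiv.equivOfIsEmpty (Fin 0) Empty, fun a => Fin.elim0 a⟩

theorem get_sixLinearFormsShifts_ne : ∀ (i : ℕ) (a : Fin (sixLinearFormsShifts (i + 1)).length)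
    (b : Fin (sixLinearFormsShifts i).length),
    (sixLinearFormsShifts i).get b ≠ (sixLinearFormsShifts (i + 1)).get a := by
  have h : ∀ (i : ℕ), ∀ x ∈ sixLinearFormsShifts (i + 1), ∀ y ∈ sixLinearFormsShifts i, y ≠ x
    | 0 | 1 | 2 | 3 | 4 | 5 | _ + 6 => by simp [sixLinearFormsShifts]
  exact fun i a b => h i _ (List.get_mem _ _) _ (List.get_mem _ _)

end Grading

/-! ### Projective dimension read off a minimal resolution -/

section ProjectiveDimension

open CategoryTheory

variable {R : Type u} [CommRing R]

theorem hasProjectiveDimensionLT_iff_ker {F N : Type u} [AddCommGroup F] [Module R F]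
    [AddCommGroup N] [Module R N] [Module.Projective R F] {f : F →ₗ[R] N}
    (hf : Function.Surjective f) (n : ℕ) :
    HasProjectiveDimensionLT (ModuleCat.of R N) (n + 2) ↔
      HasProjectiveDimensionLT (ModuleCat.of R (LinearMap.ker f)) (n + 1) := by
  have hS : (ShortComplex.mk (ModuleCat.ofHom (LinearMap.ker f).subtype) (ModuleCat.ofHom f)
      (by ext x; exact x.2)).ShortExact :=
    { exact := (ShortComplex.ShortExact.moduleCat_exact_iff_function_exact _).2
        (LinearMap.exact_subtype_ker_map f)
      mono_f := (ModuleCat.mono_iff_injective _).2 Subtype.val_injective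
      epi_g := (ModuleCat.epi_iff_surjective _).2 hf }
  exact hS.hasProjectiveDimensionLT_X₃_iff n
    ((IsProjective.iff_projective F).1 inferInstance)

theorem hasProjectiveDimensionLT_one_iff_projective {N : Type u} [AddCommGroup N] [Module R N] :
    HasProjectiveDimensionLT (ModuleCat.of R N) 1 ↔ Module.Projective R N := by
  rw [← projective_iff_hasProjectiveDimensionLT_one, IsProjective.iff_projective]

variable {M : Type u} [AddCommGroup M] [Module R M] {F : ℕ → Type u} [∀ i, AddCommGroup (F i)]
  [∀ i, Module R (F i)] [∀ i, Module.Projective R (F i)] {d : ∀ i, F (i + 1) →ₗ[R] F i}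
  {ε : F 0 →ₗ[R] M}

/-- Dimension shifting: the image of `d i` is the `(i + 1)`-st syzygy of `M`, and each syzygy lowers
the projective dimension bound by one. -/
theorem hasProjectiveDimensionLT_iff_range (hε : Function.Surjective ε)
    (h₀ : Function.Exact (d 0) ε) (hd : ∀ i, Function.Exact (d (i + 1)) (d i)) (i : ℕ) :
    ∀ k, HasProjectiveDimensionLT (ModuleCat.of R M) (k + 2 + i) ↔
      HasProjectiveDimensionLT (ModuleCat.of R (LinearMap.range (d i))) (k + 1) := by
  induction i with
  | zero =>
    intro k
    rw [← h₀.linearMap_ker_eq]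
    exact hasProjectiveDimensionLT_iff_ker hε k
  | succ i ih =>
    intro k
    rw [show k + 2 + (i + 1) = k + 1 + 2 + i by omega, ih (k + 1), ← (hd i).linearMap_ker_eq,
      ← LinearMap.ker_rangeRestrict (d i)]
    exact hasProjectiveDimensionLT_iff_ker (LinearMap.surjective_rangeRestrict (d i)) k

/-- A projective resolution whose last map is contained in an ideal times its target has
the length of the projective dimension. -/
theorem projectiveDimension_eq_of_minimal (hε : Function.Surjective ε)
    (h₀ : Function.Exact (d 0) ε) (hd : ∀ i, Function.Exact (d (i + 1)) (d i)) {n : ℕ}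
    [Subsingleton (F (n + 3))] {I : Ideal R} (hI : I • (⊤ : Submodule R (F (n + 2))) ≠ ⊤)
    (hmin : LinearMap.range (d (n + 1)) ≤ I • (⊤ : Submodule R (F (n + 1)))) :
    projectiveDimension (ModuleCat.of R M) = (n + 2 : ℕ) := by
  have hinj : Function.Injective (d (n + 1)) := by
    rw [← LinearMap.ker_eq_bot, (hd (n + 1)).linearMap_ker_eq, LinearMap.range_eq_bot]
    exact Subsingleton.elim _ _
  refine le_antisymm ?_ ?_
  · rw [projectiveDimension_le_iff]
    change HasProjectiveDimensionLT _ (n + 2 + 1)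
    rw [show n + 2 + 1 = 0 + 2 + (n + 1) by omega, hasProjectiveDimensionLT_iff_range hε h₀ hd,
      hasProjectiveDimensionLT_one_iff_projective]
    exact Module.Projective.of_equiv (LinearEquiv.ofInjective _ hinj)
  · rw [projectiveDimension_ge_iff, show n + 2 = 0 + 2 + n by omega,
      hasProjectiveDimensionLT_iff_range hε h₀ hd, hasProjectiveDimensionLT_one_iff_projective]
    intro hproj
    apply hI
    -- If the dimension were smaller, the image of `d n` would be projective. The resulting
    -- splitting gives a retraction `ρ` of the last map, and `ρ` carries `I F (n + 1)` into `I F (n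
    -- + 2)`, so `F (n + 2) = I F (n + 2)`.
    obtain ⟨s, hs⟩ := Module.projective_lifting_property (d n).rangeRestrict LinearMap.id
      (LinearMap.surjective_rangeRestrict (d n))
    have hmem : ∀ x, x - s ((d n).rangeRestrict x) ∈ LinearMap.range (d (n + 1)) := by
      intro x
      rw [← (hd n).linearMap_ker_eq, ← LinearMap.ker_rangeRestrict, LinearMap.mem_ker, map_sub,
        sub_eq_zero]
      exact (LinearMap.congr_fun hs _).symm
    let ρ : F (n + 1) →ₗ[R] F (n + 2) := (LinearEquiv.ofInjective _ hinj).symm.toLinearMap ∘ₗ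
      (LinearMap.id - s ∘ₗ (d n).rangeRestrict).codRestrict _ hmem
    have hρ : ∀ y, ρ (d (n + 1) y) = y := by
      intro y
      have h0 : (d n).rangeRestrict (d (n + 1) y) = 0 :=
        Subtype.ext ((hd n).apply_apply_eq_zero y)
      change (LinearEquiv.ofInjective _ hinj).symm _ = y
      rw [LinearEquiv.symm_apply_eq]
      refine Subtype.ext ?_
      change d (n + 1) y - s ((d n).rangeRestrict (d (n + 1) y)) = d (n + 1) y
      rw [h0, map_zero, sub_zero]
    rw [eq_top_iff]
    intro y _
    rw [← hρ y]
    have h := Submodule.mem_map_of_mem (f := ρ) (hmin ⟨y, rfl⟩)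
    rw [Submodule.map_smul''] at h
    exact Submodule.smul_mono le_rfl le_top h

end ProjectiveDimension

/-! ### The resolution over an arbitrary minimal set of generators -/

section Resolution

variable {K : Type u} [Field K] {m : ℕ} {w : Fin m → ℕ}
  {f : Fin m → linearFormsInvariants K 6}

theorem isWeightedHomogeneous_of_isHomogeneous_one {σ : Type} {w : σ → ℕ} {k : ℕ}
    (hw : ∀ i, w i = k) {p : MvPolynomial σ K} (hp : p.IsHomogeneous 1) :
    IsWeightedHomogeneous w p k := by
  intro s hs
  have h := hp hs
  rw [Finsupp.weight_apply, Finsupp.sum] at h ⊢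
  simp only [hw, smul_eq_mul, Pi.one_apply, mul_one] at h ⊢
  rw [← Finset.sum_mul, h, one_mul]

theorem isWeightedHomogeneous_skewOf {σ : Type} {w : σ → ℕ} {d : ℕ} {x : Fin 15 → MvPolynomial σ K}
    (hx : ∀ k, IsWeightedHomogeneous w (x k) d) (i j : Fin 6) :
    IsWeightedHomogeneous w (skewOf x i j) d := by
  have hx' : ∀ k, x k ∈ weightedHomogeneousSubmodule K w d := hx
  change skewOf x i j ∈ weightedHomogeneousSubmodule K w d
  fin_cases i <;> fin_cases j <;> first
    | exact hx' _
    | exact neg_mem (hx' _)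
    | exact zero_mem _

theorem isHomogeneous_aeval_of_isWeightedHomogeneous {σ τ : Type} {w : σ → ℕ} {n : ℕ}
    {g : σ → MvPolynomial τ K} (hg : ∀ i, (g i).IsHomogeneous (w i)) {p : MvPolynomial σ K}
    (hp : IsWeightedHomogeneous w p n) : (aeval g p).IsHomogeneous n := by
  rw [aeval_def, eval₂_eq]
  refine IsHomogeneous.sum _ _ _ fun s hs => ?_
  have h : (∏ i ∈ s.support, g i ^ s i).IsHomogeneous (∑ i ∈ s.support, w i * s i) :=
    IsHomogeneous.prod _ _ _ fun i _ => (hg i).pow _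
  rw [algebraMap_eq, ← hp (mem_support_iff.1 hs), Finsupp.weight_apply, Finsupp.sum]
  simp only [smul_eq_mul, mul_comm (s _)]
  exact h.C_mul _

theorem exists_minimalGradedFreeResolution [CharZero K]
    (hf : IsMinimalHomogeneousGenerators (linearFormsInvariants K 6) w f) :
    ∃ F : MinimalGradedFreeResolution w (linearFormsInvariants K 6) (aeval f)
        sixLinearFormsShifts,
      ∀ v : ShiftedFree K (Fin m) (sixLinearFormsShifts 0),
        F.ε v = aeval f (v (0 : Fin 1)) := by
  obtain ⟨Θ, hΘ, hΘ1⟩ := exists_linear_coordinates hf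
  choose e he using exists_equiv_pfTerm
  let x : Fin 15 → MvPolynomial (Fin m) K := fun k => Θ.symm (X k)
  have hx : ∀ k, IsWeightedHomogeneous w (x k) 2 := fun k =>
    isWeightedHomogeneous_of_isHomogeneous_one (weight_eq_two_of_minimal hf) (hΘ1 k)
  have h2 : IsUnit (2 : MvPolynomial (Fin m) K) := isUnit_two_of_algebra K _
  -- Composing the linear substitution `Θ` with `sectionCoordinates` puts `skewOf x` in the form of
  -- a displaced section.
  have hE : ∀ i, 1 ≤ i → PfaffianExactAt (skewOf x) i := fun i hi =>
    exactAt_adapted h2 (isUnit_two_of_algebra K _)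
      (Θ.toRingEquiv.trans (sectionCoordinates K)) (c := sectionConstants K)
      (fun k => by
        rw [← sectionCoordinates_X K k]
        exact congrArg (sectionCoordinates K) (Θ.apply_symm_apply (X k))) hi
  have hker : ∀ r, aeval f r = 0 ↔ r ∈ pfaffianIdeal (skewOf x) := by
    intro r
    rw [← Subtype.coe_inj, hΘ]
    constructor
    · intro h
      have h' := map_mem_pfaffianIdeal Θ.symm.toRingEquiv.toRingHom
        (mem_pfaffianIdeal_of_aeval_plucker_eq_zero h)
      rw [mapMatrix_skewOf] at h'
      change Θ.symm (Θ r) ∈ pfaffianIdeal (skewOf x) at h'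
      rwa [Θ.symm_apply_apply] at h'
    · intro h
      have h' := map_mem_pfaffianIdeal Θ.toRingEquiv.toRingHom h
      rw [mapMatrix_skewOf] at h'
      change Θ r ∈ pfaffianIdeal (skewOf fun k => Θ (Θ.symm (X k))) at h'
      simp only [Θ.apply_symm_apply] at h'
      exact aeval_plucker_eq_zero h'
  have hgr : ∀ i n (v : ShiftedFree K (Fin m) (sixLinearFormsShifts (i + 1))), IsDegree w n v →
      IsDegree w n (fun a => pfDiff (skewOf x) i (v ∘ (e (i + 1)).symm) (e i a)) := by
    intro i n v hv a
    rw [← he i a]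
    refine isShiftedDegree_pfDiff (isWeightedHomogeneous_skewOf hx) i _ (fun b => ?_) (e i a)
    obtain ⟨b, rfl⟩ := (e (i + 1)).surjective b
    rw [he (i + 1) b]
    simp only [Function.comp_apply, Equiv.symm_apply_apply]
    exact hv b
  refine ⟨{
    d := fun i => (LinearEquiv.funCongrLeft _ _ (e i)).toLinearMap ∘ₗ pfDiff (skewOf x) i ∘ₗ
      (LinearEquiv.funCongrLeft _ _ (e (i + 1)).symm).toLinearMap
    ε :=
      { toFun := fun v => aeval f (v (0 : Fin 1))
        map_add' := fun v v' => map_add (aeval f) _ _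
        map_smul' := fun r v => map_mul (aeval f) _ _ }
    d_graded := hgr
    ε_graded := ?_
    ε_surjective := ?_
    exact_zero := ?_
    exact_succ := ?_
    minimal := ?_ }, fun v => rfl⟩
  · intro n v hv
    have h : IsWeightedHomogeneous w (v (0 : Fin 1)) n := fun s hs => hv (0 : Fin 1) s hs
    have := isHomogeneous_aeval_of_isWeightedHomogeneous hf.homogeneous h
    have hc : ((aeval f (v (0 : Fin 1)) : linearFormsInvariants K 6) :
        MvPolynomial (Fin 6 × Fin 2) K) = aeval (fun i => (f i : MvPolynomial _ K)) (v (0 : Fin 1)) :=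
      (comp_aeval_apply (f := f) (linearFormsInvariants K 6).val (v (0 : Fin 1)))
    exact hc ▸ this
  · intro a
    have ha : a ∈ Algebra.adjoin K (Set.range f) := hf.generates ▸ Algebra.mem_top
    rw [Algebra.adjoin_range_eq_range_aeval] at ha
    obtain ⟨r, hr⟩ := ha
    exact ⟨fun _ => r, hr⟩
  · intro v
    change aeval f (v (0 : Fin 1)) = 0 ↔ _
    rw [hker, ← exists_pfDiff_zero_eq_iff h2]
    constructor
    · rintro ⟨c, hc⟩
      refine ⟨c ∘ e 1, funext fun (a : Fin 1) => ?_⟩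
      change pfDiff (skewOf x) 0 ((c ∘ e 1) ∘ (e 1).symm) (e 0 a) = v a
      rw [Function.comp_assoc, Equiv.self_comp_symm, Function.comp_id, hc, Subsingleton.elim a 0]
    · rintro ⟨c, rfl⟩
      exact ⟨c ∘ (e 1).symm, funext fun (a : Unit) => rfl⟩
  · intro i v
    have := exact_pfDiff h2 (skewOf_transpose x) hE i (v ∘ (e (i + 1)).symm)
    constructor
    · intro h
      have h' : pfDiff (skewOf x) i (v ∘ (e (i + 1)).symm) = 0 :=
        (LinearEquiv.funCongrLeft (MvPolynomial (Fin m) K) (MvPolynomial (Fin m) K)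
          (e i)).map_eq_zero_iff.1 h
      obtain ⟨c, hc⟩ := this.1 h'
      refine ⟨c ∘ e (i + 2), funext fun a => ?_⟩
      change pfDiff (skewOf x) (i + 1) ((c ∘ e (i + 2)) ∘ (e (i + 2)).symm) (e (i + 1) a) = v a
      rw [Function.comp_assoc, Equiv.self_comp_symm, Function.comp_id, hc, Function.comp_apply,
        Equiv.symm_apply_apply]
    · rintro ⟨c, rfl⟩
      have h' := this.2 ⟨c ∘ (e (i + 2)).symm, funext fun b => ?_⟩
      · exact congrArg (LinearEquiv.funCongrLeft (MvPolynomial (Fin m) K) (MvPolynomial (Fin m) K)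
          (e i)) h'
      · exact congrArg (pfDiff (skewOf x) (i + 1) (c ∘ (e (i + 2)).symm))
          ((e (i + 1)).apply_symm_apply b).symm
  · intro i
    exact range_le_of_isShiftedDegree _ (get_sixLinearFormsShifts_ne i) (hgr i)

theorem span_range_X_ne_top {σ : Type} :
    Ideal.span (Set.range (X : σ → MvPolynomial σ K)) ≠ ⊤ := by
  rw [Ne, Ideal.eq_top_iff_one, ← Set.image_univ, mem_ideal_span_X_image]
  intro h
  obtain ⟨i, -, hi⟩ := h 0 (by simp)
  exact hi rfl

theorem smul_top_pi_ne_top {R ι : Type*} [CommRing R] [Nonempty ι] {I : Ideal R} (hI : I ≠ ⊤) :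
    I • (⊤ : Submodule R (ι → R)) ≠ ⊤ := by
  intro h
  apply hI
  have i : ι := Classical.arbitrary ι
  rw [Ideal.eq_top_iff_one]
  have h1 : (1 : ι → R) ∈ I • (⊤ : Submodule R (ι → R)) := h.symm ▸ Submodule.mem_top
  have h2 := Submodule.mem_map_of_mem (f := LinearMap.proj i) h1
  rw [Submodule.map_smul''] at h2
  exact Ideal.mul_le_left h2

theorem homologicalDimension_eq_six (F : MinimalGradedFreeResolution w (linearFormsInvariants K 6)
    (aeval f) sixLinearFormsShifts) :
    homologicalDimension
      ((aeval f : MvPolynomial (Fin m) K →ₐ[K] linearFormsInvariants K 6) :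
        MvPolynomial (Fin m) K →+* linearFormsInvariants K 6) = 6 := by
  let : Module (MvPolynomial (Fin m) K) (linearFormsInvariants K 6) :=
    Module.compHom _ ((aeval f : MvPolynomial (Fin m) K →ₐ[K] linearFormsInvariants K 6) :
        MvPolynomial (Fin m) K →+* linearFormsInvariants K 6)
  let ε : ShiftedFree K (Fin m) (sixLinearFormsShifts 0) →ₗ[MvPolynomial (Fin m) K]
      linearFormsInvariants K 6 :=
    { toFun := F.ε
      map_add' := map_add F.ε
      map_smul' := F.ε.map_smulₛₗ }
  have : Subsingleton (ShiftedFree K (Fin m) (sixLinearFormsShifts (4 + 3))) :=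
    inferInstanceAs (Subsingleton (Fin 0 → MvPolynomial (Fin m) K))
  have : Nonempty (Fin (sixLinearFormsShifts (4 + 2)).length) := ⟨(0 : Fin 1)⟩
  -- With `n = 4`, the last nonzero term is number 6, of rank one, the term number 7 is zero, and
  -- `F.minimal 5` concerns the last map.
  have h := projectiveDimension_eq_of_minimal (n := 4)
    (F := fun i => ShiftedFree K (Fin m) (sixLinearFormsShifts i)) (ε := ε) F.ε_surjective
    F.exact_zero F.exact_succ (smul_top_pi_ne_top span_range_X_ne_top) (F.minimal 5)
  exact h

end Resolution

theorem mainTheorem3 (K : Type u) [Field K] [CharZero K] :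
    (∃ (m : ℕ) (w : Fin m → ℕ) (f : Fin m → linearFormsInvariants K 6),
      IsMinimalHomogeneousGenerators (linearFormsInvariants K 6) w f) ∧
    ∀ (m : ℕ) (w : Fin m → ℕ) (f : Fin m → linearFormsInvariants K 6),
      IsMinimalHomogeneousGenerators (linearFormsInvariants K 6) w f →
      (∃ F : MinimalGradedFreeResolution w (linearFormsInvariants K 6) (aeval f)
          sixLinearFormsShifts,
        ∀ v : ShiftedFree K (Fin m) (sixLinearFormsShifts 0),
          F.ε v = aeval f (v (0 : Fin 1))) ∧
      homologicalDimension
        ((aeval f : MvPolynomial (Fin m) K →ₐ[K] linearFormsInvariants K 6) :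
          MvPolynomial (Fin m) K →+* linearFormsInvariants K 6) = 6 := by
  refine ⟨⟨15, _, _, exists_minimalGenerators⟩, fun m w f hf => ?_⟩
  obtain ⟨F, hF⟩ := exists_minimalGradedFreeResolution hf
  exact ⟨⟨F, hF⟩, homologicalDimension_eq_six F⟩
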